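/- Let $\Omega_0=\Omega_1=[0,1]$ with Lebesgue measure $\mu$, and let $\Omega^2=\Omega_0\times\Omega_1$ with the product measure. For a Polish space $X$ and a probability space $\Omega'$ let $X^{\Omega'}=L^0(\Omega',X)$ be the space of $X$-valued random variables up to almost everywhere equality; $X^{\Omega}$ denotes $X^{\Omega_0}$, seen inside $X^{\Omega^2}$ via the projection $\Omega^2\to\Omega_0$. If $d$ is a bounded metric on $X$, then $X^{\Omega'}$ carries the metric $d^{\Omega'}(r,s)=\int d(r(\omega),s(\omega))\,d\mu$; for a Polish group $G$, the group $G^{\Omega'}$ (pointwise multiplication) carries the topology of convergence in measure. Let $\mathrm{Aut}(\Omega')$ be the group of invertible measure-preserving transformations of $\Omega'$ up to almost everywhere equality, acting on $X^{\Omega'}$ by $(tr)(\omega)=r(t^{-1}\omega)$, with the topology of pointwise convergence on $[0,1]^{\Omega'}$, and let $G\wr\Omega'=G^{\Omega'}\rtimes\mathrm{Aut}(\Omega')$ with the product topology. Let $M$ be a separable metric structure (continuous logic, countable language) that is separably categorical and stable, let $N\prec M$ be an elementary substructure, and let $G=\mathrm{Aut}(M)$, $\mathrm{Aut}(N)$ have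 the topology of pointwise convergence. Let $M^R$ be the Borel randomization of $M$ based on $\Omega^2$: the two-sorted metric structure with main sort $M^{\Omega^2}$, auxiliary sort $[0,1]^{\Omega^2}$, the functions $[\![\varphi]\!]:(M^{\Omega^2})^n\to[0,1]^{\Omega^2}$, $[\![\varphi(r)]\!](\omega)=\varphi(r(\omega))$, for all formulas $\varphi$, and on the auxiliary sort the expectation and the arithmetic operations $1-R$, $R/2$, $\max(R-S,0)$. Let $$G^R_P=\mathrm{Aut}\big((M^{\Omega^2},N^\Omega)_{\mathbb A_P}\big)$$ be the group of all automorphisms of $M^R$ that fix $N^\Omega$ and $[0,1]^{\Omega}$ setwise, with the topology of pointwise convergence (on both sorts). The group $G^{\Omega^2}$ acts on $M^{\Omega^2}$ by $(gr)(\omega)=g(\omega)(r(\omega))$ and trivially on $[0,1]^{\Omega^2}$. Let $$G_P^*=\{g\in G^{\Omega^2}: g|_{N^\Omega}\in\mathrm{Aut}(N)^{\Omega}\}.$$ Then $G_P^*=(G_P)^{\Omega^2}\cap G^R_P$, where $G_P=\{g\in G: g(N)=N\}$, and $$G^R_P\;\simeq\;G_P^*\rtimes(\mathrm{Aut}(\Omega_1)\wr\Omega_0)$$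 as topological groups, where the semidirect product carries the product topology. More precisely, there is a homomorphism $\iota:\mathrm{Aut}(\Omega_1)\wr\Omega_0\to\mathrm{Aut}(\Omega^2)$ such that for $h\in\mathrm{Aut}(\Omega_1)^{\Omega_0}$, $e\in\mathrm{Aut}(\Omega_0)$ and $R\in[0,1]^{\Omega^2}$ one has $(\iota(h,e)R)(\omega_0,\cdot)=h(\omega_0)\,R(e^{-1}(\omega_0),\cdot)$ for almost every $\omega_0$; the group $\mathrm{Aut}(\Omega_1)\wr\Omega_0$ acts continuously on $G_P^*$ by the automorphisms $g\mapsto \iota(x)\cdot g=g\circ\iota(x)^{-1}$; and, for this action, there is an isomorphism of topological groups $G_P^*\rtimes(\mathrm{Aut}(\Omega_1)\wr\Omega_0)\to G^R_P$ which sends $(g,x)$ to the automorphism $r\mapsto g(\iota(x)r)$, $R\mapsto\iota(x)R$. -/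

import Mathlib

open MeasureTheory Topology

universe u v w

namespace MetricLogic

noncomputable section

/-! ## Continuous first-order logic (one sort, truth values in `[0,1]`) -/

/-- A one-sorted language of continuous logic: function and predicate symbols, each of them with a
modulus of uniform continuity. -/
structure Language where
  Functions : ℕ → Type u
  Relations : ℕ → Type u
  funModulus : ∀ {n : ℕ}, Functions n → ℝ → ℝ
  relModulus : ∀ {n : ℕ}, Relations n → ℝ → ℝ
  funModulus_pos : ∀ {n : ℕ} (f : Functions n) (ε : ℝ), 0 < ε → 0 < funModulus f ε
  relModulus_pos : ∀ {n : ℕ} (R : Relations n) (ε : ℝ), 0 < ε → 0 < relModulus R ε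

/-- The language has countably many non-logical symbols. -/
def Language.IsCountable (L : Language.{u}) : Prop :=
  (∀ n, Countable (L.Functions n)) ∧ (∀ n, Countable (L.Relations n))

/-- A metric structure: a nonempty complete metric space of diameter at most `1`, with
interpretations of the symbols that respect the moduli of uniform continuity. -/
structure Structure (L : Language.{u}) where
  Carrier : Type w
  [metric : MetricSpace Carrier]
  [complete : CompleteSpace Carrier]
  [nonempty : Nonempty Carrier]
  dist_le_one : ∀ x y : Carrier, dist x y ≤ 1
  funMap : ∀ {n : ℕ}, L.Functions n → (Fin n → Carrier) → Carrier
  relMap : ∀ {n : ℕ}, L.Relations n → (Fin n → Carrier) → unitInterval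
  funMap_unif : ∀ {n : ℕ} (f : L.Functions n) (ε : ℝ), 0 < ε → ∀ x y : Fin n → Carrier,
    (∀ i, dist (x i) (y i) < L.funModulus f ε) → dist (funMap f x) (funMap f y) ≤ ε
  relMap_unif : ∀ {n : ℕ} (R : L.Relations n) (ε : ℝ), 0 < ε → ∀ x y : Fin n → Carrier,
    (∀ i, dist (x i) (y i) < L.relModulus R ε) → dist (relMap R x) (relMap R y) ≤ ε

namespace Structure

variable {L : Language.{u}}

instance : CoeSort (Structure.{u, w} L) (Type w) := ⟨Structure.Carrier⟩

instance (M : Structure.{u, w} L) : MetricSpace M := M.metric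
instance (M : Structure.{u, w} L) : CompleteSpace M := M.complete
instance (M : Structure.{u, w} L) : Nonempty M := M.nonempty

instance (M : Structure.{u, w} L) : BoundedSpace M :=
  ⟨Metric.isBounded_iff.2 ⟨1, fun x _ y _ => M.dist_le_one x y⟩⟩

end Structure

/-- Terms with free variables among `x_0, …, x_{n-1}`. -/
inductive Term (L : Language.{u}) (n : ℕ) : Type u
  | var (i : Fin n) : Term L n
  | app {k : ℕ} (f : L.Functions k) (ts : Fin k → Term L n) : Term L n

/-- Formulas with free variables among `x_0, …, x_{n-1}`. The connectives are all continuous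
functions `[0,1]^k → [0,1]`, the quantifiers are `sup` and `inf`; they bind the last variable. -/
inductive Formula (L : Language.{u}) : ℕ → Type u
  | dist {n : ℕ} (t s : Term L n) : Formula L n
  | rel {n k : ℕ} (R : L.Relations k) (ts : Fin k → Term L n) : Formula L n
  | conn {n k : ℕ} (c : C(Fin k → unitInterval, unitInterval)) (φs : Fin k → Formula L n) :
      Formula L n
  | sup {n : ℕ} (φ : Formula L (n + 1)) : Formula L n
  | inf {n : ℕ} (φ : Formula L (n + 1)) : Formula L n

section Semantics

variable {L : Language.{u}}

/-- The value of a term in a structure. -/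
def Term.eval (M : Structure.{u, w} L) {n : ℕ} (a : Fin n → M) : Term L n → M
  | .var i => a i
  | .app f ts => M.funMap f (fun i => (ts i).eval M a)

/-- The value of a formula in a structure. -/
def Formula.eval (M : Structure.{u, w} L) : {n : ℕ} → Formula L n → (Fin n → M) → unitInterval
  | _, .dist t s, a => ⟨Dist.dist (t.eval M a) (s.eval M a), dist_nonneg, M.dist_le_one _ _⟩
  | _, .rel R ts, a => M.relMap R (fun i => (ts i).eval M a)
  | _, .conn c φs, a => c (fun i => (φs i).eval M a)
  | _, .sup φ, a => ⨆ b : M, φ.eval M (Fin.snoc (α := fun _ => M) a b)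
  | _, .inf φ, a => ⨅ b : M, φ.eval M (Fin.snoc (α := fun _ => M) a b)

theorem Term.eval_uniformContinuous (M : Structure.{u, w} L) {n : ℕ} (t : Term L n) :
    UniformContinuous (fun a : Fin n → M => t.eval M a) := by
  induction t with
  | var i => exact Pi.uniformContinuous_proj _ i
  | @app k f ts ih =>
    have h1 : UniformContinuous (fun x : Fin k → M => M.funMap f x) := by
      rw [Metric.uniformContinuous_iff]
      intro ε hε
      refine ⟨L.funModulus f (ε / 2), L.funModulus_pos f _ (by linarith), fun x y hxy => ?_⟩
      have := M.funMap_unif f (ε / 2) (by linarith) x y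
        (fun i => lt_of_le_of_lt (dist_le_pi_dist x y i) hxy)
      linarith
    exact h1.comp (uniformContinuous_pi.2 ih)

theorem dist_iSup_le {ι : Type*} [Nonempty ι] (f g : ι → unitInterval) (ε : ℝ)
    (h : ∀ i, dist (f i) (g i) ≤ ε) : dist (⨆ i, f i) (⨆ i, g i) ≤ ε := by
  have key : ∀ f g : ι → unitInterval, (∀ i, dist (f i) (g i) ≤ ε) →
      ((⨆ i, f i : unitInterval) : ℝ) ≤ ((⨆ i, g i : unitInterval) : ℝ) + ε := by
    intro f g h
    rw [Set.Icc.coe_iSup zero_le_one (S := f)]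
    refine ciSup_le fun i => ?_
    have h1 := h i
    rw [Subtype.dist_eq, Real.dist_eq] at h1
    have h2 : (g i : ℝ) ≤ ((⨆ i, g i : unitInterval) : ℝ) := le_iSup g i
    have := (abs_le.1 h1).2
    linarith
  have h1 := key f g h
  have h2 := key g f (fun i => by rw [dist_comm]; exact h i)
  rw [Subtype.dist_eq, Real.dist_eq, abs_le]
  constructor <;> linarith

theorem dist_iInf_le {ι : Type*} [Nonempty ι] (f g : ι → unitInterval) (ε : ℝ)
    (h : ∀ i, dist (f i) (g i) ≤ ε) : dist (⨅ i, f i) (⨅ i, g i) ≤ ε := by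
  have key : ∀ f g : ι → unitInterval, (∀ i, dist (f i) (g i) ≤ ε) →
      ((⨅ i, f i : unitInterval) : ℝ) - ε ≤ ((⨅ i, g i : unitInterval) : ℝ) := by
    intro f g h
    rw [Set.Icc.coe_iInf zero_le_one (S := g)]
    refine le_ciInf fun i => ?_
    have h1 := h i
    rw [Subtype.dist_eq, Real.dist_eq] at h1
    have h2 : ((⨅ i, f i : unitInterval) : ℝ) ≤ (f i : ℝ) := iInf_le f i
    have := (abs_le.1 h1).2
    linarith
  have h1 := key f g h
  have h2 := key g f (fun i => by rw [dist_comm]; exact h i)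
  rw [Subtype.dist_eq, Real.dist_eq, abs_le]
  constructor <;> linarith

theorem dist_snoc_le {X : Type*} [PseudoMetricSpace X] {n : ℕ} (a a' : Fin n → X) (b : X) :
    dist (Fin.snoc (α := fun _ => X) a b) (Fin.snoc (α := fun _ => X) a' b) ≤ dist a a' := by
  refine (dist_pi_le_iff dist_nonneg).2 fun i => ?_
  refine Fin.lastCases ?_ (fun j => ?_) i
  · simp
  · simpa using dist_le_pi_dist a a' j

theorem Formula.eval_uniformContinuous (M : Structure.{u, w} L) {n : ℕ} (φ : Formula L n) :
    UniformContinuous (fun a : Fin n → M => φ.eval M a) := by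
  induction φ with
  | dist t s =>
    exact UniformContinuous.subtype_mk
      ((t.eval_uniformContinuous M).dist (s.eval_uniformContinuous M)) _
  | @rel n k R ts =>
    have h1 : UniformContinuous (fun x : Fin k → M => M.relMap R x) := by
      rw [Metric.uniformContinuous_iff]
      intro ε hε
      refine ⟨L.relModulus R (ε / 2), L.relModulus_pos R _ (by linarith), fun x y hxy => ?_⟩
      have := M.relMap_unif R (ε / 2) (by linarith) x y
        (fun i => lt_of_le_of_lt (dist_le_pi_dist x y i) hxy)
      linarith
    exact h1.comp (uniformContinuous_pi.2 fun i => (ts i).eval_uniformContinuous M)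
  | conn c φs ih =>
    exact (CompactSpace.uniformContinuous_of_continuous c.continuous).comp
      (uniformContinuous_pi.2 ih)
  | sup φ ih =>
    rw [Metric.uniformContinuous_iff] at ih ⊢
    intro ε hε
    obtain ⟨δ, hδ, h⟩ := ih (ε / 2) (by linarith)
    refine ⟨δ, hδ, fun a a' haa' => ?_⟩
    have := dist_iSup_le (fun b : M => φ.eval M (Fin.snoc (α := fun _ => M) a b))
      (fun b : M => φ.eval M (Fin.snoc (α := fun _ => M) a' b)) (ε / 2)
      (fun b => (h (lt_of_le_of_lt (dist_snoc_le a a' b) haa')).le)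
    exact lt_of_le_of_lt this (by linarith)
  | inf φ ih =>
    rw [Metric.uniformContinuous_iff] at ih ⊢
    intro ε hε
    obtain ⟨δ, hδ, h⟩ := ih (ε / 2) (by linarith)
    refine ⟨δ, hδ, fun a a' haa' => ?_⟩
    have := dist_iInf_le (fun b : M => φ.eval M (Fin.snoc (α := fun _ => M) a b))
      (fun b : M => φ.eval M (Fin.snoc (α := fun _ => M) a' b)) (ε / 2)
      (fun b => (h (lt_of_le_of_lt (dist_snoc_le a a' b) haa')).le)
    exact lt_of_le_of_lt this (by linarith)

end Semantics

namespace Structure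

variable {L : Language.{u}}

/-- `M` and `M'` have the same theory: every sentence has the same value in both. -/
def ElemEquiv (M M' : Structure.{u, w} L) : Prop :=
  ∀ φ : Formula L 0, φ.eval M' Fin.elim0 = φ.eval M Fin.elim0

/-- `e` is an isomorphism of metric structures. -/
def IsIso (M M' : Structure.{u, w} L) (e : M ≃ M') : Prop :=
  (∀ x y : M, dist (e x) (e y) = dist x y) ∧
  (∀ (n : ℕ) (f : L.Functions n) (a : Fin n → M), e (M.funMap f a) = M'.funMap f (e ∘ a)) ∧
  (∀ (n : ℕ) (R : L.Relations n) (a : Fin n → M), M'.relMap R (e ∘ a) = M.relMap R a)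

/-- `M` is separably categorical: every separable model of the theory of `M` is isomorphic
to `M`. -/
def IsSeparablyCategorical (M : Structure.{u, w} L) : Prop :=
  ∀ M' : Structure.{u, w} L, TopologicalSpace.SeparableSpace M' → M.ElemEquiv M' →
    ∃ e : M ≃ M', M.IsIso M' e

/-- `M` is stable, that is, all formulas `φ(x, y)`, with `x` and `y` finite tuples of variables, are
stable for the theory of `M`: for no `ε > 0` there are tuples `a_i, b_i`, `i ∈ ℕ`, in a model of
this theory, such that `|φ(a_i, b_j) - φ(a_j, b_i)| ≥ ε` for all `i < j`. -/
def IsStable (M : Structure.{u, w} L) : Prop :=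
  ∀ (n m : ℕ) (φ : Formula L (n + m)) (ε : ℝ), 0 < ε →
    ∀ M' : Structure.{u, w} L, M.ElemEquiv M' →
      ¬ ∃ (a : ℕ → Fin n → M') (b : ℕ → Fin m → M'), ∀ i j : ℕ, i < j →
        ε ≤ |(φ.eval M' (Fin.append (a i) (b j)) : ℝ) - (φ.eval M' (Fin.append (a j) (b i)) : ℝ)|

/-- A substructure of a metric structure: a nonempty closed subset, closed under the functions. -/
structure Substructure (M : Structure.{u, w} L) where
  carrier : Set M
  isClosed_carrier : IsClosed carrier
  nonempty_carrier : carrier.Nonempty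
  funMap_mem : ∀ {n : ℕ} (f : L.Functions n) (a : Fin n → M),
    (∀ i, a i ∈ carrier) → M.funMap f a ∈ carrier

/-- A substructure as a structure in its own right. -/
def Substructure.toStructure {M : Structure.{u, w} L} (N : M.Substructure) : Structure.{u, w} L where
  Carrier := N.carrier
  complete := N.isClosed_carrier.completeSpace_coe
  nonempty := N.nonempty_carrier.to_subtype
  dist_le_one x y := M.dist_le_one x y
  funMap f a := ⟨M.funMap f (fun i => (a i : M)), N.funMap_mem f _ fun i => (a i).2⟩
  relMap R a := M.relMap R (fun i => (a i : M))
  funMap_unif f ε hε _ _ h := M.funMap_unif f ε hε _ _ h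
  relMap_unif R ε hε _ _ h := M.relMap_unif R ε hε _ _ h

/-- The inclusion of a substructure. -/
def Substructure.incl {M : Structure.{u, w} L} (N : M.Substructure) : N.toStructure → M :=
  fun x => (x : N.carrier).1

theorem Substructure.continuous_incl {M : Structure.{u, w} L} (N : M.Substructure) :
    Continuous N.incl :=
  continuous_subtype_val (p := fun x : M => x ∈ N.carrier)

/-- `N ≺ M`: all formulas have the same values in `N` and in `M`. -/
def Substructure.IsElementary {M : Structure.{u, w} L} (N : M.Substructure) : Prop :=
  ∀ (n : ℕ) (φ : Formula L n) (a : Fin n → N.toStructure),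
    φ.eval M (fun i => N.incl (a i)) = φ.eval N.toStructure a

end Structure

/-! ## Groups of isometries with the topology of pointwise convergence -/

/-- A group acting by isometries, with the topology of pointwise convergence, is a topological
group. -/
theorem isTopologicalGroup_of_pointwise {G X : Type*} [Group G] [TopologicalSpace G]
    [PseudoMetricSpace X] [MulAction G X] (hd : ∀ (g : G) (x y : X), dist (g • x) (g • y) = dist x y)
    (ht : IsInducing (fun (g : G) (x : X) => g • x)) : IsTopologicalGroup G := by
  have hc : ∀ x : X, Continuous fun g : G => g • x := fun x =>
    (continuous_apply x).comp ht.continuous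
  refine { continuous_mul := ?_, continuous_inv := ?_ }
  · rw [ht.continuous_iff, continuous_pi_iff]
    intro x
    rw [continuous_iff_continuousAt]
    rintro ⟨g, h⟩
    rw [ContinuousAt, tendsto_iff_dist_tendsto_zero]
    have h1 : Filter.Tendsto (fun p : G × G => dist (p.2 • x) (h • x) + dist (p.1 • h • x) (g • h • x))
        (𝓝 (g, h)) (𝓝 0) := by
      have := (((hc x).comp continuous_snd).dist (continuous_const (y := h • x))).add
        (((hc (h • x)).comp continuous_fst).dist (continuous_const (y := g • h • x)))
      simpa [Pi.add_def] using this.tendsto (g, h)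
    refine squeeze_zero (fun _ => dist_nonneg) (fun p => ?_) h1
    show dist ((p.1 * p.2) • x) ((g * h) • x) ≤ _
    rw [mul_smul, mul_smul]
    refine (dist_triangle _ (p.1 • h • x) _).trans ?_
    rw [hd]
  · rw [ht.continuous_iff, continuous_pi_iff]
    intro x
    rw [continuous_iff_continuousAt]
    intro g
    rw [ContinuousAt, tendsto_iff_dist_tendsto_zero]
    have h1 : Filter.Tendsto (fun p : G => dist (g • g⁻¹ • x) (p • g⁻¹ • x)) (𝓝 g) (𝓝 0) := by
      have := (continuous_const (y := g • g⁻¹ • x)).dist (hc (g⁻¹ • x))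
      simpa using this.tendsto g
    refine h1.congr fun p => ?_
    show _ = dist (p⁻¹ • x) (g⁻¹ • x)
    rw [← hd p (p⁻¹ • x), smul_inv_smul, smul_inv_smul]

theorem continuousSMul_of_pointwise {G X : Type*} [Group G] [TopologicalSpace G]
    [PseudoMetricSpace X] [MulAction G X] (hd : ∀ (g : G) (x y : X), dist (g • x) (g • y) = dist x y)
    (ht : IsInducing (fun (g : G) (x : X) => g • x)) : ContinuousSMul G X := by
  have hc : ∀ x : X, Continuous fun g : G => g • x := fun x =>
    (continuous_apply x).comp ht.continuous
  refine ⟨?_⟩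
  rw [continuous_iff_continuousAt]
  rintro ⟨g, x⟩
  rw [ContinuousAt, tendsto_iff_dist_tendsto_zero]
  have h1 : Filter.Tendsto (fun p : G × X => dist p.2 x + dist (p.1 • x) (g • x))
      (𝓝 (g, x)) (𝓝 0) := by
    have := (continuous_snd.dist (continuous_const (y := x))).add
      (((hc x).comp continuous_fst).dist (continuous_const (y := g • x)))
    simpa [Pi.add_def] using this.tendsto (g, x)
  refine squeeze_zero (fun _ => dist_nonneg) (fun p => ?_) h1
  show dist (p.1 • p.2) (g • x) ≤ _
  refine (dist_triangle _ (p.1 • x) _).trans ?_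
  rw [hd]

/-- The automorphisms of a metric structure, as a subgroup of the permutations. -/
def Structure.autSubgroup {L : Language.{u}} (M : Structure.{u, w} L) :
    Subgroup (Equiv.Perm M) where
  carrier := {e | M.IsIso M e}
  mul_mem' := by
    rintro a b ⟨a1, a2, a3⟩ ⟨b1, b2, b3⟩
    refine ⟨fun x y => ?_, fun n f v => ?_, fun n R v => ?_⟩
    · simp only [Equiv.Perm.mul_apply, a1, b1]
    · simp only [Equiv.Perm.mul_apply, b2, a2]; rfl
    · rw [← b3 n R v, ← a3 n R (b ∘ v)]; rfl
  one_mem' := ⟨fun _ _ => rfl, fun _ _ _ => rfl, fun _ _ _ => rfl⟩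
  inv_mem' := by
    rintro a ⟨a1, a2, a3⟩
    have hcomp : ∀ {n : ℕ} (v : Fin n → M), a ∘ ((a⁻¹ : Equiv.Perm M) ∘ v) = v := by
      intro n v; funext i; simp
    refine ⟨fun x y => ?_, fun n f v => ?_, fun n R v => ?_⟩
    · rw [← a1]; simp
    · apply a.injective
      rw [a2, hcomp]; simp
    · rw [← a3 n R, hcomp]

/-- `Aut(M)`. -/
def Structure.Aut {L : Language.{u}} (M : Structure.{u, w} L) : Type w := M.autSubgroup

section Aut

variable {L : Language.{u}} (M : Structure.{u, w} L)

instance : Group M.Aut := inferInstanceAs (Group M.autSubgroup)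
instance : MulAction M.Aut M := inferInstanceAs (MulAction M.autSubgroup M)

/-- The topology of pointwise convergence. -/
instance : TopologicalSpace M.Aut :=
  TopologicalSpace.induced (fun (g : M.Aut) (x : M) => g • x) inferInstance

theorem Structure.aut_dist (g : M.Aut) (x y : M) : dist (g • x) (g • y) = dist x y :=
  g.2.1 x y

instance : IsTopologicalGroup M.Aut := isTopologicalGroup_of_pointwise M.aut_dist ⟨rfl⟩
instance : ContinuousSMul M.Aut M := continuousSMul_of_pointwise M.aut_dist ⟨rfl⟩

end Aut

/-! ## Spaces of random variables -/

/-- `X^Ω = L⁰(Ω, X)`: random variables with values in `X`, up to equality almost everywhere. -/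
def L0 (Ω : Type v) [MeasureSpace Ω] (X : Type w) [TopologicalSpace X] : Type (max v w) :=
  Ω →ₘ[(volume : Measure Ω)] X

namespace L0

variable {Ω : Type v} [MeasureSpace Ω]

instance {X : Type w} [TopologicalSpace X] : CoeFun (L0 Ω X) (fun _ => Ω → X) :=
  ⟨fun r => AEEqFun.cast r⟩

/-- The class of a random variable. -/
def mk {X : Type w} [TopologicalSpace X] (f : Ω → X) (hf : AEStronglyMeasurable f volume) : L0 Ω X :=
  AEEqFun.mk f hf

theorem coeFn_mk {X : Type w} [TopologicalSpace X] (f : Ω → X)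
    (hf : AEStronglyMeasurable f volume) : ∀ᵐ ω, mk f hf ω = f ω :=
  AEEqFun.coeFn_mk f hf

theorem stronglyMeasurable {X : Type w} [TopologicalSpace X] (r : L0 Ω X) : StronglyMeasurable r :=
  AEEqFun.stronglyMeasurable r

theorem ext {X : Type w} [TopologicalSpace X] {r s : L0 Ω X} (h : ∀ᵐ ω, r ω = s ω) : r = s :=
  AEEqFun.ext h

section Metric

variable [IsFiniteMeasure (volume : Measure Ω)] {X : Type w} [MetricSpace X] [BoundedSpace X]

theorem integrable_dist (r s : L0 Ω X) : Integrable (fun ω => dist (r ω) (s ω)) := by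
  obtain ⟨C, hC⟩ := Metric.isBounded_iff.1 (BoundedSpace.bounded_univ (α := X))
  refine Integrable.of_bound (r.stronglyMeasurable.dist s.stronglyMeasurable).aestronglyMeasurable C
    (Filter.Eventually.of_forall fun ω => ?_)
  rw [Real.norm_of_nonneg dist_nonneg]
  exact hC (Set.mem_univ _) (Set.mem_univ _)

/-- The distance `d^Ω(r, s) = ∫ d(r(ω), s(ω)) dω` on `X^Ω`. -/
instance : MetricSpace (L0 Ω X) where
  dist r s := ∫ ω, dist (r ω) (s ω)
  dist_self r := by simp
  dist_comm r s := by simp only [dist_comm]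
  dist_triangle r s t := by
    rw [← integral_add (integrable_dist r s) (integrable_dist s t)]
    exact integral_mono (integrable_dist r t) ((integrable_dist r s).add (integrable_dist s t))
      fun ω => dist_triangle _ _ _
  eq_of_dist_eq_zero := by
    intro r s h
    have := (integral_eq_zero_iff_of_nonneg (fun ω => dist_nonneg) (integrable_dist r s)).1 h
    refine ext ?_
    filter_upwards [this] with ω hω
    exact dist_eq_zero.1 hω

theorem dist_def (r s : L0 Ω X) : dist r s = ∫ ω, dist (r ω) (s ω) := rfl

end Metric

/-- Composition with a continuous map. -/
def map {X : Type*} {Y : Type*} [TopologicalSpace X] [TopologicalSpace Y] (f : X → Y)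
    (hf : Continuous f) (r : L0 Ω X) : L0 Ω Y :=
  AEEqFun.comp f hf r

/-- Composition with a continuous map of two variables. -/
def map₂ {X : Type*} {Y : Type*} {Z : Type*} [TopologicalSpace X] [TopologicalSpace Y]
    [TopologicalSpace Z] (f : X → Y → Z) (hf : Continuous (Function.uncurry f)) (r : L0 Ω X)
    (s : L0 Ω Y) : L0 Ω Z :=
  AEEqFun.comp₂ f hf r s

/-- The map `X^{Ω₀} → X^{Ω₀ × Ω₁}` induced by the projection `Ω₀ × Ω₁ → Ω₀`. -/
def pullFst {Ω₀ : Type*} {Ω₁ : Type*} [MeasureSpace Ω₀] [MeasureSpace Ω₁]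
    [IsProbabilityMeasure (volume : Measure Ω₁)] {X : Type*} [TopologicalSpace X] (r : L0 Ω₀ X) :
    L0 (Ω₀ × Ω₁) X :=
  AEEqFun.compMeasurePreserving r Prod.fst measurePreserving_fst

/-- The section `r(ω₀, ·)` of a random variable `r` on `Ω₀ × Ω₁`. -/
def curry {Ω₀ : Type*} {Ω₁ : Type*} [MeasureSpace Ω₀] [MeasureSpace Ω₁] {X : Type*}
    [TopologicalSpace X] (r : L0 (Ω₀ × Ω₁) X) (ω₀ : Ω₀) : L0 Ω₁ X :=
  mk (fun ω₁ => r (ω₀, ω₁))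
    (r.stronglyMeasurable.comp_measurable measurable_prodMk_left).aestronglyMeasurable

section Group

variable {G : Type w} [Group G] [TopologicalSpace G] [IsTopologicalGroup G]

/-- `G^Ω` with pointwise multiplication. -/
instance : Group (L0 Ω G) := inferInstanceAs (Group (Ω →ₘ[(volume : Measure Ω)] G))

theorem coeFn_mul (g h : L0 Ω G) : ∀ᵐ ω, (g * h) ω = g ω * h ω := AEEqFun.coeFn_mul g h
theorem coeFn_one : ∀ᵐ ω, (1 : L0 Ω G) ω = 1 := AEEqFun.coeFn_one
theorem coeFn_inv (g : L0 Ω G) : ∀ᵐ ω, g⁻¹ ω = (g ω)⁻¹ := AEEqFun.coeFn_inv g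

/-- The topology of convergence in measure on `G^Ω`: the sets
`{h : μ {ω : g(ω)⁻¹ h(ω) ∉ U} < ε}`, with `U` a neighbourhood of `1` in `G` and `ε > 0`, form a base
of neighbourhoods of `g`. For a Polish group `G` this is the topology induced by `d^Ω`, for any
compatible bounded distance `d` on `G`. -/
@[reducible]
def convergenceInMeasure (Ω : Type v) [MeasureSpace Ω] (G : Type w) [Group G] [TopologicalSpace G]
    [IsTopologicalGroup G] : TopologicalSpace (L0 Ω G) where
  IsOpen S := ∀ g ∈ S, ∃ U ∈ 𝓝 (1 : G), ∃ ε : ENNReal, 0 < ε ∧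
    {h : L0 Ω G | volume {ω | (g ω)⁻¹ * h ω ∉ U} < ε} ⊆ S
  isOpen_univ _ _ := ⟨Set.univ, Filter.univ_mem, 1, one_pos, Set.subset_univ _⟩
  isOpen_inter S T hS hT g hg := by
    obtain ⟨U, hU, ε, hε, h1⟩ := hS g hg.1
    obtain ⟨V, hV, δ, hδ, h2⟩ := hT g hg.2
    refine ⟨U ∩ V, Filter.inter_mem hU hV, min ε δ, lt_min hε hδ, fun h hh => ⟨h1 ?_, h2 ?_⟩⟩
    · exact lt_of_le_of_lt (measure_mono fun ω (hω : _ ∉ U) (h' : _ ∈ U ∩ V) => hω h'.1) (lt_of_lt_of_le hh (min_le_left _ _))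
    · exact lt_of_le_of_lt (measure_mono fun ω (hω : _ ∉ V) (h' : _ ∈ U ∩ V) => hω h'.2) (lt_of_lt_of_le hh (min_le_right _ _))
  isOpen_sUnion 𝒮 h𝒮 g := by
    rintro ⟨S, hS, hg⟩
    obtain ⟨U, hU, ε, hε, h1⟩ := h𝒮 S hS g hg
    exact ⟨U, hU, ε, hε, h1.trans (Set.subset_sUnion_of_mem hS)⟩

instance : TopologicalSpace (L0 Ω G) := convergenceInMeasure Ω G

/-- The action `(g r)(ω) = g(ω)(r(ω))` of `G^Ω` on `X^Ω`. -/
instance {X : Type*} [TopologicalSpace X] [MulAction G X] [ContinuousSMul G X] :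
    MulAction (L0 Ω G) (L0 Ω X) where
  smul g r := map₂ (fun (g : G) (x : X) => g • x) continuous_smul g r
  one_smul r := by
    refine ext ?_
    filter_upwards [AEEqFun.coeFn_comp₂ (fun (g : G) (x : X) => g • x) continuous_smul
      (1 : L0 Ω G) r, coeFn_one (Ω := Ω) (G := G)] with ω h1 h2
    exact h1.trans (by rw [h2, one_smul])
  mul_smul g h r := by
    refine ext ?_
    filter_upwards [AEEqFun.coeFn_comp₂ (fun (g : G) (x : X) => g • x) continuous_smul (g * h) r,
      AEEqFun.coeFn_comp₂ (fun (g : G) (x : X) => g • x) continuous_smul h r,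
      AEEqFun.coeFn_comp₂ (fun (g : G) (x : X) => g • x) continuous_smul g
        (map₂ (fun (g : G) (x : X) => g • x) continuous_smul h r), coeFn_mul g h] with ω h1 h2 h3 h4
    refine h1.trans (Eq.trans ?_ h3.symm)
    rw [h4, mul_smul]
    exact congrArg (fun x => g ω • x) h2.symm

theorem coeFn_smul {X : Type*} [TopologicalSpace X] [MulAction G X] [ContinuousSMul G X]
    (g : L0 Ω G) (r : L0 Ω X) : ∀ᵐ ω, (g • r) ω = g ω • r ω :=
  AEEqFun.coeFn_comp₂ (fun (g : G) (x : X) => g • x) continuous_smul g r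

end Group

end L0

/-! ## Automorphisms of a probability space -/

section MPAut

variable (Ω : Type v) [MeasureSpace Ω]

/-- The invertible measure-preserving transformations of `Ω`. -/
def mpGroup : Subgroup (Equiv.Perm Ω) where
  carrier := {e | MeasurePreserving e volume volume ∧ MeasurePreserving e.symm volume volume}
  mul_mem' := fun {_ _} ha hb => ⟨ha.1.comp hb.1, hb.2.comp ha.2⟩
  one_mem' := ⟨MeasurePreserving.id _, MeasurePreserving.id _⟩
  inv_mem' := fun {_} ha => ⟨ha.2, ha.1⟩

/-- The transformations that are equal to the identity almost everywhere. -/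
def mpNull : Subgroup (mpGroup Ω) where
  carrier := {e | ∀ᵐ ω ∂(volume : Measure Ω), e.1 ω = ω}
  mul_mem' := by
    intro a b ha hb
    filter_upwards [hb, b.2.1.quasiMeasurePreserving.ae ha] with ω h1 h2
    show a.1 (b.1 ω) = ω
    rw [h2, h1]
  one_mem' := by
    show ∀ᵐ ω ∂(volume : Measure Ω), (1 : mpGroup Ω).1 ω = ω
    exact Filter.Eventually.of_forall fun _ => rfl
  inv_mem' := by
    intro a ha
    filter_upwards [a.2.2.quasiMeasurePreserving.ae ha] with ω h
    have h' : a.1 (a.1.symm ω) = a.1.symm ω := h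
    show a.1.symm ω = ω
    rw [← h', Equiv.apply_symm_apply]

instance : (mpNull Ω).Normal where
  conj_mem := by
    intro a ha b
    filter_upwards [b.2.2.quasiMeasurePreserving.ae ha] with ω h
    show b.1 (a.1 (b.1.symm ω)) = ω
    rw [h, Equiv.apply_symm_apply]

/-- `Aut(Ω)`: invertible measure-preserving transformations up to equality almost everywhere. -/
def MPAut : Type v := mpGroup Ω ⧸ mpNull Ω

instance : Group (MPAut Ω) := inferInstanceAs (Group (mpGroup Ω ⧸ mpNull Ω))

variable {Ω}

/-- The class of a transformation in `Aut(Ω)`. -/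
def MPAut.mk : mpGroup Ω →* MPAut Ω := QuotientGroup.mk' (mpNull Ω)

/-- `(e r)(ω) = r(e⁻¹(ω))`. -/
def L0.shift {X : Type w} [TopologicalSpace X] (e : mpGroup Ω) (r : L0 Ω X) : L0 Ω X :=
  AEEqFun.compMeasurePreserving r e.1.symm e.2.2

theorem L0.coeFn_shift {X : Type w} [TopologicalSpace X] (e : mpGroup Ω) (r : L0 Ω X) :
    ∀ᵐ ω, L0.shift e r ω = r (e.1.symm ω) :=
  AEEqFun.coeFn_compMeasurePreserving r e.2.2

theorem L0.shift_mul {X : Type w} [TopologicalSpace X] (a b : mpGroup Ω) (r : L0 Ω X) :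
    L0.shift (a * b) r = L0.shift a (L0.shift b r) := by
  refine L0.ext ?_
  filter_upwards [L0.coeFn_shift (a * b) r, L0.coeFn_shift a (L0.shift b r),
    a.2.2.quasiMeasurePreserving.ae (L0.coeFn_shift b r)] with ω h1 h2 h3
  rw [h1, h2, h3]
  rfl

theorem L0.shift_null {X : Type w} [TopologicalSpace X] (a : mpGroup Ω) (ha : a ∈ mpNull Ω)
    (r : L0 Ω X) : L0.shift a r = r := by
  refine L0.ext ?_
  have h := inv_mem ha
  filter_upwards [L0.coeFn_shift a r, h] with ω h1 h2
  have h2' : a.1.symm ω = ω := h2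
  rw [h1, h2']

/-- The transformations of `Ω` as permutations of `X^Ω`. -/
def L0.shiftHom (Ω : Type v) [MeasureSpace Ω] (X : Type w) [TopologicalSpace X] :
    mpGroup Ω →* Equiv.Perm (L0 Ω X) :=
  MonoidHom.toHomPerm
    { toFun := fun e r => L0.shift e r
      map_one' := by
        funext r
        exact L0.shift_null 1 (one_mem _) r
      map_mul' := fun a b => by
        funext r
        exact L0.shift_mul a b r }

/-- The action `(t r)(ω) = r(t⁻¹(ω))` of `Aut(Ω)` on `X^Ω`. -/
instance {X : Type w} [TopologicalSpace X] : MulAction (MPAut Ω) (L0 Ω X) :=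
  MulAction.compHom (L0 Ω X) (QuotientGroup.lift (mpNull Ω) (L0.shiftHom Ω X) (by
    intro a ha
    ext1 r
    exact L0.shift_null a ha r))

theorem MPAut.mk_smul {X : Type w} [TopologicalSpace X] (e : mpGroup Ω) (r : L0 Ω X) :
    MPAut.mk e • r = L0.shift e r := rfl

theorem MPAut.mk_surjective : Function.Surjective (MPAut.mk (Ω := Ω)) :=
  QuotientGroup.mk'_surjective _

variable (Ω) in
/-- The auxiliary sort `𝔸 = [0,1]^Ω`. -/
abbrev Aux : Type v := L0 Ω unitInterval

section Topology

variable [IsFiniteMeasure (volume : Measure Ω)]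

theorem MPAut.dist_smul {X : Type w} [MetricSpace X] [BoundedSpace X] (t : MPAut Ω)
    (r s : L0 Ω X) : dist (t • r) (t • s) = dist r s := by
  obtain ⟨e, rfl⟩ := MPAut.mk_surjective t
  rw [MPAut.mk_smul, MPAut.mk_smul, L0.dist_def, L0.dist_def]
  have h : ∀ᵐ ω, dist (L0.shift e r ω) (L0.shift e s ω)
      = (fun ω => dist (r ω) (s ω)) (e.1.symm ω) := by
    filter_upwards [L0.coeFn_shift e r, L0.coeFn_shift e s] with ω h1 h2
    rw [h1, h2]
  rw [integral_congr_ae h]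
  have e' : MeasurableEmbedding e.1.symm :=
    (MeasurableEquiv.mk e.1.symm e.2.2.measurable e.2.1.measurable).measurableEmbedding
  exact e.2.2.integral_comp e' (fun ω => dist (r ω) (s ω))

/-- The topology of pointwise convergence on `𝔸`. -/
instance : TopologicalSpace (MPAut Ω) :=
  TopologicalSpace.induced (fun (t : MPAut Ω) (R : Aux Ω) => t • R) inferInstance

instance : IsTopologicalGroup (MPAut Ω) :=
  isTopologicalGroup_of_pointwise (X := Aux Ω) MPAut.dist_smul ⟨rfl⟩

end Topology

/-! ## The measurable wreath product -/

/-- `Aut(Ω)` acts on the group `G^Ω` by automorphisms. -/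
instance {G : Type w} [Group G] [TopologicalSpace G] [IsTopologicalGroup G] :
    MulDistribMulAction (MPAut Ω) (L0 Ω G) where
  smul_one t := by
    obtain ⟨e, rfl⟩ := MPAut.mk_surjective t
    rw [MPAut.mk_smul]
    refine L0.ext ?_
    filter_upwards [L0.coeFn_shift e (1 : L0 Ω G), L0.coeFn_one (Ω := Ω) (G := G),
      e.2.2.quasiMeasurePreserving.ae (L0.coeFn_one (Ω := Ω) (G := G))] with ω h1 h2 h3
    rw [h1, h2, h3]
  smul_mul t g h := by
    obtain ⟨e, rfl⟩ := MPAut.mk_surjective t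
    rw [MPAut.mk_smul, MPAut.mk_smul, MPAut.mk_smul]
    refine L0.ext ?_
    filter_upwards [L0.coeFn_shift e (g * h), L0.coeFn_shift e g, L0.coeFn_shift e h,
      e.2.2.quasiMeasurePreserving.ae (L0.coeFn_mul g h),
      L0.coeFn_mul (L0.shift e g) (L0.shift e h)] with ω h1 h2 h3 h4 h5
    rw [h1, h4, h5, h2, h3]

/-- A semidirect product of topological groups carries the product topology. -/
instance {N : Type*} {H : Type*} [Group N] [Group H] [TopologicalSpace N] [TopologicalSpace H]
    (θ : H →* MulAut N) : TopologicalSpace (N ⋊[θ] H) :=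
  TopologicalSpace.induced (fun x => (x.left, x.right)) inferInstance

/-- The measurable wreath product `G ≀ Ω = G^Ω ⋊ Aut(Ω)`. -/
abbrev MWreath (G : Type w) [Group G] [TopologicalSpace G] [IsTopologicalGroup G] (Ω : Type v)
    [MeasureSpace Ω] : Type (max v w) :=
  L0 Ω G ⋊[MulDistribMulAction.toMulAut (MPAut Ω) (L0 Ω G)] MPAut Ω

end MPAut

/-! ## The Borel randomization and its automorphisms -/

section Randomization

variable {L : Language.{u}}

theorem stronglyMeasurable_tuple {α : Type*} [MeasurableSpace α] {X : Type*} [TopologicalSpace X] :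
    ∀ {n : ℕ} (f : Fin n → α → X), (∀ i, StronglyMeasurable (f i)) →
      StronglyMeasurable (fun a i => f i a)
  | 0, f, _ => by
    have : (fun (a : α) (i : Fin 0) => f i a) = fun _ => Fin.elim0 := by
      funext a i; exact i.elim0
    rw [this]; exact stronglyMeasurable_const
  | n + 1, f, hf => by
    have h1 := stronglyMeasurable_tuple (fun i : Fin n => f i.succ) (fun i => hf i.succ)
    have hc : Continuous (fun p : X × (Fin n → X) => (Fin.cons p.1 p.2 : Fin (n + 1) → X)) := by
      refine continuous_pi fun i => ?_
      refine Fin.cases ?_ (fun j => ?_) i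
      · simpa using continuous_fst
      · simpa [Function.comp_def] using (continuous_apply j).comp (continuous_snd (X := X) (Y := Fin n → X))
    have h2 := hc.comp_stronglyMeasurable ((hf 0).prodMk h1)
    have h3 : (fun a i => f i a) = fun a => (Fin.cons (f 0 a) (fun i : Fin n => f i.succ a) :
        Fin (n + 1) → X) := by
      funext a i
      refine Fin.cases ?_ (fun j => ?_) i <;> simp
    rw [h3]
    exact h2

variable {Ω : Type v} [MeasureSpace Ω]

/-- The function `⟦φ(x)⟧ : (M^Ω)^n → 𝔸`, `⟦φ(r)⟧(ω) = φ(r(ω))`. -/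
def Formula.rv (M : Structure.{u, w} L) {n : ℕ} (φ : Formula L n) (r : Fin n → L0 Ω M) : Aux Ω :=
  L0.mk (fun ω => φ.eval M (fun i => r i ω))
    ((φ.eval_uniformContinuous M).continuous.comp_stronglyMeasurable
      (stronglyMeasurable_tuple (fun i => (r i : Ω → M))
        fun i => (r i).stronglyMeasurable)).aestronglyMeasurable

/-- The expectation `𝔼 R`. -/
def Aux.expect (R : Aux Ω) : ℝ := ∫ ω, (R ω : ℝ)

/-- The complement `1 - R`. -/
def Aux.compl (R : Aux Ω) : Aux Ω := L0.map unitInterval.symm unitInterval.continuous_symm R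

/-- The half `R / 2`. -/
def Aux.half (R : Aux Ω) : Aux Ω :=
  L0.map (fun x : unitInterval => Set.projIcc (0 : ℝ) 1 zero_le_one ((x : ℝ) / 2))
    (continuous_projIcc.comp (continuous_subtype_val.div_const 2)) R

/-- The truncated difference `max (R - S) 0`. -/
def Aux.tsub (R S : Aux Ω) : Aux Ω :=
  L0.map₂ (fun x y : unitInterval => Set.projIcc (0 : ℝ) 1 zero_le_one ((x : ℝ) - (y : ℝ)))
    (continuous_projIcc.comp ((continuous_subtype_val.comp continuous_fst).sub
      (continuous_subtype_val.comp continuous_snd))) R S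

variable [IsFiniteMeasure (volume : Measure Ω)]

/-- The automorphisms of the Borel randomization `M^R` based on `Ω`: pairs of isometric permutations
of the main sort `M^Ω` and of the auxiliary sort `𝔸`, preserving the functions `⟦φ(x)⟧`, the
expectation and the arithmetic operations of the auxiliary sort. -/
def randAutSubgroup (M : Structure.{u, w} L) (Ω : Type v) [MeasureSpace Ω]
    [IsFiniteMeasure (volume : Measure Ω)] :
    Subgroup (Equiv.Perm (L0 Ω M) × Equiv.Perm (Aux Ω)) where
  carrier := {ρ |
    (∀ r s : L0 Ω M, dist (ρ.1 r) (ρ.1 s) = dist r s) ∧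
    (∀ R S : Aux Ω, dist (ρ.2 R) (ρ.2 S) = dist R S) ∧
    (∀ (n : ℕ) (φ : Formula L n) (r : Fin n → L0 Ω M), φ.rv M (ρ.1 ∘ r) = ρ.2 (φ.rv M r)) ∧
    (∀ R : Aux Ω, (ρ.2 R).expect = R.expect) ∧
    (∀ R : Aux Ω, ρ.2 R.compl = (ρ.2 R).compl) ∧
    (∀ R : Aux Ω, ρ.2 R.half = (ρ.2 R).half) ∧
    (∀ R S : Aux Ω, ρ.2 (R.tsub S) = (ρ.2 R).tsub (ρ.2 S))}
  mul_mem' := by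
    rintro a b ⟨a1, a2, a3, a4, a5, a6, a7⟩ ⟨b1, b2, b3, b4, b5, b6, b7⟩
    refine ⟨fun r s => ?_, fun R S => ?_, fun n φ r => ?_, fun R => ?_, fun R => ?_, fun R => ?_,
      fun R S => ?_⟩
    · exact (a1 _ _).trans (b1 r s)
    · exact (a2 _ _).trans (b2 R S)
    · exact (a3 n φ (b.1 ∘ r)).trans (congrArg a.2 (b3 n φ r))
    · exact (a4 _).trans (b4 R)
    · exact (congrArg a.2 (b5 R)).trans (a5 _)
    · exact (congrArg a.2 (b6 R)).trans (a6 _)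
    · exact (congrArg a.2 (b7 R S)).trans (a7 _ _)
  one_mem' := ⟨fun _ _ => rfl, fun _ _ => rfl, fun _ _ _ => rfl, fun _ => rfl, fun _ => rfl,
    fun _ => rfl, fun _ _ => rfl⟩
  inv_mem' := by
    rintro a ⟨a1, a2, a3, a4, a5, a6, a7⟩
    have e1 : ∀ r, a.1 (a⁻¹.1 r) = r := fun r => a.1.apply_symm_apply r
    have e2 : ∀ R, a.2 (a⁻¹.2 R) = R := fun R => a.2.apply_symm_apply R
    refine ⟨fun r s => ?_, fun R S => ?_, fun n φ r => ?_, fun R => ?_, fun R => ?_, fun R => ?_,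
      fun R S => ?_⟩
    · rw [← a1, e1, e1]
    · rw [← a2, e2, e2]
    · apply a.2.injective
      rw [← a3, e2]
      congr 1
      funext i
      exact e1 (r i)
    · rw [← a4, e2]
    · apply a.2.injective; rw [a5, e2, e2]
    · apply a.2.injective; rw [a6, e2, e2]
    · apply a.2.injective; rw [a7, e2, e2, e2]

/-- `Aut(M^R)`, for the Borel randomization `M^R` based on `Ω`. -/
def RandAut (M : Structure.{u, w} L) (Ω : Type v) [MeasureSpace Ω]
    [IsFiniteMeasure (volume : Measure Ω)] : Type (max v w) :=
  randAutSubgroup M Ω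

namespace RandAut

variable (M : Structure.{u, w} L)

instance : Group (RandAut M Ω) := inferInstanceAs (Group (randAutSubgroup M Ω))

variable {M}

/-- The action of an automorphism on the main sort. -/
def onMain (ρ : RandAut M Ω) : L0 Ω M → L0 Ω M := ρ.1.1

/-- The action of an automorphism on the auxiliary sort. -/
def onAux (ρ : RandAut M Ω) : Aux Ω → Aux Ω := ρ.1.2

/-- The topology of pointwise convergence (on both sorts). -/
instance : TopologicalSpace (RandAut M Ω) :=
  TopologicalSpace.induced (fun ρ : RandAut M Ω => (ρ.onMain, ρ.onAux)) inferInstance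

end RandAut

end Randomization

/-! ## The pair `(M^{Ω²}, N^Ω)_{𝔸_P}` -/

section Pair

variable {L : Language.{u}} {M : Structure.{u, w} L} (N : M.Substructure)
variable (Ω₀ Ω₁ : Type v) [MeasureSpace Ω₀] [MeasureSpace Ω₁]
variable [IsProbabilityMeasure (volume : Measure Ω₀)] [IsProbabilityMeasure (volume : Measure Ω₁)]

/-- The inclusion `N^Ω → M^{Ω²}`, where `Ω² = Ω₀ × Ω₁` and `Ω` is the factor of `Ω²` given by the
projection to `Ω₀`. -/
def randIncl (r : L0 Ω₀ N.toStructure) : L0 (Ω₀ × Ω₁) M :=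
  L0.pullFst (L0.map N.incl N.continuous_incl r)

/-- The automorphism group of the pair `(M^{Ω²}, N^Ω)_{𝔸_P}`: the automorphisms of `M^R` that fix
`N^Ω` and `𝔸_Ω` setwise. -/
def pairAut : Subgroup (RandAut M (Ω₀ × Ω₁)) where
  carrier := {ρ |
    ρ.onMain '' Set.range (randIncl N Ω₀ Ω₁) = Set.range (randIncl N Ω₀ Ω₁) ∧
    ρ.onAux '' Set.range (L0.pullFst : Aux Ω₀ → Aux (Ω₀ × Ω₁)) =
      Set.range (L0.pullFst : Aux Ω₀ → Aux (Ω₀ × Ω₁))}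
  mul_mem' := by
    rintro a b ⟨a1, a2⟩ ⟨b1, b2⟩
    constructor
    · rw [show (a * b).onMain = a.onMain ∘ b.onMain from rfl, Set.image_comp, b1, a1]
    · rw [show (a * b).onAux = a.onAux ∘ b.onAux from rfl, Set.image_comp, b2, a2]
  one_mem' := ⟨Set.image_id _, Set.image_id _⟩
  inv_mem' := by
    rintro a ⟨a1, a2⟩
    have e1 : a⁻¹.onMain ∘ a.onMain = id := by
      funext r; exact a.1.1.symm_apply_apply r
    have e2 : a⁻¹.onAux ∘ a.onAux = id := by
      funext r; exact a.1.2.symm_apply_apply r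
    constructor
    · conv_lhs => rw [← a1]
      rw [← Set.image_comp, e1, Set.image_id]
    · conv_lhs => rw [← a2]
      rw [← Set.image_comp, e2, Set.image_id]

/-- The group `G_P^*` of all `g ∈ Aut(M)^{Ω²}` whose restriction to `N^Ω` lies in `Aut(N)^Ω`. -/
def GPStar : Subgroup (L0 (Ω₀ × Ω₁) M.Aut) where
  carrier := {g | ∃ k : L0 Ω₀ N.toStructure.Aut, ∀ r : L0 Ω₀ N.toStructure,
    g • randIncl N Ω₀ Ω₁ r = randIncl N Ω₀ Ω₁ (k • r)}
  mul_mem' := by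
    rintro a b ⟨k, hk⟩ ⟨l, hl⟩
    refine ⟨k * l, fun r => ?_⟩
    rw [mul_smul, hl, hk, mul_smul]
  one_mem' := ⟨1, fun r => by rw [one_smul, one_smul]⟩
  inv_mem' := by
    rintro a ⟨k, hk⟩
    refine ⟨k⁻¹, fun r => ?_⟩
    rw [inv_smul_eq_iff, hk, smul_inv_smul]

end Pair

end

end MetricLogic

open MetricLogic
open scoped unitInterval

open MetricLogic
open scoped unitInterval

namespace MetricLogic

noncomputable section

/-! ## Random variables -/

namespace L0

section Basic

variable {Ω : Type*} [MeasureSpace Ω]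

/-! An automorphism of the randomization moves points of the base and acts on the values over each
point; the proof separates these two effects and then reads off what the invariance of `[0,1]^Ω` and
`N^Ω` means for each.

The base. A map of the auxiliary sort that respects the metric and the arithmetic commutes with
composition by every Borel function of `[0,1]`, since these are generated by arithmetic and
pointwise limits. Every random variable is a Borel function of one variable `J`, a Borel isomorphism
of the base with `[0,1]`, so the map is composition with the transformation read off from the image
of `J`; preservation of expectation makes it measure preserving (`IsAuxHom.exists_MPAut`).

The values. Once the base transformation is divided out, all truth values `⟦φ⟧` are fixed, among
them `⟦d(x, y)⟧`. A permutation of `X^Ω` that preserves distances pointwise is given at almost every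
point by an isometry, determined by the images of countably many constants
(`exists_pointwise_isometry`). For a countable language these isometries are almost surely
automorphisms, and they depend measurably on the point (`exists_L0_aut`). Hence every automorphism
has the form `r ↦ g (t r)`, `R ↦ t R` (`RandAut.exists_of_onAux`).

The invariant subspaces. If `t` fixes `[0,1]^Ω` setwise, it induces some `e` on `Ω₀`; after division
by `e` it fixes all sets `B × Ω₁`, so it preserves the distance of sections pointwise, and the same
local argument, now for `X = [0,1]^{Ω₁}`, produces `h ∈ Aut(Ω₁)^{Ω₀}`. Thus the possible `t` are
exactly the values of `ι` (`exists_iota_eq`). Since `ι(x)` itself preserves `N^Ω`, so does `g`, and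
the local argument for `X = N` puts `g` in `G_P^*` (`mem_GPStar_of_image`).

The topology. Convergence in measure on `G^Ω` is pointwise convergence on `X^Ω` when `G` consists of
isometries of `X` with pointwise convergence (`L0.isInducing_smul`). All groups involved are then
groups of isometries with pointwise convergence, where evaluation is jointly continuous, and `e`,
`h`, `g` can be recovered continuously from the automorphism, in this order. -/

theorem coeFn_map {X Y : Type*} [TopologicalSpace X] [TopologicalSpace Y] (f : X → Y)
    (hf : Continuous f) (r : L0 Ω X) : ∀ᵐ ω, map f hf r ω = f (r ω) :=
  AEEqFun.coeFn_comp f hf r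

theorem coeFn_map₂ {X Y Z : Type*} [TopologicalSpace X] [TopologicalSpace Y] [TopologicalSpace Z]
    (f : X → Y → Z) (hf : Continuous (Function.uncurry f)) (r : L0 Ω X) (s : L0 Ω Y) :
    ∀ᵐ ω, map₂ f hf r s ω = f (r ω) (s ω) :=
  AEEqFun.coeFn_comp₂ f hf r s

theorem coeFn_eq {X : Type*} [TopologicalSpace X] {r s : L0 Ω X} (h : r = s) :
    ∀ᵐ ω, r ω = s ω := by
  subst h; exact Filter.Eventually.of_forall fun _ => rfl

theorem mk_coeFn {X : Type*} [TopologicalSpace X] (r : L0 Ω X) :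
    mk r r.stronglyMeasurable.aestronglyMeasurable = r :=
  AEEqFun.mk_coeFn r

/-- A constant random variable. -/
def const (Ω : Type*) [MeasureSpace Ω] {X : Type*} [TopologicalSpace X] (x : X) : L0 Ω X :=
  mk (fun _ => x) aestronglyMeasurable_const

theorem coeFn_const {X : Type*} [TopologicalSpace X] (x : X) : ∀ᵐ ω, const Ω x ω = x :=
  coeFn_mk _ _

theorem coeFn_pullFst {Ω₀ Ω₁ : Type*} [MeasureSpace Ω₀] [MeasureSpace Ω₁]
    [IsProbabilityMeasure (volume : Measure Ω₁)] {X : Type*} [TopologicalSpace X] (r : L0 Ω₀ X) :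
    ∀ᵐ ω : Ω₀ × Ω₁, (pullFst r : L0 (Ω₀ × Ω₁) X) ω = r ω.1 :=
  AEEqFun.coeFn_compMeasurePreserving r measurePreserving_fst

theorem coeFn_curry {Ω₀ Ω₁ : Type*} [MeasureSpace Ω₀] [MeasureSpace Ω₁] {X : Type*}
    [TopologicalSpace X] (r : L0 (Ω₀ × Ω₁) X) (ω₀ : Ω₀) :
    ∀ᵐ ω₁, curry r ω₀ ω₁ = r (ω₀, ω₁) :=
  coeFn_mk _ _

theorem map_const {X Y : Type*} [TopologicalSpace X] [TopologicalSpace Y] (f : X → Y)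
    (hf : Continuous f) (x : X) : map f hf (const Ω x) = const Ω (f x) := by
  refine ext ?_
  filter_upwards [coeFn_map f hf (const Ω x), coeFn_const (Ω := Ω) x,
    coeFn_const (Ω := Ω) (f x)] with ω h1 h2 h3
  rw [h1, h2, h3]

variable [IsFiniteMeasure (volume : Measure Ω)] {X : Type*} [MetricSpace X] [BoundedSpace X]

theorem dist_le_of_forall {C : ℝ} (r s : L0 Ω X) (h : ∀ᵐ ω, dist (r ω) (s ω) ≤ C) :
    dist r s ≤ C * (volume : Measure Ω).real Set.univ := by
  rw [dist_def]
  refine (integral_mono_ae (integrable_dist r s) (integrable_const C) h).trans ?_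
  simp [mul_comm]

/-- Lets the construction be iterated: `L0 Ω₀ (Aux Ω₁)` is a metric space only because `Aux Ω₁` is
bounded. -/
instance : BoundedSpace (L0 Ω X) := by
  obtain ⟨C, hC⟩ := Metric.isBounded_iff.1 (BoundedSpace.bounded_univ (α := X))
  refine ⟨Metric.isBounded_iff.2 ⟨C * (volume : Measure Ω).real Set.univ, fun r _ s _ => ?_⟩⟩
  exact dist_le_of_forall r s
    (Filter.Eventually.of_forall fun ω => hC (Set.mem_univ _) (Set.mem_univ _))

theorem dist_smul {G : Type*} [Group G] [TopologicalSpace G] [IsTopologicalGroup G]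
    [MulAction G X] [ContinuousSMul G X] (hd : ∀ (g : G) (x y : X), dist (g • x) (g • y) = dist x y)
    (g : L0 Ω G) (r s : L0 Ω X) : dist (g • r) (g • s) = dist r s := by
  rw [dist_def, dist_def]
  refine integral_congr_ae ?_
  filter_upwards [coeFn_smul g r, coeFn_smul g s] with ω h1 h2
  rw [h1, h2, hd]

theorem dist_pullFst {Ω₀ Ω₁ : Type*} [MeasureSpace Ω₀] [MeasureSpace Ω₁]
    [IsProbabilityMeasure (volume : Measure Ω₀)] [IsProbabilityMeasure (volume : Measure Ω₁)]
    (r s : L0 Ω₀ X) :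
    dist (pullFst r : L0 (Ω₀ × Ω₁) X) (pullFst s) = dist r s := by
  rw [dist_def, dist_def]
  have h : ∀ᵐ ω : Ω₀ × Ω₁, dist ((pullFst r : L0 (Ω₀ × Ω₁) X) ω) ((pullFst s : L0 (Ω₀ × Ω₁) X) ω)
      = dist (r ω.1) (s ω.1) := by
    filter_upwards [coeFn_pullFst (Ω₁ := Ω₁) r, coeFn_pullFst (Ω₁ := Ω₁) s] with ω h1 h2
    rw [h1, h2]
  rw [integral_congr_ae h]
  have := integral_prod (μ := (volume : Measure Ω₀)) (ν := (volume : Measure Ω₁))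
    (fun ω : Ω₀ × Ω₁ => dist (r ω.1) (s ω.1))
    ((integrable_dist r s).comp_fst _)
  refine this.trans ?_
  simp

theorem pullFst_injective {Ω₀ Ω₁ : Type*} [MeasureSpace Ω₀] [MeasureSpace Ω₁]
    [IsProbabilityMeasure (volume : Measure Ω₀)] [IsProbabilityMeasure (volume : Measure Ω₁)] :
    Function.Injective (pullFst : L0 Ω₀ X → L0 (Ω₀ × Ω₁) X) := fun r s h => by
  rw [← dist_eq_zero, ← dist_pullFst (Ω₁ := Ω₁), h, dist_self]

/-- Random variables with finitely many values are dense: `r` is a limit of a sequence of simple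
random variables. -/
theorem exists_simple_dist_lt (r : L0 Ω X) {ε : ℝ} (hε : 0 < ε) :
    ∃ f : SimpleFunc Ω X, dist r (mk f f.stronglyMeasurable.aestronglyMeasurable) < ε := by
  obtain ⟨C, hC⟩ := Metric.isBounded_iff.1 (BoundedSpace.bounded_univ (α := X))
  have hr := r.stronglyMeasurable
  -- Dominated convergence: the approximating simple functions converge pointwise, and the diameter
  -- bound `C` dominates the distances.
  have h1 : Filter.Tendsto (fun n => ∫ ω, dist (r ω) (hr.approx n ω)) Filter.atTop
      (𝓝 (∫ ω : Ω, (0 : ℝ))) := by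
    refine tendsto_integral_of_dominated_convergence (fun _ => C) (fun n => ?_)
      (integrable_const _) (fun n => Filter.Eventually.of_forall fun ω => ?_)
      (Filter.Eventually.of_forall fun ω => ?_)
    · exact (hr.dist (hr.approx n).stronglyMeasurable).aestronglyMeasurable
    · rw [Real.norm_of_nonneg dist_nonneg]
      exact hC (Set.mem_univ _) (Set.mem_univ _)
    · have := tendsto_iff_dist_tendsto_zero.1 (hr.tendsto_approx ω)
      simpa only [dist_comm] using this
  rw [integral_zero] at h1
  obtain ⟨n, hn⟩ := (h1.eventually (gt_mem_nhds hε)).exists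
  refine ⟨hr.approx n, ?_⟩
  rw [dist_def]
  refine lt_of_eq_of_lt (integral_congr_ae ?_) hn
  filter_upwards [coeFn_mk (hr.approx n) (hr.approx n).stronglyMeasurable.aestronglyMeasurable]
    with ω h
  rw [h]

end Basic

end L0

/-! ### The action of `Aut(Ω)` and pointwise operations -/

section MPAut

variable {Ω : Type*} [MeasureSpace Ω]

theorem MPAut.smul_map {X Y : Type*} [TopologicalSpace X] [TopologicalSpace Y] (t : MPAut Ω)
    (f : X → Y) (hf : Continuous f) (r : L0 Ω X) :
    t • L0.map f hf r = L0.map f hf (t • r) := by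
  obtain ⟨e, rfl⟩ := MPAut.mk_surjective t
  rw [MPAut.mk_smul, MPAut.mk_smul]
  refine L0.ext ?_
  filter_upwards [L0.coeFn_shift e r, L0.coeFn_shift e (L0.map f hf r),
    L0.coeFn_map f hf (L0.shift e r), e.2.2.quasiMeasurePreserving.ae (L0.coeFn_map f hf r)]
    with ω h1 h2 h3 h4
  rw [h2, h4, h3, h1]

theorem MPAut.smul_map₂ {X Y Z : Type*} [TopologicalSpace X] [TopologicalSpace Y]
    [TopologicalSpace Z] (t : MPAut Ω) (f : X → Y → Z) (hf : Continuous (Function.uncurry f))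
    (r : L0 Ω X) (s : L0 Ω Y) :
    t • L0.map₂ f hf r s = L0.map₂ f hf (t • r) (t • s) := by
  obtain ⟨e, rfl⟩ := MPAut.mk_surjective t
  rw [MPAut.mk_smul, MPAut.mk_smul, MPAut.mk_smul]
  refine L0.ext ?_
  filter_upwards [L0.coeFn_shift e r, L0.coeFn_shift e s, L0.coeFn_shift e (L0.map₂ f hf r s),
    L0.coeFn_map₂ f hf (L0.shift e r) (L0.shift e s),
    e.2.2.quasiMeasurePreserving.ae (L0.coeFn_map₂ f hf r s)] with ω h1 h2 h3 h4 h5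
  rw [h3, h5, h4, h1, h2]

/-- This is the relation behind all the semidirect products below: conjugating the action of `g` by
`t` gives the action of `t • g`. -/
theorem MPAut.smul_smul_L0 {G X : Type*} [Group G] [TopologicalSpace G] [IsTopologicalGroup G]
    [TopologicalSpace X] [MulAction G X] [ContinuousSMul G X] (t : MPAut Ω) (g : L0 Ω G)
    (r : L0 Ω X) : t • (g • r) = (t • g) • (t • r) :=
  MPAut.smul_map₂ t _ _ g r

theorem MPAut.smul_const {X : Type*} [TopologicalSpace X] (t : MPAut Ω) (x : X) :
    t • L0.const Ω x = L0.const Ω x := by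
  obtain ⟨e, rfl⟩ := MPAut.mk_surjective t
  rw [MPAut.mk_smul]
  refine L0.ext ?_
  filter_upwards [L0.coeFn_shift e (L0.const Ω x), L0.coeFn_const (Ω := Ω) x,
    e.2.2.quasiMeasurePreserving.ae (L0.coeFn_const (Ω := Ω) x)] with ω h1 h2 h3
  rw [h1, h2, h3]

theorem MPAut.expect_smul (t : MPAut Ω) (R : Aux Ω) : (t • R).expect = R.expect := by
  obtain ⟨e, rfl⟩ := MPAut.mk_surjective t
  rw [MPAut.mk_smul]
  have h : ∀ᵐ ω, ((L0.shift e R ω : unitInterval) : ℝ) = (fun ω => (R ω : ℝ)) (e.1.symm ω) := by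
    filter_upwards [L0.coeFn_shift e R] with ω h1
    rw [h1]
  rw [Aux.expect, integral_congr_ae h]
  have e' : MeasurableEmbedding e.1.symm :=
    (MeasurableEquiv.mk e.1.symm e.2.2.measurable e.2.1.measurable).measurableEmbedding
  exact e.2.2.integral_comp e' (fun ω => (R ω : ℝ))

variable [IsFiniteMeasure (volume : Measure Ω)]

instance : ContinuousSMul (MPAut Ω) (Aux Ω) := continuousSMul_of_pointwise MPAut.dist_smul ⟨rfl⟩

end MPAut

/-! ## Pointwise convergence -/

section Pointwise

/-- A family of isometries is equicontinuous, so continuity in the parameter alone gives joint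
continuity. -/
theorem continuous_uncurry_of_isometry {A Y : Type*} [TopologicalSpace A] [PseudoMetricSpace Y]
    {F : A → Y → Y} (hF : ∀ a x y, dist (F a x) (F a y) = dist x y)
    (hc : ∀ y, Continuous fun a => F a y) : Continuous fun p : A × Y => F p.1 p.2 := by
  rw [continuous_iff_continuousAt]
  rintro ⟨a, y⟩
  rw [ContinuousAt, tendsto_iff_dist_tendsto_zero]
  have h1 : Filter.Tendsto (fun p : A × Y => dist p.2 y + dist (F p.1 y) (F a y))
      (𝓝 (a, y)) (𝓝 0) := by
    have := (continuous_snd.dist (continuous_const (y := y))).add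
      (((hc y).comp continuous_fst).dist (continuous_const (y := F a y)))
    simpa [Pi.add_def] using this.tendsto (a, y)
  refine squeeze_zero (fun _ => dist_nonneg) (fun p => ?_) h1
  refine (dist_triangle _ (F p.1 y) _).trans ?_
  rw [hF]

variable {Ω : Type*} [MeasureSpace Ω] [IsFiniteMeasure (volume : Measure Ω)]
  {X : Type*} [MetricSpace X] [BoundedSpace X]

/-- Basic neighbourhoods for the topology of pointwise convergence. -/
theorem exists_finset_of_mem_nhds_pointwise {G Y : Type*} [TopologicalSpace G]
    [PseudoMetricSpace Y] {F : G → Y → Y} (ht : IsInducing F) {g : G} {S : Set G} (hS : S ∈ 𝓝 g) :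
    ∃ (s : Finset Y) (δ : ℝ), 0 < δ ∧ {h | ∀ y ∈ s, dist (F h y) (F g y) < δ} ⊆ S := by
  rw [ht.nhds_eq_comap, Filter.mem_comap] at hS
  obtain ⟨T, hT, hTS⟩ := hS
  rw [nhds_pi, Filter.mem_pi'] at hT
  obtain ⟨s, t, ht1, ht2⟩ := hT
  have h1 : ∀ y, ∃ δ > 0, Metric.ball (F g y) δ ⊆ t y := fun y => Metric.mem_nhds_iff.1 (ht1 y)
  choose δ hδ hb using h1
  obtain ⟨η, hη, hη'⟩ : ∃ η > 0, ∀ y ∈ s, η ≤ δ y := by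
    classical
    clear ht2
    induction s using Finset.induction_on with
    | empty => exact ⟨1, one_pos, by simp⟩
    | insert a s _ ih =>
      obtain ⟨η, hη, h⟩ := ih
      refine ⟨min η (δ a), lt_min hη (hδ a), fun y hy => ?_⟩
      rcases Finset.mem_insert.1 hy with rfl | hy
      · exact min_le_right _ _
      · exact (min_le_left _ _).trans (h y hy)
  refine ⟨s, η, hη, fun h hh => hTS (ht2 fun y hy => hb y ?_)⟩
  exact Metric.mem_ball.2 (lt_of_lt_of_le (hh y hy) (hη' y hy))

theorem exists_finset_of_isOpen_pointwise {G Y : Type*} [PseudoMetricSpace Y] {F : G → Y → Y}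
    {S : Set G} (hS : IsOpen[TopologicalSpace.induced F inferInstance] S) {g : G} (hg : g ∈ S) :
    ∃ (s : Finset Y) (δ : ℝ), 0 < δ ∧ {h | ∀ y ∈ s, dist (F h y) (F g y) < δ} ⊆ S := by
  let τ : TopologicalSpace G := TopologicalSpace.induced F inferInstance
  have hS' : IsOpen S := hS
  exact exists_finset_of_mem_nhds_pointwise ⟨rfl⟩ (hS'.mem_nhds hg)

theorem pointwise_mem_nhds {G Y : Type*} [TopologicalSpace G]
    [PseudoMetricSpace Y] {F : G → Y → Y} (ht : IsInducing F) (g : G) (s : Finset Y) {δ : ℝ}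
    (hδ : 0 < δ) : {h | ∀ y ∈ s, dist (F h y) (F g y) < δ} ∈ 𝓝 g := by
  have hc : ∀ y, Continuous fun h => F h y := fun y => (continuous_apply y).comp ht.continuous
  have : ∀ y ∈ s, ∀ᶠ h in 𝓝 g, dist (F h y) (F g y) < δ := fun y _ => by
    have := ((hc y).tendsto g).eventually (Metric.ball_mem_nhds _ hδ)
    exact this
  exact (Filter.eventually_all_finset s).2 this

variable {G : Type*} [Group G] [TopologicalSpace G] [IsTopologicalGroup G] [MulAction G X]
  [ContinuousSMul G X]

/-- A simple approximation of `r` has finitely many values, so one neighbourhood `U` of `1` controls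
the displacement of all of them. Off the set where `g⁻¹h ∉ U` the integrand is then small; on it the
integrand is at most the diameter and the measure is small. -/
theorem L0.exists_convergenceInMeasure_dist_lt
    (hd : ∀ (g : G) (x y : X), dist (g • x) (g • y) = dist x y)
    (ht : IsInducing (fun (g : G) (x : X) => g • x)) (g : L0 Ω G) (r : L0 Ω X) {δ : ℝ}
    (hδ : 0 < δ) : ∃ U ∈ 𝓝 (1 : G), ∃ ε : ENNReal, 0 < ε ∧
      ∀ h : L0 Ω G, volume {ω | (g ω)⁻¹ * h ω ∉ U} < ε → dist (h • r) (g • r) < δ := by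
  obtain ⟨C, hC⟩ := Metric.isBounded_iff.1 (BoundedSpace.bounded_univ (α := X))
  set m := (volume : Measure Ω).real Set.univ with hm
  have hm0 : 0 ≤ m := measureReal_nonneg
  obtain ⟨f, hf⟩ := L0.exists_simple_dist_lt r (show 0 < δ / 4 by linarith)
  set s : L0 Ω X := L0.mk f f.stronglyMeasurable.aestronglyMeasurable with hs
  -- The error `δ` is split into `δ / 4` for each of two simple approximations, `δ / 4` for the good
  -- set of mass at most `m`, and `δ / 4` for the bad set, where distances are at most `|C|`. The
  -- added `1` avoids division by zero.
  have hη : 0 < δ / 4 / (m + 1) := by positivity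
  have hη' : 0 < δ / 4 / (|C| + 1) := by positivity
  refine ⟨_, pointwise_mem_nhds ht 1 f.range hη, ENNReal.ofReal (δ / 4 / (|C| + 1)),
    ENNReal.ofReal_pos.2 hη', fun h hh => ?_⟩
  set B : Set Ω := {ω | (g ω)⁻¹ * h ω ∉ {h : G | ∀ y ∈ f.range, dist (h • y) ((1 : G) • y)
    < δ / 4 / (m + 1)}} with hB
  -- The set `B` need not be measurable; its measurable hull has the same measure and can be
  -- integrated over.
  have hB' : volume (toMeasurable volume B) < ENNReal.ofReal (δ / 4 / (|C| + 1)) := by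
    rwa [measure_toMeasurable]
  have key : dist (h • s) (g • s) < δ / 2 := by
    rw [L0.dist_def]
    have hle : ∀ᵐ ω, dist ((h • s) ω) ((g • s) ω) ≤
        δ / 4 / (m + 1) + (toMeasurable volume B).indicator (fun _ => |C|) ω := by
      filter_upwards [L0.coeFn_smul h s, L0.coeFn_smul g s,
        L0.coeFn_mk f f.stronglyMeasurable.aestronglyMeasurable] with ω h1 h2 h3
      rw [h1, h2]
      by_cases hω : ω ∈ toMeasurable volume B
      · rw [Set.indicator_of_mem hω]
        have : dist (h ω • s ω) (g ω • s ω) ≤ C := hC (Set.mem_univ _) (Set.mem_univ _)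
        have := le_abs_self C
        linarith
      · rw [Set.indicator_of_notMem hω, add_zero]
        have hω' : ω ∉ B := fun h => hω (subset_toMeasurable _ _ h)
        have hω'' : ∀ y ∈ f.range, dist (((g ω)⁻¹ * h ω) • y) ((1 : G) • y) < δ / 4 / (m + 1) :=
          not_not.1 hω'
        have := hω'' (s ω) (by rw [h3]; exact SimpleFunc.mem_range_self f ω)
        rw [← hd (g ω), smul_smul, mul_inv_cancel_left, one_smul] at this
        exact this.le
    have hi : Integrable (fun ω => δ / 4 / (m + 1) +
        (toMeasurable volume B).indicator (fun _ => |C|) ω) (volume : Measure Ω) :=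
      (integrable_const _).add ((integrable_const _).indicator (measurableSet_toMeasurable _ _))
    refine (integral_mono_ae (L0.integrable_dist _ _) hi hle).trans_lt ?_
    rw [integral_add (integrable_const _)
      ((integrable_const _).indicator (measurableSet_toMeasurable _ _)),
      integral_indicator_const _ (measurableSet_toMeasurable _ _), integral_const]
    simp only [smul_eq_mul]
    have h1 : m * (δ / 4 / (m + 1)) ≤ δ / 4 := by
      rw [mul_div_assoc', div_le_iff₀ (by positivity)]
      nlinarith
    have h2 : (volume : Measure Ω).real (toMeasurable volume B) * |C| ≤
        (δ / 4 / (|C| + 1)) * |C| := by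
      refine mul_le_mul_of_nonneg_right ?_ (abs_nonneg _)
      exact ENNReal.toReal_le_of_le_ofReal hη'.le hB'.le
    have h3 : (δ / 4 / (|C| + 1)) * |C| < δ / 4 := by
      rw [div_mul_eq_mul_div, div_lt_iff₀ (by positivity)]
      nlinarith [abs_nonneg C]
    linarith
  have h1 : dist (h • r) (h • s) < δ / 4 := by rwa [L0.dist_smul hd]
  have h2 : dist (g • s) (g • r) < δ / 4 := by rwa [L0.dist_smul hd, dist_comm]
  have := dist_triangle4 (h • r) (h • s) (g • s) (g • r)
  linarith

/-- Markov's inequality for each test point of `s`, followed by a union bound. Dividing by `s.card +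
1` instead of `s.card` makes the sum strictly less than `ε` and covers empty `s`. -/
theorem L0.measure_lt_of_dist_lt (hd : ∀ (g : G) (x y : X), dist (g • x) (g • y) = dist x y)
    (g h : L0 Ω G) (s : Finset X) {δ : ℝ} (hδ : 0 < δ) {ε : ENNReal} (hε : 0 < ε)
    (hh : ∀ x ∈ s, ENNReal.ofReal (dist (h • const Ω x) (g • const Ω x)) <
      ENNReal.ofReal δ * (ε / (s.card + 1))) :
    volume {ω | (g ω)⁻¹ * h ω ∉ {u : G | ∀ y ∈ s, dist (u • y) ((1 : G) • y) < δ}} < ε := by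
  have hsub : {ω | (g ω)⁻¹ * h ω ∉ {u : G | ∀ y ∈ s, dist (u • y) ((1 : G) • y) < δ}} ⊆
      ⋃ x ∈ s, {ω | δ ≤ dist (h ω • x) (g ω • x)} := by
    intro ω hω
    have hω' : ¬ ∀ y ∈ s, dist (((g ω)⁻¹ * h ω) • y) ((1 : G) • y) < δ := hω
    push Not at hω'
    obtain ⟨y, hy, hle⟩ := hω'
    rw [← hd (g ω), smul_smul, mul_inv_cancel_left, one_smul] at hle
    exact Set.mem_biUnion hy hle
  have hone : ∀ x ∈ s, volume {ω | δ ≤ dist (h ω • x) (g ω • x)} ≤ ε / (s.card + 1) := by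
    intro x hx
    have hae : ∀ᵐ ω, dist ((h • const Ω x) ω) ((g • const Ω x) ω) = dist (h ω • x) (g ω • x) := by
      filter_upwards [coeFn_smul h (const Ω x), coeFn_smul g (const Ω x),
        coeFn_const (Ω := Ω) x] with ω h1 h2 h3
      rw [h1, h2, h3]
    have hint := (integrable_dist (h • const Ω x) (g • const Ω x)).congr hae
    have h1 := mul_meas_ge_le_integral_of_nonneg
      (Filter.Eventually.of_forall fun ω => dist_nonneg) hint δ
    rw [← integral_congr_ae hae, ← dist_def] at h1
    have h2 := (ENNReal.ofReal_le_ofReal h1).trans (hh x hx).le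
    rw [ENNReal.ofReal_mul hδ.le, ofReal_measureReal (measure_ne_top _ _)] at h2
    exact (ENNReal.mul_le_mul_iff_right (ENNReal.ofReal_pos.2 hδ).ne' ENNReal.ofReal_ne_top).1 h2
  rcases eq_or_ne ε ⊤ with rfl | hεt
  · exact measure_lt_top _ _
  refine (measure_mono hsub).trans_lt ((measure_biUnion_finset_le _ _).trans_lt ?_)
  refine (Finset.sum_le_sum hone).trans_lt ?_
  rw [Finset.sum_const, nsmul_eq_mul, ← mul_div_assoc]
  have hc : ((s.card : ENNReal) + 1) ≠ ⊤ := by simp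
  rw [ENNReal.div_lt_iff (Or.inl (by simp)) (Or.inl hc), mul_comm]
  refine (ENNReal.mul_lt_mul_iff_right hε.ne' hεt).2 ?_
  exact ENNReal.lt_add_right (by simp) one_ne_zero

/-- For a group of isometries of `X` with the topology of pointwise convergence, the topology of
convergence in measure on `G^Ω` is the topology of pointwise convergence on `X^Ω`. -/
theorem L0.isInducing_smul (hd : ∀ (g : G) (x y : X), dist (g • x) (g • y) = dist x y)
    (ht : IsInducing (fun (g : G) (x : X) => g • x)) :
    IsInducing (fun (g : L0 Ω G) (r : L0 Ω X) => g • r) := by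
  have key : ∀ (g : L0 Ω G) (s : Finset (L0 Ω X)) (δ : ℝ), 0 < δ → ∃ U ∈ 𝓝 (1 : G),
      ∃ ε : ENNReal, 0 < ε ∧ ∀ h : L0 Ω G, volume {ω | (g ω)⁻¹ * h ω ∉ U} < ε →
        ∀ r ∈ s, dist (h • r) (g • r) < δ := by
    classical
    intro g s δ hδ
    induction s using Finset.induction_on with
    | empty => exact ⟨Set.univ, Filter.univ_mem, 1, one_pos, by simp⟩
    | insert a s _ ih =>
      obtain ⟨U, hU, ε, hε, h1⟩ := ih
      obtain ⟨V, hV, η, hη, h2⟩ := L0.exists_convergenceInMeasure_dist_lt hd ht g a hδ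
      refine ⟨U ∩ V, Filter.inter_mem hU hV, min ε η, lt_min hε hη, fun h hh r hr => ?_⟩
      have hsU : volume {ω | (g ω)⁻¹ * h ω ∉ U} ≤ volume {ω | (g ω)⁻¹ * h ω ∉ U ∩ V} :=
        measure_mono fun ω (hω : _ ∉ U) (h' : _ ∈ U ∩ V) => hω h'.1
      have hsV : volume {ω | (g ω)⁻¹ * h ω ∉ V} ≤ volume {ω | (g ω)⁻¹ * h ω ∉ U ∩ V} :=
        measure_mono fun ω (hω : _ ∉ V) (h' : _ ∈ U ∩ V) => hω h'.2
      rcases Finset.mem_insert.1 hr with rfl | hr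
      · exact h2 h (hsV.trans_lt (hh.trans_le (min_le_right _ _)))
      · exact h1 h (hsU.trans_lt (hh.trans_le (min_le_left _ _))) r hr
  refine ⟨TopologicalSpace.ext_iff.2 fun S => ⟨fun hS => ?_, fun hS g hg => ?_⟩⟩
  · let τ : TopologicalSpace (L0 Ω G) :=
      TopologicalSpace.induced (fun (g : L0 Ω G) (r : L0 Ω X) => g • r) inferInstance
    refine isOpen_iff_mem_nhds.2 fun g hg => ?_
    obtain ⟨U, hU, ε, hε, hUS⟩ := hS g hg
    obtain ⟨s, δ, hδ, hs⟩ := exists_finset_of_mem_nhds_pointwise ht hU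
    classical
    -- `ε` may be infinite; the cap at `1` makes the threshold a genuine positive real radius.
    have hε' : 0 < min ε 1 := lt_min hε one_pos
    have hc : 0 < ENNReal.ofReal δ * (min ε 1 / (s.card + 1)) :=
      ENNReal.mul_pos (ENNReal.ofReal_pos.2 hδ).ne'
        (ENNReal.div_pos hε'.ne' (by simp)).ne'
    have hct : ENNReal.ofReal δ * (min ε 1 / (s.card + 1)) ≠ ⊤ :=
      ENNReal.mul_ne_top ENNReal.ofReal_ne_top (ENNReal.div_ne_top
        (ne_top_of_le_ne_top ENNReal.one_ne_top (min_le_right _ _)) (by simp))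
    have hnhds := pointwise_mem_nhds (F := fun (g : L0 Ω G) (r : L0 Ω X) => g • r) ⟨rfl⟩ g
      (s.image fun x => const Ω x) (ENNReal.toReal_pos hc.ne' hct)
    refine Filter.mem_of_superset hnhds fun h hh => hUS ?_
    refine (measure_mono ?_).trans_lt ((L0.measure_lt_of_dist_lt hd g h s hδ hε'
      fun x hx => ?_).trans_le (min_le_left _ _))
    · exact fun ω (hω : _ ∉ U) h' => hω (hs h')
    · rw [← ENNReal.ofReal_toReal hct]
      exact (ENNReal.ofReal_lt_ofReal_iff (ENNReal.toReal_pos hc.ne' hct)).2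
        (hh _ (Finset.mem_image_of_mem _ hx))
  · obtain ⟨s, δ, hδ, hs⟩ := exists_finset_of_isOpen_pointwise hS hg
    obtain ⟨U, hU, ε, hε, h1⟩ := key g s δ hδ
    exact ⟨U, hU, ε, hε, fun h hh => hs (h1 h hh)⟩

/-- `Aut(Ω)` acts continuously on `X^Ω`. -/
theorem MPAut.continuous_smul_const (r : L0 Ω X) : Continuous fun t : MPAut Ω => t • r := by
  rw [continuous_iff_continuousAt]
  intro t₀
  rw [ContinuousAt, Metric.tendsto_nhds]
  intro δ hδ
  obtain ⟨f, hf⟩ := L0.exists_simple_dist_lt r (show 0 < δ / 3 by linarith)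
  set s : L0 Ω X := L0.mk f f.stronglyMeasurable.aestronglyMeasurable with hs
  obtain ⟨C, hC⟩ := Metric.isBounded_iff.1 (BoundedSpace.bounded_univ (α := X))
  classical
  -- The level sets of the simple function, as elements of the auxiliary sort; the topology of
  -- `Aut(Ω)` controls their movement by definition.
  let A : X → Aux Ω := fun x => L0.mk (fun ω => if f ω = x then 1 else 0)
    (StronglyMeasurable.ite (f.measurableSet_fiber x) stronglyMeasurable_const
      stronglyMeasurable_const).aestronglyMeasurable
  have hle : ∀ t : MPAut Ω, dist (t • s) (t₀ • s) ≤ ∑ x ∈ f.range,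
      |C| * dist (t • A x) (t₀ • A x) := by
    intro t
    obtain ⟨e, rfl⟩ := MPAut.mk_surjective t
    obtain ⟨e₀, rfl⟩ := MPAut.mk_surjective t₀
    simp only [MPAut.mk_smul, L0.dist_def]
    simp_rw [← integral_const_mul]
    rw [← integral_finsetSum _ fun x _ => (L0.integrable_dist _ _).const_mul _]
    refine integral_mono_ae (L0.integrable_dist _ _)
      (integrable_finsetSum _ fun x _ => (L0.integrable_dist _ _).const_mul _) ?_
    have hA : ∀ e : mpGroup Ω, ∀ᵐ ω, ∀ x ∈ f.range, L0.shift e (A x) ω =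
        if f (e.1.symm ω) = x then 1 else 0 := by
      intro e
      rw [Filter.eventually_all_finset]
      intro x _
      filter_upwards [L0.coeFn_shift e (A x), e.2.2.quasiMeasurePreserving.ae (L0.coeFn_mk
        (fun ω => if f ω = x then (1 : unitInterval) else 0)
        (StronglyMeasurable.ite (f.measurableSet_fiber x) stronglyMeasurable_const
          stronglyMeasurable_const).aestronglyMeasurable)] with ω h1 h2
      exact h1.trans h2
    have hsh : ∀ e : mpGroup Ω, ∀ᵐ ω, L0.shift e s ω = f (e.1.symm ω) := by
      intro e
      filter_upwards [L0.coeFn_shift e s, e.2.2.quasiMeasurePreserving.ae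
        (L0.coeFn_mk f f.stronglyMeasurable.aestronglyMeasurable)] with ω h1 h2
      exact h1.trans h2
    filter_upwards [hA e, hA e₀, hsh e, hsh e₀] with ω h1 h2 h3 h4
    rw [h3, h4]
    -- Where the two shifted values differ, the indicator of the level set of the first value is `1`
    -- for one shift and `0` for the other, so that single summand already equals `|C|`.
    by_cases heq : f (e.1.symm ω) = f (e₀.1.symm ω)
    · rw [heq, dist_self]
      exact Finset.sum_nonneg fun x _ => mul_nonneg (abs_nonneg _) dist_nonneg
    · refine le_trans ?_ (Finset.single_le_sum
        (fun x _ => mul_nonneg (abs_nonneg C) dist_nonneg)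
        (SimpleFunc.mem_range_self f (e.1.symm ω)))
      rw [h1 _ (SimpleFunc.mem_range_self f _), h2 _ (SimpleFunc.mem_range_self f _), if_pos rfl,
        if_neg (Ne.symm heq)]
      have h01 : dist (1 : unitInterval) 0 = 1 := by
        rw [Subtype.dist_eq]; simp
      rw [h01, mul_one]
      exact (hC (Set.mem_univ _) (Set.mem_univ _)).trans (le_abs_self C)
  have hlim : Filter.Tendsto (fun t : MPAut Ω => ∑ x ∈ f.range,
      |C| * dist (t • A x) (t₀ • A x)) (𝓝 t₀) (𝓝 0) := by
    have hc : Continuous fun t : MPAut Ω => ∑ x ∈ f.range, |C| * dist (t • A x) (t₀ • A x) := by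
      fun_prop
    have := hc.tendsto t₀
    simpa using this
  filter_upwards [hlim.eventually (gt_mem_nhds (show 0 < δ / 3 by linarith))] with t ht
  have h1 : dist (t • r) (t • s) < δ / 3 := by rwa [MPAut.dist_smul]
  have h2 : dist (t₀ • s) (t₀ • r) < δ / 3 := by rwa [MPAut.dist_smul, dist_comm]
  have := dist_triangle4 (t • r) (t • s) (t₀ • s) (t₀ • r)
  have := hle t
  linarith

instance : ContinuousSMul (MPAut Ω) (L0 Ω X) :=
  ⟨continuous_uncurry_of_isometry (F := fun (t : MPAut Ω) (r : L0 Ω X) => t • r)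
    MPAut.dist_smul MPAut.continuous_smul_const⟩

end Pointwise

/-! ## Borel functions of the unit interval -/

namespace UnitFun

/-- The half of a number. -/
def half (x : I) : I := Set.projIcc (0 : ℝ) 1 zero_le_one ((x : ℝ) / 2)

/-- The truncated difference. -/
def tsub (x y : I) : I := Set.projIcc (0 : ℝ) 1 zero_le_one ((x : ℝ) - (y : ℝ))

/-- The truncated sum. -/
def tadd (x y : I) : I := unitInterval.symm (tsub (unitInterval.symm x) y)

theorem coe_half (x : I) : (half x : ℝ) = x / 2 := by
  have := x.2.1; have := x.2.2
  rw [half, Set.projIcc_of_mem zero_le_one (x := (x : ℝ) / 2) ⟨by linarith, by linarith⟩]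

theorem coe_tsub (x y : I) : (tsub x y : ℝ) = max ((x : ℝ) - y) 0 := by
  have := x.2.2; have := y.2.1
  rw [tsub, Set.coe_projIcc, min_eq_right (by linarith), max_comm]

theorem coe_tadd (x y : I) : (tadd x y : ℝ) = min ((x : ℝ) + y) 1 := by
  rw [tadd, unitInterval.coe_symm_eq, coe_tsub, unitInterval.coe_symm_eq]
  rcases le_total ((x : ℝ) + y) 1 with h | h
  · rw [min_eq_left h, max_eq_left (by linarith)]; ring
  · rw [min_eq_right h, max_eq_right (by linarith)]; ring

open Classical in
/-- The indicator function of a set. -/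
def ind {α : Type*} (A : Set α) (x : α) : I := if x ∈ A then 1 else 0

theorem ind_of_mem {α : Type*} {A : Set α} {x : α} (h : x ∈ A) : ind A x = 1 := if_pos h
theorem ind_of_notMem {α : Type*} {A : Set α} {x : α} (h : x ∉ A) : ind A x = 0 := if_neg h

theorem measurable_ind {α : Type*} [MeasurableSpace α] {A : Set α} (h : MeasurableSet A) :
    Measurable (ind A) :=
  Measurable.ite h measurable_const measurable_const

section Induction

variable {P : (I → I) → Prop} (hid : P id)
  (hcompl : ∀ v, P v → P fun x => unitInterval.symm (v x))
  (hhalf : ∀ v, P v → P fun x => half (v x))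
  (htsub : ∀ u v, P u → P v → P fun x => tsub (u x) (v x))
  (hlim : ∀ (v : ℕ → I → I) (w : I → I), (∀ n, P (v n)) →
    (∀ x, Filter.Tendsto (fun n => v n x) Filter.atTop (𝓝 (w x))) → P w)

include hcompl htsub in
theorem tadd_mem (u v : I → I) (hu : P u) (hv : P v) : P fun x => tadd (u x) (v x) :=
  hcompl _ (htsub _ _ (hcompl _ hu) hv)

include hid htsub in
theorem zero_mem : P fun _ => 0 := by
  convert htsub _ _ hid hid using 2 with x
  refine Subtype.ext ?_
  rw [coe_tsub]; simp

include hid hcompl htsub in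
theorem one_mem : P fun _ => 1 := by
  simpa using hcompl _ (zero_mem hid htsub)

include hid hcompl hhalf htsub hlim in
-- Binary expansion: `v` is half of its first digit plus half of a remainder with values in `[0,1]`.
-- The digit is an indicator of a preimage, the remainder satisfies the same hypothesis, and each
-- digit halves the error.
theorem mem_of_preimages {v : I → I} (h : ∀ B : Set I, MeasurableSet B → P (ind (v ⁻¹' B))) :
    P v := by
  have key : ∀ (n : ℕ) (v : I → I), (∀ B : Set I, MeasurableSet B → P (ind (v ⁻¹' B))) →
      ∃ v', P v' ∧ ∀ x, |(v x : ℝ) - v' x| ≤ (1 / 2) ^ n := by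
    intro n
    induction n with
    | zero =>
      intro v _
      refine ⟨_, zero_mem hid htsub, fun x => ?_⟩
      have := (v x).2.1; have := (v x).2.2
      simp only [Set.Icc.coe_zero, sub_zero, pow_zero]
      rw [abs_of_nonneg (by assumption)]; assumption
    | succ n ih =>
      intro v hv
      -- The indicator of `A` is the first binary digit; `φ` deletes it and shifts the expansion.
      let A : Set I := {y | (1 / 2 : ℝ) ≤ y}
      have hA : MeasurableSet A := measurableSet_le measurable_const measurable_subtype_coe
      let φ : I → I := fun y =>
        Set.projIcc (0 : ℝ) 1 zero_le_one (2 * (y : ℝ) - (ind A y : I))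
      have hφ : Measurable φ := by
        refine continuous_projIcc.measurable.comp ?_
        exact (measurable_subtype_coe.const_mul 2).sub
          (measurable_subtype_coe.comp (measurable_ind hA))
      have hφ' : ∀ y, (φ y : ℝ) = 2 * y - (ind A y : I) := by
        intro y
        have h0 := y.2.1; have h1 := y.2.2
        by_cases hy : y ∈ A
        · have hy' : (1 / 2 : ℝ) ≤ y := hy
          simp only [φ, ind_of_mem hy, Set.Icc.coe_one]
          rw [Set.projIcc_of_mem zero_le_one (x := 2 * (y : ℝ) - 1) ⟨by linarith, by linarith⟩]
        · have hy' : (y : ℝ) < 1 / 2 := not_le.1 hy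
          simp only [φ, ind_of_notMem hy, Set.Icc.coe_zero, sub_zero]
          rw [Set.projIcc_of_mem zero_le_one (x := 2 * (y : ℝ)) ⟨by linarith, by linarith⟩]
      obtain ⟨w', hw', hd⟩ := ih (fun x => φ (v x)) fun B hB => hv _ (hφ hB)
      refine ⟨_, tadd_mem hcompl htsub _ _ (hhalf _ (hv A hA)) (hhalf _ hw'), fun x => ?_⟩
      have h1 := hd x
      simp only [hφ'] at h1
      have e : ind (v ⁻¹' A) x = ind A (v x) := rfl
      rw [coe_tadd, coe_half, coe_half, e, min_eq_left]
      · rw [pow_succ, show (v x : ℝ) - ((ind A (v x) : I) / 2 + w' x / 2) =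
          (2 * v x - (ind A (v x) : I) - w' x) / 2 by ring, abs_div, abs_two]
        linarith
      · have := (ind A (v x)).2.2; have := (w' x).2.2; linarith
  choose v' hv' hd using fun n => key n v h
  refine hlim v' v hv' fun x => ?_
  rw [tendsto_iff_dist_tendsto_zero]
  refine squeeze_zero (fun _ => dist_nonneg) (fun n => ?_)
    (tendsto_pow_atTop_nhds_zero_of_lt_one (r := (1 / 2 : ℝ)) (by norm_num) (by norm_num))
  rw [dist_comm, Subtype.dist_eq, Real.dist_eq]
  exact hd n x

include hid hcompl hhalf htsub hlim in
/-- A class of functions on the unit interval which is closed under the arithmetic operations and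
under limits of sequences contains all Borel functions. -/
theorem borel_induction {v : I → I} (hv : Measurable v) : P v := by
  have h0 := zero_mem hid htsub
  have h1 := one_mem hid hcompl htsub
  -- Preimages under a constant map are empty or everything, so `0` and `1` suffice to produce all
  -- constants.
  have hconst : ∀ c : I, P fun _ => c := fun c => by
    refine mem_of_preimages hid hcompl hhalf htsub hlim fun B _ => ?_
    by_cases hc : c ∈ B
    · convert h1 using 2 with x
      exact ind_of_mem hc
    · convert h0 using 2 with x
      exact ind_of_notMem hc
  have hIoi : ∀ c : I, P (ind (Set.Ioi c)) := fun c => by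
    -- Repeated truncated doubling of `x - c`: values above `c` eventually reach `1`, the others
    -- stay at `0`.
    let d : ℕ → I → I := fun n =>
      Nat.rec (motive := fun _ => I → I) (fun x => tsub x c) (fun _ f x => tadd (f x) (f x)) n
    have hd : ∀ n, P (d n) := fun n => by
      induction n with
      | zero => exact htsub _ _ hid (hconst c)
      | succ n ih => exact tadd_mem hcompl htsub _ _ ih ih
    have hdc : ∀ (n : ℕ) (x : I), (d n x).1 = min (2 ^ n * max ((x : ℝ) - c) 0) 1 := fun n x => by
      induction n with
      | zero =>
        have := x.2.2; have := c.2.1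
        refine (coe_tsub x c).trans ?_
        rw [pow_zero, one_mul, min_eq_left (max_le (by linarith) zero_le_one)]
      | succ n ih =>
        refine (coe_tadd _ _).trans ?_
        rw [ih, pow_succ]
        rcases le_total (2 ^ n * max ((x : ℝ) - c) 0) 1 with h | h
        · rw [min_eq_left h]; congr 1; ring
        · rw [min_eq_right h, min_eq_right (by norm_num), min_eq_right]
          nlinarith
    refine hlim d _ hd fun x => ?_
    rw [tendsto_subtype_rng]
    show Filter.Tendsto (fun n => (d n x : ℝ)) _ _
    by_cases hx : x ∈ Set.Ioi c
    · rw [ind_of_mem hx]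
      have hx' : 0 < (x : ℝ) - c := sub_pos.2 hx
      have ht : Filter.Tendsto (fun n : ℕ => (2 : ℝ) ^ n * ((x : ℝ) - c)) Filter.atTop
          Filter.atTop :=
        (tendsto_pow_atTop_atTop_of_one_lt one_lt_two).atTop_mul_const hx'
      refine tendsto_const_nhds.congr' ?_
      filter_upwards [ht.eventually_ge_atTop 1] with n hn
      rw [hdc, max_eq_left hx'.le, min_eq_right hn]
      rfl
    · rw [ind_of_notMem hx]
      have hx' : (x : ℝ) - c ≤ 0 := sub_nonpos.2 (not_lt.1 hx)
      refine tendsto_const_nhds.congr fun n => ?_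
      rw [hdc, max_eq_right hx', mul_zero, min_eq_left zero_le_one]
      rfl
  have hset : ∀ A : Set I, MeasurableSet A → P (ind A) := by
    intro A hA
    induction A, hA using MeasurableSpace.induction_on_inter
      (borel_eq_generateFrom_Ioi I ▸ BorelSpace.measurable_eq (α := I)) isPiSystem_Ioi with
    | empty =>
      convert h0 using 2 with x
      exact ind_of_notMem (Set.notMem_empty x)
    | basic t ht =>
      obtain ⟨c, rfl⟩ := ht
      exact hIoi c
    | compl t _ ih =>
      convert hcompl _ ih using 2 with x
      by_cases hx : x ∈ t
      · rw [ind_of_mem hx, ind_of_notMem (by simpa using hx), unitInterval.symm_one]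
      · rw [ind_of_notMem hx, ind_of_mem (by simpa using hx), unitInterval.symm_zero]
    | iUnion f hf _ ih =>
      -- The truncated sum of two indicators is the indicator of the union, so finite unions come
      -- from arithmetic and the countable union is their limit.
      have hfin : ∀ n, P (ind (⋃ i, ⋃ (_ : i < n), f i)) := fun n => by
        induction n with
        | zero =>
          convert h0 using 2 with x
          exact ind_of_notMem (by simp)
        | succ n ihn =>
          convert tadd_mem hcompl htsub _ _ ihn (ih n) using 2 with x
          refine Subtype.ext ?_
          rw [coe_tadd]
          by_cases hx : x ∈ ⋃ i, ⋃ (_ : i < n), f i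
          · have hx' : x ∈ ⋃ i, ⋃ (_ : i < n + 1), f i := by
              simp only [Set.mem_iUnion] at hx ⊢
              obtain ⟨i, hi, hx⟩ := hx
              exact ⟨i, by omega, hx⟩
            have h01 := (ind (f n) x).2.1
            rw [ind_of_mem hx, ind_of_mem hx', Set.Icc.coe_one, min_eq_right (by linarith)]
          · by_cases hx' : x ∈ f n
            · rw [ind_of_notMem hx, ind_of_mem hx', ind_of_mem]
              · simp
              · simp only [Set.mem_iUnion]
                exact ⟨n, by omega, hx'⟩
            · rw [ind_of_notMem hx, ind_of_notMem hx', ind_of_notMem]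
              · simp
              · simp only [Set.mem_iUnion, not_exists] at hx ⊢
                intro i hi hxi
                rcases Nat.lt_succ_iff_lt_or_eq.1 hi with h | rfl
                · exact hx i h hxi
                · exact hx' hxi
      refine hlim _ _ hfin fun x => ?_
      by_cases hx : x ∈ ⋃ i, f i
      · rw [ind_of_mem hx]
        obtain ⟨i, hi⟩ := Set.mem_iUnion.1 hx
        refine tendsto_const_nhds.congr' ?_
        filter_upwards [Filter.eventually_gt_atTop i] with n hn
        rw [ind_of_mem]
        simp only [Set.mem_iUnion]
        exact ⟨i, hn, hi⟩
      · rw [ind_of_notMem hx]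
        refine tendsto_const_nhds.congr fun n => ?_
        rw [ind_of_notMem]
        simp only [Set.mem_iUnion, not_exists] at hx ⊢
        exact fun i _ => hx i
  exact mem_of_preimages hid hcompl hhalf htsub hlim fun B hB => hset _ (hv hB)

end Induction

end UnitFun

/-! ## Realization of automorphisms of the auxiliary sort -/

section Realization

variable {Ω : Type*} [MeasureSpace Ω]

/-- Composition of a `[0,1]`-valued random variable with a Borel function. -/
def Aux.bmap (v : I → I) (hv : Measurable v) (R : Aux Ω) : Aux Ω :=
  L0.mk (fun ω => v (R ω))
    (hv.comp R.stronglyMeasurable.measurable).stronglyMeasurable.aestronglyMeasurable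

theorem Aux.coeFn_bmap (v : I → I) (hv : Measurable v) (R : Aux Ω) :
    ∀ᵐ ω, Aux.bmap v hv R ω = v (R ω) :=
  L0.coeFn_mk _ _

theorem Aux.coeFn_compl (R : Aux Ω) : ∀ᵐ ω, R.compl ω = unitInterval.symm (R ω) :=
  L0.coeFn_map _ _ R

theorem Aux.coeFn_half (R : Aux Ω) : ∀ᵐ ω, R.half ω = UnitFun.half (R ω) :=
  L0.coeFn_map _ _ R

theorem Aux.coeFn_tsub (R S : Aux Ω) : ∀ᵐ ω, R.tsub S ω = UnitFun.tsub (R ω) (S ω) :=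
  L0.coeFn_map₂ _ _ R S

variable [IsFiniteMeasure (volume : Measure Ω)]

theorem Aux.tendsto_bmap (v : ℕ → I → I) (hv : ∀ n, Measurable (v n)) (w : I → I)
    (hw : Measurable w) (h : ∀ x, Filter.Tendsto (fun n => v n x) Filter.atTop (𝓝 (w x)))
    (R : Aux Ω) :
    Filter.Tendsto (fun n => Aux.bmap (v n) (hv n) R) Filter.atTop (𝓝 (Aux.bmap w hw R)) := by
  rw [tendsto_iff_dist_tendsto_zero]
  have h1 : Filter.Tendsto (fun n => ∫ ω, dist (v n (R ω)) (w (R ω))) Filter.atTop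
      (𝓝 (∫ ω : Ω, (0 : ℝ))) := by
    refine tendsto_integral_of_dominated_convergence (fun _ => 1) (fun n => ?_)
      (integrable_const _) (fun n => Filter.Eventually.of_forall fun ω => ?_)
      (Filter.Eventually.of_forall fun ω => tendsto_iff_dist_tendsto_zero.1 (h _))
    · exact (((hv n).comp R.stronglyMeasurable.measurable).dist
        (hw.comp R.stronglyMeasurable.measurable)).aestronglyMeasurable
    · rw [Real.norm_of_nonneg dist_nonneg]
      exact Real.dist_le_of_mem_Icc_01 (v n (R ω)).2 (w (R ω)).2
  rw [integral_zero] at h1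
  refine h1.congr fun n => ?_
  rw [L0.dist_def]
  refine integral_congr_ae ?_
  filter_upwards [Aux.coeFn_bmap (v n) (hv n) R, Aux.coeFn_bmap w hw R] with ω h1 h2
  rw [h1, h2]

/-- Maps that preserve the structure of the auxiliary sort. -/
structure IsAuxHom (τ : Aux Ω → Aux Ω) : Prop where
  dist : ∀ R S : Aux Ω, dist (τ R) (τ S) = dist R S
  expect : ∀ R : Aux Ω, (τ R).expect = R.expect
  compl : ∀ R : Aux Ω, τ R.compl = (τ R).compl
  half : ∀ R : Aux Ω, τ R.half = (τ R).half
  tsub : ∀ R S : Aux Ω, τ (R.tsub S) = (τ R).tsub (τ S)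

theorem IsAuxHom.symm {τ : Equiv.Perm (Aux Ω)} (h : IsAuxHom τ) : IsAuxHom τ.symm where
  dist R S := by rw [← h.dist, τ.apply_symm_apply, τ.apply_symm_apply]
  expect R := by rw [← h.expect, τ.apply_symm_apply]
  compl R := by rw [Equiv.symm_apply_eq, h.compl, τ.apply_symm_apply]
  half R := by rw [Equiv.symm_apply_eq, h.half, τ.apply_symm_apply]
  tsub R S := by rw [Equiv.symm_apply_eq, h.tsub, τ.apply_symm_apply, τ.apply_symm_apply]

theorem MPAut.isAuxHom (t : MPAut Ω) : IsAuxHom fun R : Aux Ω => t • R where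
  dist := MPAut.dist_smul t
  expect := MPAut.expect_smul t
  compl R := MPAut.smul_map t _ _ R
  half R := MPAut.smul_map t _ _ R
  tsub R S := MPAut.smul_map₂ t _ _ R S

/-- The functions `v` for which this holds contain the identity and are closed under the arithmetic
operations, which `τ` respects, and under pointwise limits, since `τ` is an isometry and hence
continuous. `UnitFun.borel_induction` applies. -/
theorem IsAuxHom.map_bmap {τ : Aux Ω → Aux Ω} (h : IsAuxHom τ) (J : Aux Ω) (v : I → I)
    (hv : Measurable v) : τ (Aux.bmap v hv J) = Aux.bmap v hv (τ J) := by
  let P : (I → I) → Prop := fun v => ∃ hv : Measurable v, τ (Aux.bmap v hv J) = Aux.bmap v hv (τ J)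
  suffices hP : P v from hP.2
  refine UnitFun.borel_induction (P := P) ?_ ?_ ?_ ?_ ?_ hv
  · refine ⟨measurable_id, ?_⟩
    have e : ∀ R : Aux Ω, Aux.bmap id measurable_id R = R := fun R => L0.mk_coeFn R
    rw [e, e]
  · rintro v ⟨hv, h1⟩
    have e : ∀ R : Aux Ω, Aux.bmap (fun x => unitInterval.symm (v x))
        (unitInterval.continuous_symm.measurable.comp hv) R = (Aux.bmap v hv R).compl := fun R => by
      refine L0.ext ?_
      filter_upwards [Aux.coeFn_bmap (fun x => unitInterval.symm (v x))
        (unitInterval.continuous_symm.measurable.comp hv) R, Aux.coeFn_bmap v hv R,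
        Aux.coeFn_compl (Aux.bmap v hv R)] with ω h1 h2 h3
      rw [h1, h3, h2]
    exact ⟨unitInterval.continuous_symm.measurable.comp hv, by rw [e, e, h.compl, h1]⟩
  · rintro v ⟨hv, h1⟩
    have hm : Measurable fun x => UnitFun.half (v x) :=
      (continuous_projIcc.measurable.comp (measurable_subtype_coe.div_const 2)).comp hv
    have e : ∀ R : Aux Ω, Aux.bmap (fun x => UnitFun.half (v x)) hm R
        = (Aux.bmap v hv R).half := fun R => by
      refine L0.ext ?_
      filter_upwards [Aux.coeFn_bmap (fun x => UnitFun.half (v x)) hm R, Aux.coeFn_bmap v hv R,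
        Aux.coeFn_half (Aux.bmap v hv R)] with ω h1 h2 h3
      rw [h1, h3, h2]
    exact ⟨hm, by rw [e, e, h.half, h1]⟩
  · rintro u v ⟨hu, h0⟩ ⟨hv, h1⟩
    have hm : Measurable fun x => UnitFun.tsub (u x) (v x) :=
      continuous_projIcc.measurable.comp
        ((measurable_subtype_coe.comp hu).sub (measurable_subtype_coe.comp hv))
    have e : ∀ R : Aux Ω, Aux.bmap (fun x => UnitFun.tsub (u x) (v x)) hm R
        = (Aux.bmap u hu R).tsub (Aux.bmap v hv R) := fun R => by
      refine L0.ext ?_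
      filter_upwards [Aux.coeFn_bmap (fun x => UnitFun.tsub (u x) (v x)) hm R,
        Aux.coeFn_bmap u hu R, Aux.coeFn_bmap v hv R,
        Aux.coeFn_tsub (Aux.bmap u hu R) (Aux.bmap v hv R)] with ω h1 h2 h3 h4
      rw [h1, h4, h2, h3]
    exact ⟨hm, by rw [e, e, h.tsub, h0, h1]⟩
  · intro v w hv hl
    choose hm hv using hv
    have hw : Measurable w := measurable_of_tendsto_metrizable hm (tendsto_pi_nhds.2 hl)
    refine ⟨hw, tendsto_nhds_unique (f := fun n => τ (Aux.bmap (v n) (hm n) J))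
      (l := Filter.atTop) ?_ ?_⟩
    · have hc : Continuous τ := (Isometry.of_dist_eq h.dist).continuous
      exact (hc.tendsto _).comp (Aux.tendsto_bmap v hm w hw hl J)
    · simp only [hv]
      exact Aux.tendsto_bmap v hm w hw hl (τ J)

/-- The coordinate `j`, seen as an element `J` of the auxiliary sort, generates everything: `f = (f
∘ j⁻¹) ∘ J`, so `τ` is determined by `τ J`, and `T = j⁻¹ ∘ τ J`. -/
theorem IsAuxHom.exists_map {τ : Aux Ω → Aux Ω} (h : IsAuxHom τ) (j : Ω ≃ᵐ I) :
    ∃ T : Ω → Ω, MeasurePreserving T volume volume ∧ ∀ R : Aux Ω, ∀ᵐ ω, τ R ω = R (T ω) := by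
  let J : Aux Ω := L0.mk j j.measurable.stronglyMeasurable.aestronglyMeasurable
  have hJ : ∀ᵐ ω, J ω = j ω := L0.coeFn_mk _ _
  let T : Ω → Ω := fun ω => j.symm (τ J ω)
  have hT : Measurable T := j.symm.measurable.comp (τ J).stronglyMeasurable.measurable
  have key : ∀ f : Ω → I, Measurable f → ∀ R : Aux Ω, (∀ᵐ ω, R ω = f ω) →
      ∀ᵐ ω, τ R ω = f (T ω) := by
    intro f hf R hR
    have hm : Measurable fun x => f (j.symm x) := hf.comp j.symm.measurable
    have hRJ : R = Aux.bmap (fun x => f (j.symm x)) hm J := by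
      refine L0.ext ?_
      filter_upwards [Aux.coeFn_bmap (fun x => f (j.symm x)) hm J, hJ, hR] with ω h1 h2 h3
      rw [h1, h2, h3, j.symm_apply_apply]
    rw [hRJ, h.map_bmap]
    exact Aux.coeFn_bmap _ hm (τ J)
  refine ⟨T, ⟨hT, ?_⟩, fun R => key R R.stronglyMeasurable.measurable R
    (Filter.Eventually.of_forall fun _ => rfl)⟩
  ext A hA
  rw [Measure.map_apply hT hA]
  -- The expectations of the indicator of `A` and of its image are the measures of `A` and of `T⁻¹
  -- A`.
  let R : Aux Ω := L0.mk (UnitFun.ind A)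
    (UnitFun.measurable_ind hA).stronglyMeasurable.aestronglyMeasurable
  have hR : ∀ᵐ ω, R ω = UnitFun.ind A ω := L0.coeFn_mk _ _
  have hI : ∀ B : Set Ω, MeasurableSet B → ∫ ω, ((UnitFun.ind B ω : I) : ℝ) =
      (volume : Measure Ω).real B := by
    intro B hB
    rw [← integral_indicator_one hB]
    refine integral_congr_ae (Filter.Eventually.of_forall fun ω => ?_)
    by_cases hω : ω ∈ B
    · simp [UnitFun.ind_of_mem hω, hω]
    · simp [UnitFun.ind_of_notMem hω, hω]
  have h1 : (τ R).expect = (volume : Measure Ω).real (T ⁻¹' A) := by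
    rw [← hI _ (hT hA), Aux.expect]
    refine integral_congr_ae ?_
    filter_upwards [key _ (UnitFun.measurable_ind hA) R hR] with ω h1
    rw [h1]; rfl
  have h2 : R.expect = (volume : Measure Ω).real A := by
    rw [← hI _ hA, Aux.expect]
    refine integral_congr_ae ?_
    filter_upwards [hR] with ω h1
    rw [h1]
  rw [h.expect, h2] at h1
  exact ((measureReal_eq_measureReal_iff (measure_ne_top _ _) (measure_ne_top _ _)).1 h1).symm

omit [IsFiniteMeasure (volume : Measure Ω)] in
/-- Two measure-preserving maps which are inverse to each other almost everywhere come from an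
invertible measure-preserving transformation. -/
theorem exists_mpGroup {T S : Ω → Ω} (hT : MeasurePreserving T volume volume)
    (hS : MeasurePreserving S volume volume) (hTS : ∀ᵐ ω, T (S ω) = ω)
    (hST : ∀ᵐ ω, S (T ω) = ω) :
    ∃ e : mpGroup Ω, (∀ᵐ ω, e.1 ω = T ω) ∧ ∀ᵐ ω, e.1.symm ω = S ω := by
  obtain ⟨A₀, hA₀s, hA₀m, hA₀⟩ : ∃ A₀ ⊆ {ω | T (S ω) = ω ∧ S (T ω) = ω}, MeasurableSet A₀ ∧
      ∀ᵐ ω, ω ∈ A₀ := by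
    obtain ⟨B, hB, hBm, hB0⟩ := exists_measurable_superset_of_null (ae_iff.1 (hTS.and hST))
    refine ⟨Bᶜ, fun ω hω => ?_, hBm.compl, by simpa [ae_iff] using hB0⟩
    by_contra h
    exact hω (hB h)
  -- Starting from a conull set where `T` and `S` are mutually inverse, each step removes the points
  -- that leave the previous set under `T` or `S`. The intersection `B` is conull and invariant
  -- under both; the permutation is `T` on `B` and the identity off `B`.
  let A : ℕ → Set Ω := fun n => Nat.rec (motive := fun _ => Set Ω) A₀ (fun _ B => B ∩ T ⁻¹' B ∩ S ⁻¹' B) n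
  have hAm : ∀ n, MeasurableSet (A n) := fun n => by
    induction n with
    | zero => exact hA₀m
    | succ n ih => exact (ih.inter (hT.measurable ih)).inter (hS.measurable ih)
  have hAae : ∀ n, ∀ᵐ ω, ω ∈ A n := fun n => by
    induction n with
    | zero => exact hA₀
    | succ n ih =>
      filter_upwards [ih, hT.quasiMeasurePreserving.ae ih, hS.quasiMeasurePreserving.ae ih]
        with ω h1 h2 h3
      exact ⟨⟨h1, h2⟩, h3⟩
  let B : Set Ω := ⋂ n, A n
  have hBm : MeasurableSet B := MeasurableSet.iInter hAm
  have hBae : ∀ᵐ ω, ω ∈ B := by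
    filter_upwards [ae_all_iff.2 hAae] with ω h
    exact Set.mem_iInter.2 h
  have hBT : ∀ ω ∈ B, T ω ∈ B := fun ω h =>
    Set.mem_iInter.2 fun n => (Set.mem_iInter.1 h (n + 1)).1.2
  have hBS : ∀ ω ∈ B, S ω ∈ B := fun ω h =>
    Set.mem_iInter.2 fun n => (Set.mem_iInter.1 h (n + 1)).2
  have hB0 : ∀ ω ∈ B, T (S ω) = ω ∧ S (T ω) = ω := fun ω h => hA₀s (Set.mem_iInter.1 h 0)
  classical
  let e : Equiv.Perm Ω :=
    { toFun := fun ω => if ω ∈ B then T ω else ω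
      invFun := fun ω => if ω ∈ B then S ω else ω
      left_inv := fun ω => by
        by_cases h : ω ∈ B
        · simp only [if_pos h, if_pos (hBT ω h), (hB0 ω h).2]
        · simp only [if_neg h]
      right_inv := fun ω => by
        by_cases h : ω ∈ B
        · simp only [if_pos h, if_pos (hBS ω h), (hB0 ω h).1]
        · simp only [if_neg h] }
  have he : ∀ᵐ ω, e ω = T ω := by
    filter_upwards [hBae] with ω h
    exact if_pos h
  have hes : ∀ᵐ ω, e.symm ω = S ω := by
    filter_upwards [hBae] with ω h
    exact if_pos h
  refine ⟨⟨e, ⟨Measurable.ite hBm hT.measurable measurable_id, ?_⟩,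
    ⟨Measurable.ite hBm hS.measurable measurable_id, ?_⟩⟩, he, hes⟩
  · rw [Measure.map_congr he, hT.map_eq]
  · rw [Measure.map_congr hes, hS.map_eq]

/-- Automorphisms of the auxiliary sort are induced by transformations of the base. -/
theorem IsAuxHom.exists_MPAut {τ : Equiv.Perm (Aux Ω)} (h : IsAuxHom τ) (j : Ω ≃ᵐ I) :
    ∃ t : MPAut Ω, ∀ R : Aux Ω, t • R = τ R := by
  obtain ⟨T, hT, hT'⟩ := h.exists_map j
  obtain ⟨S, hS, hS'⟩ := h.symm.exists_map j
  let J : Aux Ω := L0.mk j j.measurable.stronglyMeasurable.aestronglyMeasurable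
  have hJ : ∀ᵐ ω, J ω = j ω := L0.coeFn_mk _ _
  have hTS : ∀ᵐ ω, T (S ω) = ω := by
    have h1 := hS' (τ J)
    rw [τ.symm_apply_apply] at h1
    filter_upwards [h1, hJ, hS.quasiMeasurePreserving.ae (hT' J),
      (hT.comp hS).quasiMeasurePreserving.ae hJ] with ω h1 h2 h3 h4
    refine j.injective ?_
    rw [← h2, h1, h3]
    exact h4.symm
  have hST : ∀ᵐ ω, S (T ω) = ω := by
    have h1 := hT' (τ.symm J)
    rw [τ.apply_symm_apply] at h1
    filter_upwards [h1, hJ, hT.quasiMeasurePreserving.ae (hS' J),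
      (hS.comp hT).quasiMeasurePreserving.ae hJ] with ω h1 h2 h3 h4
    refine j.injective ?_
    rw [← h2, h1, h3]
    exact h4.symm
  -- The roles are exchanged because `e` acts through `e⁻¹`: it is `e.symm` that must agree with
  -- `T`.
  obtain ⟨e, _, he⟩ := exists_mpGroup hS hT hST hTS
  refine ⟨MPAut.mk e, fun R => ?_⟩
  rw [MPAut.mk_smul]
  refine L0.ext ?_
  filter_upwards [L0.coeFn_shift e R, hT' R, he] with ω h1 h2 h3
  rw [h1, h2, h3]

omit [IsFiniteMeasure (volume : Measure Ω)] in
-- An injective coordinate `J` detects every transformation: if `J ∘ e⁻¹ = J` almost everywhere,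
-- then `e` is trivial.
theorem MPAut.eq_of_smul_eq (j : Ω ≃ᵐ I) {s t : MPAut Ω} (h : ∀ R : Aux Ω, s • R = t • R) :
    s = t := by
  rw [← inv_mul_eq_one]
  have h' : ∀ R : Aux Ω, (s⁻¹ * t) • R = R := fun R => by
    rw [mul_smul, ← h, inv_smul_smul]
  obtain ⟨e, he⟩ := MPAut.mk_surjective (s⁻¹ * t)
  rw [← he] at h' ⊢
  let J : Aux Ω := L0.mk j j.measurable.stronglyMeasurable.aestronglyMeasurable
  have hJ : ∀ᵐ ω, J ω = j ω := L0.coeFn_mk _ _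
  have h1 : e⁻¹ ∈ mpNull Ω := by
    have h2 := L0.coeFn_shift e J
    rw [← MPAut.mk_smul, h'] at h2
    filter_upwards [h2, hJ, e.2.2.quasiMeasurePreserving.ae hJ] with ω h2 h3 h4
    rw [h3, h4] at h2
    exact (j.injective h2).symm
  exact (QuotientGroup.eq_one_iff e).2 (inv_mem_iff.1 h1)

end Realization

/-! ## The space `[0,1]^Ω` as a retract of `L¹` -/

section AuxMetric

variable {Ω : Type*} [MeasureSpace Ω] [IsFiniteMeasure (volume : Measure Ω)]

theorem Aux.integrable (R : Aux Ω) : Integrable (fun ω => (R ω : ℝ)) :=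
  Integrable.of_bound (continuous_subtype_val.comp_stronglyMeasurable
    R.stronglyMeasurable).aestronglyMeasurable 1 (Filter.Eventually.of_forall fun ω => by
      rw [Real.norm_of_nonneg (R ω).2.1]; exact (R ω).2.2)

/-- A `[0,1]`-valued random variable as an integrable function. -/
def Aux.toL1 (R : Aux Ω) : Ω →₁[(volume : Measure Ω)] ℝ := R.integrable.toL1 _

theorem Aux.isometry_toL1 : Isometry (Aux.toL1 : Aux Ω → _) := by
  refine Isometry.of_dist_eq fun R S => ?_
  rw [L1.dist_eq_integral_dist, L0.dist_def]
  refine integral_congr_ae ?_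
  filter_upwards [R.integrable.coeFn_toL1, S.integrable.coeFn_toL1] with ω h1 h2
  rw [Aux.toL1, Aux.toL1, h1, h2, Subtype.dist_eq]

/-- The projection of an integrable function to `[0,1]`. -/
def Aux.ofL1 (f : Ω →₁[(volume : Measure Ω)] ℝ) : Aux Ω :=
  L0.mk (fun ω => Set.projIcc (0 : ℝ) 1 zero_le_one (f ω))
    (continuous_projIcc.comp_aestronglyMeasurable (Lp.aestronglyMeasurable f))

theorem Aux.dist_ofL1_le (f g : Ω →₁[(volume : Measure Ω)] ℝ) :
    dist (Aux.ofL1 f) (Aux.ofL1 g) ≤ dist f g := by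
  rw [L1.dist_eq_integral_dist, L0.dist_def]
  refine integral_mono_ae (L0.integrable_dist _ _) ?_ ?_
  · simp_rw [dist_eq_norm]
    exact ((L1.integrable_coeFn f).sub (L1.integrable_coeFn g)).norm
  · filter_upwards [L0.coeFn_mk (fun ω => Set.projIcc (0 : ℝ) 1 zero_le_one (f ω))
      (continuous_projIcc.comp_aestronglyMeasurable (Lp.aestronglyMeasurable f)),
      L0.coeFn_mk (fun ω => Set.projIcc (0 : ℝ) 1 zero_le_one (g ω))
      (continuous_projIcc.comp_aestronglyMeasurable (Lp.aestronglyMeasurable g))] with ω h1 h2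
    rw [Aux.ofL1, Aux.ofL1, h1, h2, Subtype.dist_eq, Real.dist_eq, Real.dist_eq]
    exact Set.abs_projIcc_sub_projIcc zero_le_one

theorem Aux.ofL1_toL1 (R : Aux Ω) : Aux.ofL1 R.toL1 = R := by
  refine L0.ext ?_
  filter_upwards [L0.coeFn_mk (fun ω => Set.projIcc (0 : ℝ) 1 zero_le_one (R.toL1 ω))
    (continuous_projIcc.comp_aestronglyMeasurable (Lp.aestronglyMeasurable R.toL1)),
    R.integrable.coeFn_toL1] with ω h1 h2
  rw [Aux.ofL1, h1, Aux.toL1, h2, Set.projIcc_val]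

/-- A Cauchy sequence converges in `L¹`, and the 1-Lipschitz retraction `Aux.ofL1` carries the limit
back. -/
instance : CompleteSpace (Aux Ω) := by
  refine Metric.complete_of_cauchySeq_tendsto fun u hu => ?_
  obtain ⟨f, hf⟩ := cauchySeq_tendsto_of_complete
    ((Aux.isometry_toL1 (Ω := Ω)).uniformContinuous.comp_cauchySeq hu)
  refine ⟨Aux.ofL1 f, ?_⟩
  have hc : Continuous (Aux.ofL1 : (Ω →₁[(volume : Measure Ω)] ℝ) → Aux Ω) :=
    (LipschitzWith.of_dist_le_mul (K := 1) fun f g => by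
      simpa using Aux.dist_ofL1_le f g).continuous
  refine ((hc.tendsto f).comp hf).congr fun n => ?_
  exact Aux.ofL1_toL1 (u n)

instance [MeasurableSpace.CountablyGenerated Ω] : SecondCountableTopology (Aux Ω) := by
  have : Fact ((1 : ENNReal) ≤ 1) := ⟨le_rfl⟩
  have : Fact ((1 : ENNReal) ≠ ⊤) := ⟨ENNReal.one_ne_top⟩
  exact (Aux.isometry_toL1 (Ω := Ω)).isUniformInducing.isInducing.secondCountableTopology

end AuxMetric

/-! ## Measurability criteria -/

section Measurability

/-- In a separable metric space every open set is a countable union of balls with rational radii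
centred in a dense sequence. -/
theorem stronglyMeasurable_of_measurable_dist {α : Type*} [MeasurableSpace α] {X : Type*}
    [MetricSpace X] [SecondCountableTopology X] {f : α → X}
    (h : ∀ x, Measurable fun a => dist (f a) x) : StronglyMeasurable f := by
  rcases isEmpty_or_nonempty α with hα | hα
  · borelize X
    exact (measurable_of_empty f).stronglyMeasurable
  have : Nonempty X := hα.map f
  borelize X
  refine Measurable.stronglyMeasurable (measurable_of_isOpen fun U hU => ?_)
  let d := TopologicalSpace.denseSeq X
  have hd : DenseRange d := TopologicalSpace.denseRange_denseSeq X
  have : f ⁻¹' U = ⋃ (n : ℕ) (q : ℚ) (_ : Metric.ball (d n) q ⊆ U), {a | dist (f a) (d n) < q} := by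
    ext a
    simp only [Set.mem_iUnion]
    constructor
    · intro ha
      obtain ⟨ε, hε, hεU⟩ := Metric.isOpen_iff.1 hU (f a) ha
      obtain ⟨q, hq0, hq⟩ := exists_rat_btwn (show (0 : ℝ) < ε / 2 by linarith)
      obtain ⟨n, hn⟩ := hd.exists_dist_lt (f a) hq0
      refine ⟨n, q, fun x hx => hεU ?_, hn⟩
      have h1 : dist x (d n) < q := hx
      have := dist_triangle_right x (f a) (d n)
      exact Metric.mem_ball.2 (by linarith)
    · rintro ⟨n, q, hU', ha⟩
      exact hU' ha
  rw [this]
  exact MeasurableSet.iUnion fun n => MeasurableSet.iUnion fun q => MeasurableSet.iUnion fun _ =>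
    measurableSet_lt (h (d n)) measurable_const

end Measurability

/-! ## Random variables on a product -/

section Curry

variable {Ω₀ Ω₁ : Type*} [MeasureSpace Ω₀] [MeasureSpace Ω₁]
  [IsProbabilityMeasure (volume : Measure Ω₀)] [IsProbabilityMeasure (volume : Measure Ω₁)]

omit [IsProbabilityMeasure (volume : Measure Ω₀)] in
theorem ae_prod {p : Ω₀ × Ω₁ → Prop} (h : ∀ᵐ ω, p ω) : ∀ᵐ ω₀, ∀ᵐ ω₁, p (ω₀, ω₁) :=
  Measure.ae_ae_of_ae_prod h

theorem L0.dist_eq_integral_curry (r s : Aux (Ω₀ × Ω₁)) :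
    dist r s = ∫ ω₀, dist (r.curry ω₀) (s.curry ω₀) := by
  rw [dist_def]
  refine (integral_prod (μ := (volume : Measure Ω₀)) (ν := (volume : Measure Ω₁)) _
    (integrable_dist r s)).trans ?_
  refine integral_congr_ae (Filter.Eventually.of_forall fun ω₀ => ?_)
  show _ = dist (r.curry ω₀) (s.curry ω₀)
  rw [dist_def]
  refine integral_congr_ae ?_
  filter_upwards [coeFn_curry r ω₀, coeFn_curry s ω₀] with ω₁ h1 h2
  rw [h1, h2]

omit [IsProbabilityMeasure (volume : Measure Ω₀)] in
theorem L0.curry_congr {r : Aux (Ω₀ × Ω₁)} {f : Ω₀ × Ω₁ → I} (h : ∀ᵐ ω, r ω = f ω) :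
    ∀ᵐ ω₀, ∀ᵐ ω₁, r.curry ω₀ ω₁ = f (ω₀, ω₁) := by
  filter_upwards [ae_prod h] with ω₀ h
  filter_upwards [h, coeFn_curry r ω₀] with ω₁ h1 h2
  rw [h2, h1]

variable [MeasurableSpace.CountablyGenerated Ω₁]

omit [IsProbabilityMeasure (volume : Measure Ω₀)] in
-- The distance of a section to a fixed `s` is a partial integral of a jointly measurable function,
-- hence measurable in `ω₀`; by separability of `Aux Ω₁` this is enough.
theorem L0.stronglyMeasurable_curry (r : Aux (Ω₀ × Ω₁)) :
    StronglyMeasurable fun ω₀ => r.curry ω₀ := by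
  refine stronglyMeasurable_of_measurable_dist fun s => ?_
  have h : (fun ω₀ => dist (r.curry ω₀) s) = fun ω₀ => ∫ ω₁, dist (r (ω₀, ω₁)) (s ω₁) := by
    funext ω₀
    rw [dist_def]
    refine integral_congr_ae ?_
    filter_upwards [coeFn_curry r ω₀] with ω₁ h1
    rw [h1]
  rw [h]
  have hm : StronglyMeasurable fun p : Ω₀ × Ω₁ => dist (r p) (s p.2) :=
    r.stronglyMeasurable.dist (s.stronglyMeasurable.comp_measurable measurable_snd)
  exact (hm.integral_prod_right').measurable

/-- A random variable on `Ω₀ × Ω₁` as a random variable with values in `[0,1]^{Ω₁}`. -/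
def L0.curryL0 (r : Aux (Ω₀ × Ω₁)) : L0 Ω₀ (Aux Ω₁) :=
  mk r.curry (stronglyMeasurable_curry r).aestronglyMeasurable

omit [IsProbabilityMeasure (volume : Measure Ω₀)] in
theorem L0.coeFn_curryL0 (r : Aux (Ω₀ × Ω₁)) : ∀ᵐ ω₀, curryL0 r ω₀ = r.curry ω₀ :=
  coeFn_mk _ _

theorem L0.dist_curryL0 (r s : Aux (Ω₀ × Ω₁)) : dist (curryL0 r) (curryL0 s) = dist r s := by
  rw [dist_eq_integral_curry, dist_def]
  refine integral_congr_ae ?_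
  filter_upwards [coeFn_curryL0 r, coeFn_curryL0 s] with ω h1 h2
  rw [h1, h2]

/-- Currying is an isometry of a complete space, so its range is closed. The range contains the
simple functions, which are dense; for these, joint measurability only involves finitely many
measurable sections. -/
theorem L0.curryL0_surjective :
    Function.Surjective (curryL0 : Aux (Ω₀ × Ω₁) → L0 Ω₀ (Aux Ω₁)) := by
  have hi : Isometry (curryL0 : Aux (Ω₀ × Ω₁) → L0 Ω₀ (Aux Ω₁)) := Isometry.of_dist_eq dist_curryL0
  rw [← Set.range_eq_univ, ← hi.isClosedEmbedding.isClosed_range.closure_eq, ← dense_iff_closure_eq]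
  intro F
  rw [Metric.mem_closure_iff]
  intro ε hε
  obtain ⟨f, hf⟩ := exists_simple_dist_lt F hε
  have hm : Measurable fun p : Ω₀ × Ω₁ => f p.1 p.2 :=
    (f.comp Prod.fst measurable_fst).measurable_bind (fun b p => b p.2)
      fun b => b.stronglyMeasurable.measurable.comp measurable_snd
  let r : Aux (Ω₀ × Ω₁) := mk (fun p => f p.1 p.2) hm.stronglyMeasurable.aestronglyMeasurable
  refine ⟨_, ⟨r, rfl⟩, ?_⟩
  convert hf using 2
  refine ext ?_
  filter_upwards [coeFn_curryL0 r, coeFn_mk f f.stronglyMeasurable.aestronglyMeasurable,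
    curry_congr (r := r) (coeFn_mk _ _)] with ω h1 h2 h3
  rw [h1, h2]
  exact ext h3

/-- The identification of `[0,1]^{Ω₀ × Ω₁}` with `([0,1]^{Ω₁})^{Ω₀}`. -/
def L0.curryEquiv (Ω₀ Ω₁ : Type*) [MeasureSpace Ω₀] [MeasureSpace Ω₁]
    [IsProbabilityMeasure (volume : Measure Ω₀)] [IsProbabilityMeasure (volume : Measure Ω₁)]
    [MeasurableSpace.CountablyGenerated Ω₁] : Aux (Ω₀ × Ω₁) ≃ L0 Ω₀ (Aux Ω₁) :=
  Equiv.ofBijective curryL0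
    ⟨(Isometry.of_dist_eq dist_curryL0).injective, curryL0_surjective⟩

theorem L0.coeFn_curryEquiv (r : Aux (Ω₀ × Ω₁)) : ∀ᵐ ω₀, curryEquiv Ω₀ Ω₁ r ω₀ = r.curry ω₀ :=
  coeFn_mk _ _

theorem L0.dist_curryEquiv (r s : Aux (Ω₀ × Ω₁)) :
    dist (curryEquiv Ω₀ Ω₁ r) (curryEquiv Ω₀ Ω₁ s) = dist r s :=
  dist_curryL0 r s

theorem L0.isometry_curryEquiv : Isometry (curryEquiv Ω₀ Ω₁) :=
  Isometry.of_dist_eq dist_curryEquiv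

theorem L0.isometry_curryEquiv_symm : Isometry (curryEquiv Ω₀ Ω₁).symm :=
  Isometry.of_dist_eq fun r s => by
    rw [← dist_curryEquiv, Equiv.apply_symm_apply, Equiv.apply_symm_apply]

end Curry

/-! ## Local isometries of spaces of random variables -/

section Local

variable {Ω : Type*} [MeasureSpace Ω] {X : Type*} [MetricSpace X]

/-- The image of `x` is the limit of `u` along any subsequence of `d` tending to `x`. Describing it
by its distances to the `u n` determines it uniquely (`eq_of_forall_dist_eq`) and forces the map to
be an isometry (`isometry_of_forall_dist_eq`). -/
theorem exists_isometry_extension [CompleteSpace X] {d u : ℕ → X} (hd : DenseRange d)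
    (h : ∀ n m, dist (u n) (u m) = dist (d n) (d m)) :
    ∃ f : X → X, ∀ x n, dist (f x) (u n) = dist x (d n) := by
  have key : ∀ x, ∃ y, ∀ n, dist y (u n) = dist x (d n) := by
    intro x
    have h1 : ∀ k : ℕ, ∃ n, dist x (d n) < 1 / ((k : ℝ) + 1) := fun k =>
      hd.exists_dist_lt x (by positivity)
    choose n hn using h1
    have hx : Filter.Tendsto (fun k => d (n k)) Filter.atTop (𝓝 x) := by
      rw [tendsto_iff_dist_tendsto_zero]
      refine squeeze_zero (fun _ => dist_nonneg) (fun k => ?_)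
        tendsto_one_div_add_atTop_nhds_zero_nat
      rw [dist_comm]
      exact (hn k).le
    have hc : CauchySeq fun k => u (n k) := by
      have := hx.cauchySeq
      rw [Metric.cauchySeq_iff] at this ⊢
      simpa only [h] using this
    obtain ⟨y, hy⟩ := cauchySeq_tendsto_of_complete hc
    refine ⟨y, fun m => tendsto_nhds_unique (hy.dist (tendsto_const_nhds (x := u m))) ?_⟩
    simp only [h]
    exact hx.dist tendsto_const_nhds
  choose f hf using key
  exact ⟨f, hf⟩

theorem eq_of_forall_dist_eq {d u : ℕ → X} (hd : DenseRange d) {x y y' : X}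
    (h : ∀ n, dist y (u n) = dist x (d n)) (h' : ∀ n, dist y' (u n) = dist x (d n)) : y = y' := by
  refine eq_of_forall_dist_le fun ε hε => ?_
  obtain ⟨n, hn⟩ := hd.exists_dist_lt x (show 0 < ε / 2 by linarith)
  have := dist_triangle_right y y' (u n)
  rw [h, h'] at this
  linarith

theorem isometry_of_forall_dist_eq {d u : ℕ → X} (hd : DenseRange d) {f : X → X}
    (h : ∀ x n, dist (f x) (u n) = dist x (d n)) : Isometry f := by
  have h0 : ∀ n, u n = f (d n) := fun n => by
    rw [eq_comm, ← dist_eq_zero, h, dist_self]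
  refine Isometry.of_dist_eq fun x y => ?_
  refine le_antisymm (le_of_forall_pos_le_add fun ε hε => ?_)
    (le_of_forall_pos_le_add fun ε hε => ?_)
  all_goals
    obtain ⟨n, hn⟩ := hd.exists_dist_lt y (show 0 < ε / 2 by linarith)
    have h1 := h x n
    have h2 := h y n
  · have := dist_triangle_right (f x) (f y) (u n)
    have := dist_triangle x y (d n)
    linarith
  · have := dist_triangle_right x y (d n)
    have := dist_triangle (f x) (f y) (u n)
    linarith

/-- A permutation of `X^Ω` which preserves distances pointwise acts pointwise by isometric
bijections of `X`. -/
theorem exists_pointwise_isometry [CompleteSpace X] [TopologicalSpace.SeparableSpace X] [Nonempty X]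
    (ρ : Equiv.Perm (L0 Ω X))
    (hρ : ∀ r s : L0 Ω X, ∀ᵐ ω, dist (ρ r ω) (ρ s ω) = dist (r ω) (s ω)) :
    ∃ g : Ω → X → X, (∀ᵐ ω, Isometry (g ω) ∧ Function.Surjective (g ω)) ∧
      ∀ r : L0 Ω X, ∀ᵐ ω, ρ r ω = g ω (r ω) := by
  let d := TopologicalSpace.denseSeq X
  have hd : DenseRange d := TopologicalSpace.denseRange_denseSeq X
  have hc : ∀ᵐ ω, ∀ n, L0.const Ω (d n) ω = d n := ae_all_iff.2 fun n => L0.coeFn_const (d n)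
  have h1 : ∀ᵐ ω, ∃ f : X → X, ∀ x n, dist (f x) (ρ (L0.const Ω (d n)) ω) = dist x (d n) := by
    have h2 : ∀ᵐ ω, ∀ n m, dist (ρ (L0.const Ω (d n)) ω) (ρ (L0.const Ω (d m)) ω) =
        dist (L0.const Ω (d n) ω) (L0.const Ω (d m) ω) :=
      ae_all_iff.2 fun n => ae_all_iff.2 fun m => hρ _ _
    filter_upwards [h2, hc] with ω h2 hc
    refine exists_isometry_extension hd fun n m => ?_
    rw [h2, hc, hc]
  classical
  -- The images of countably many constants fix the isometry at `ω`, so one null set serves for all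
  -- of them; the exceptional `id` is a dummy value.
  let g : Ω → X → X := fun ω =>
    if h : ∃ f : X → X, ∀ x n, dist (f x) (ρ (L0.const Ω (d n)) ω) = dist x (d n) then h.choose
    else id
  have hg : ∀ᵐ ω, ∀ x n, dist (g ω x) (ρ (L0.const Ω (d n)) ω) = dist x (d n) := by
    filter_upwards [h1] with ω h
    simp only [g, dif_pos h]
    exact h.choose_spec
  have hr : ∀ r : L0 Ω X, ∀ᵐ ω, ρ r ω = g ω (r ω) := by
    intro r
    have h2 : ∀ᵐ ω, ∀ n, dist (ρ r ω) (ρ (L0.const Ω (d n)) ω) = dist (r ω) (L0.const Ω (d n) ω) :=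
      ae_all_iff.2 fun n => hρ _ _
    filter_upwards [h2, hc, hg] with ω h2 hc hg
    refine eq_of_forall_dist_eq hd (fun n => ?_) (hg (r ω))
    rw [h2, hc]
  refine ⟨g, ?_, hr⟩
  -- Applying `hr` to preimages of constants under `ρ` shows that the range of `g ω` contains the
  -- dense sequence; being complete, the range is closed.
  have h3 : ∀ᵐ ω, ∀ n, d n = g ω (ρ.symm (L0.const Ω (d n)) ω) := ae_all_iff.2 fun n => by
    have := hr (ρ.symm (L0.const Ω (d n)))
    rw [ρ.apply_symm_apply] at this
    filter_upwards [this, hc] with ω h1 h2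
    rw [← h1, h2]
  filter_upwards [hg, h3] with ω hg h3
  have hi := isometry_of_forall_dist_eq hd hg
  refine ⟨hi, Set.range_eq_univ.1 ?_⟩
  rw [← hi.isClosedEmbedding.isClosed_range.closure_eq, ← dense_iff_closure_eq]
  refine hd.mono ?_
  rintro _ ⟨n, rfl⟩
  exact ⟨_, (h3 n).symm⟩

theorem continuous_of_denseRange {A : Type*} [TopologicalSpace A] {F : A → X → X}
    (hF : ∀ a x y, dist (F a x) (F a y) = dist x y) {d : ℕ → X} (hd : DenseRange d)
    (hc : ∀ n, Continuous fun a => F a (d n)) (x : X) : Continuous fun a => F a x := by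
  refine continuous_of_uniform_approx_of_continuous fun U hU => ?_
  obtain ⟨ε, hε, hU⟩ := Metric.mem_uniformity_dist.1 hU
  obtain ⟨n, hn⟩ := hd.exists_dist_lt x hε
  exact ⟨_, hc n, fun a => hU (by rwa [hF])⟩

variable {G : Type*} [Group G] [TopologicalSpace G] [MulAction G X]

/-- Evaluation at any point is a uniform limit of evaluations at points of the dense sequence. So
the topology of `G` comes from the countable power `X^ℕ`, where measurability can be tested
coordinatewise. -/
theorem isInducing_smul_of_denseRange (hd : ∀ (g : G) (x y : X), dist (g • x) (g • y) = dist x y)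
    (ht : IsInducing (fun (g : G) (x : X) => g • x)) {d : ℕ → X} (hdr : DenseRange d) :
    IsInducing (fun (g : G) (n : ℕ) => g • d n) := by
  refine ⟨le_antisymm ?_ ?_⟩
  · rw [← continuous_iff_le_induced]
    exact continuous_pi fun n => (continuous_apply (d n)).comp ht.continuous
  · rw [ht.eq_induced, ← continuous_iff_le_induced]
    refine @continuous_pi _ _ _ (_) _ _ fun x => ?_
    refine @continuous_of_denseRange _ _ _ (_) (fun (g : G) (x : X) => g • x) hd _ hdr
      (fun n => ?_) x
    exact @Continuous.comp G (ℕ → X) X (_) _ _ (fun g n => g • d n) (fun f => f n)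
      (continuous_apply n) continuous_induced_dom

theorem aestronglyMeasurable_of_smul [SecondCountableTopology X] [Nonempty X]
    (hd : ∀ (g : G) (x y : X), dist (g • x) (g • y) = dist x y)
    (ht : IsInducing (fun (g : G) (x : X) => g • x))
    (hf : ∀ g h : G, (∀ x : X, g • x = h • x) → g = h) {k : Ω → G}
    (hk : ∀ x : X, AEStronglyMeasurable (fun ω => k ω • x) volume) :
    AEStronglyMeasurable k volume := by
  let d := TopologicalSpace.denseSeq X
  have hdr : DenseRange d := TopologicalSpace.denseRange_denseSeq X
  have hi := isInducing_smul_of_denseRange hd ht hdr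
  have hinj : Function.Injective (fun (g : G) (n : ℕ) => g • d n) := fun g h hgh => by
    refine hf g h fun x => ?_
    have hcont : ∀ g : G, Continuous fun x : X => g • x := fun g =>
      (Isometry.of_dist_eq (hd g)).continuous
    refine congrFun (hdr.equalizer (hcont g) (hcont h) ?_) x
    funext n
    exact congrFun hgh n
  have : TopologicalSpace.PseudoMetrizableSpace G := hi.pseudoMetrizableSpace
  rw [← (⟨hi, hinj⟩ : IsEmbedding _).aestronglyMeasurable_comp_iff]
  borelize X
  exact (aemeasurable_pi_lambda _ fun n => (hk (d n)).aemeasurable).aestronglyMeasurable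

/-- Pointwise actions of a group of isometries. -/
theorem exists_L0_smul_eq [IsTopologicalGroup G] [ContinuousSMul G X] [CompleteSpace X]
    [SecondCountableTopology X] [Nonempty X]
    (hd : ∀ (g : G) (x y : X), dist (g • x) (g • y) = dist x y)
    (ht : IsInducing (fun (g : G) (x : X) => g • x))
    (hf : ∀ g h : G, (∀ x : X, g • x = h • x) → g = h) (ρ : Equiv.Perm (L0 Ω X))
    {g : Ω → X → X} (hg : ∀ r : L0 Ω X, ∀ᵐ ω, ρ r ω = g ω (r ω))
    (hG : ∀ᵐ ω, ∃ k : G, ∀ x, k • x = g ω x) :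
    ∃ k : L0 Ω G, ∀ r : L0 Ω X, ρ r = k • r := by
  classical
  let k : Ω → G := fun ω => if h : ∃ k : G, ∀ x, k • x = g ω x then h.choose else 1
  have hk : ∀ᵐ ω, ∀ x, k ω • x = g ω x := by
    filter_upwards [hG] with ω h
    simp only [k, dif_pos h]
    exact h.choose_spec
  have hm : AEStronglyMeasurable k volume := by
    refine aestronglyMeasurable_of_smul hd ht hf fun x => ?_
    refine (ρ (L0.const Ω x)).stronglyMeasurable.aestronglyMeasurable.congr ?_
    filter_upwards [hg (L0.const Ω x), hk, L0.coeFn_const (Ω := Ω) x] with ω h1 h2 h3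
    rw [h1, h2, h3]
  refine ⟨L0.mk k hm, fun r => L0.ext ?_⟩
  filter_upwards [hg r, hk, L0.coeFn_mk k hm, L0.coeFn_smul (L0.mk k hm) r] with ω h1 h2 h3 h4
  rw [h4, h3, h2, h1]

end Local

/-! ## Pointwise automorphisms of metric structures -/

section StructureLocal

variable {Ω : Type*} [MeasureSpace Ω] {L : Language.{u}} {M : Structure.{u, w} L}

theorem Structure.continuous_funMap {n : ℕ} (f : L.Functions n) :
    Continuous fun a : Fin n → M => M.funMap f a :=
  ((Term.app f fun i => Term.var i).eval_uniformContinuous M).continuous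

theorem Structure.continuous_relMap {n : ℕ} (R : L.Relations n) :
    Continuous fun a : Fin n → M => M.relMap R a :=
  ((Formula.rel R fun i => Term.var i).eval_uniformContinuous M).continuous

theorem Structure.aut_ext {g h : M.Aut} (H : ∀ x : M, g • x = h • x) : g = h :=
  Subtype.ext (Equiv.ext H)

theorem denseRange_comp {X : Type*} [TopologicalSpace X] {d : ℕ → X} (hd : DenseRange d) (n : ℕ) :
    DenseRange fun (a : Fin n → ℕ) (i : Fin n) => d (a i) := by
  have := dense_pi (Set.univ : Set (Fin n)) (s := fun _ => Set.range d) fun _ _ => hd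
  refine this.mono fun x hx => ?_
  choose a ha using fun i => hx i (Set.mem_univ i)
  exact ⟨a, funext ha⟩

/-- With countably many symbols and a countable dense set, the pointwise identities hold
simultaneously off a null set, and continuity extends them to all tuples. Function symbols enter
through the distance of `f(r)` to a further variable, because the randomization only records truth
values of formulas. -/
theorem exists_L0_aut (hL : L.IsCountable) [TopologicalSpace.SeparableSpace M]
    (ρ : Equiv.Perm (L0 Ω M))
    (hdist : ∀ r s : L0 Ω M, ∀ᵐ ω, dist (ρ r ω) (ρ s ω) = dist (r ω) (s ω))
    (hfun : ∀ (n : ℕ) (f : L.Functions n) (r : Fin n → L0 Ω M) (s : L0 Ω M),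
      ∀ᵐ ω, dist (M.funMap f fun i => ρ (r i) ω) (ρ s ω) = dist (M.funMap f fun i => r i ω) (s ω))
    (hrel : ∀ (n : ℕ) (R : L.Relations n) (r : Fin n → L0 Ω M),
      ∀ᵐ ω, M.relMap R (fun i => ρ (r i) ω) = M.relMap R fun i => r i ω) :
    ∃ k : L0 Ω M.Aut, ∀ r : L0 Ω M, ρ r = k • r := by
  have : SecondCountableTopology M := UniformSpace.secondCountable_of_separable M
  obtain ⟨g, hg, hgr⟩ := exists_pointwise_isometry ρ hdist
  refine exists_L0_smul_eq M.aut_dist ⟨rfl⟩ (fun _ _ => Structure.aut_ext) ρ hgr ?_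
  let d := TopologicalSpace.denseSeq M
  have hd : DenseRange d := TopologicalSpace.denseRange_denseSeq M
  have hc : ∀ᵐ ω, ∀ n, L0.const Ω (d n) ω = d n := ae_all_iff.2 fun n => L0.coeFn_const (d n)
  have hρ : ∀ᵐ ω, ∀ n, ρ (L0.const Ω (d n)) ω = g ω (d n) := ae_all_iff.2 fun n => by
    filter_upwards [hgr (L0.const Ω (d n)), hc] with ω h1 h2
    rw [h1, h2]
  have := hL.1
  have := hL.2
  have hF : ∀ᵐ ω, ∀ (n : ℕ) (f : L.Functions n) (a : Fin n → ℕ) (m : ℕ),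
      dist (M.funMap f fun i => ρ (L0.const Ω (d (a i))) ω) (ρ (L0.const Ω (d m)) ω) =
        dist (M.funMap f fun i => L0.const Ω (d (a i)) ω) (L0.const Ω (d m) ω) :=
    ae_all_iff.2 fun n => ae_all_iff.2 fun f => ae_all_iff.2 fun a => ae_all_iff.2 fun m =>
      hfun n f (fun i => L0.const Ω (d (a i))) _
  have hR : ∀ᵐ ω, ∀ (n : ℕ) (R : L.Relations n) (a : Fin n → ℕ),
      M.relMap R (fun i => ρ (L0.const Ω (d (a i))) ω) =
        M.relMap R fun i => L0.const Ω (d (a i)) ω :=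
    ae_all_iff.2 fun n => ae_all_iff.2 fun f => ae_all_iff.2 fun a =>
      hrel n f (fun i => L0.const Ω (d (a i)))
  filter_upwards [hg, hc, hρ, hF, hR] with ω hg hc hρ hF hR
  simp only [hρ, hc] at hF hR
  have hgc := hg.1.continuous
  refine ⟨⟨Equiv.ofBijective (g ω) ⟨hg.1.injective, hg.2⟩, hg.1.dist_eq, fun n f a => ?_,
    fun n R a => ?_⟩, fun x => rfl⟩
  · have h1 : (fun p : (Fin n → M) × M => dist (M.funMap f fun i => g ω (p.1 i)) (g ω p.2)) =
        fun p => dist (M.funMap f p.1) p.2 := by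
      refine ((denseRange_comp hd n).prodMap hd).equalizer ?_ ?_ (funext fun p => ?_)
      · exact ((Structure.continuous_funMap f).comp (continuous_pi fun i =>
          hgc.comp ((continuous_apply i).comp continuous_fst))).dist (hgc.comp continuous_snd)
      · exact ((Structure.continuous_funMap f).comp continuous_fst).dist continuous_snd
      · exact hF n f p.1 p.2
    -- Choosing the extra variable equal to `f(a)` makes the preserved distance zero.
    have h2 := congrFun h1 (a, M.funMap f a)
    simp only [dist_self] at h2
    exact (dist_eq_zero.1 h2).symm
  · have h1 : (fun p : Fin n → M => M.relMap R fun i => g ω (p i)) = fun p => M.relMap R p := by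
      refine (denseRange_comp hd n).equalizer ?_ (Structure.continuous_relMap R)
        (funext fun p => hR n R p)
      exact (Structure.continuous_relMap R).comp (continuous_pi fun i =>
        hgc.comp (continuous_apply i))
    exact congrFun h1 a

end StructureLocal

/-! ## Pointwise automorphisms of the auxiliary sort -/

section AuxLocal

variable {Ω : Type*} [MeasureSpace Ω] [IsFiniteMeasure (volume : Measure Ω)]

theorem UnitFun.dist_half_le (x y : I) : dist (half x) (half y) ≤ dist x y := by
  rw [Subtype.dist_eq, Subtype.dist_eq, coe_half, coe_half, Real.dist_eq, Real.dist_eq,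
    ← sub_div, abs_div, abs_two]
  have := abs_nonneg ((x : ℝ) - y)
  linarith

theorem UnitFun.dist_tsub_le (x y x' y' : I) :
    dist (tsub x y) (tsub x' y') ≤ dist x x' + dist y y' := by
  simp only [Subtype.dist_eq, coe_tsub, Real.dist_eq]
  refine (abs_max_sub_max_le_abs _ _ _).trans ?_
  rw [show (x : ℝ) - y - (x' - y') = (x - x') + (y' - y) by ring, abs_sub_comm (y : ℝ)]
  exact abs_add_le _ _

theorem Aux.continuous_half : Continuous (Aux.half : Aux Ω → Aux Ω) := by
  refine (LipschitzWith.of_dist_le_mul (K := 1) fun R S => ?_).continuous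
  rw [NNReal.coe_one, one_mul, L0.dist_def, L0.dist_def]
  refine integral_mono_ae (L0.integrable_dist _ _) (L0.integrable_dist _ _) ?_
  filter_upwards [R.coeFn_half, S.coeFn_half] with ω h1 h2
  rw [h1, h2]
  exact UnitFun.dist_half_le _ _

theorem Aux.continuous_tsub : Continuous fun p : Aux Ω × Aux Ω => p.1.tsub p.2 := by
  refine (LipschitzWith.of_dist_le_mul (K := 2) fun p q => ?_).continuous
  have h : dist (p.1.tsub p.2) (q.1.tsub q.2) ≤ dist p.1 q.1 + dist p.2 q.2 := by
    rw [L0.dist_def, L0.dist_def, L0.dist_def,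
      ← integral_add (L0.integrable_dist _ _) (L0.integrable_dist _ _)]
    refine integral_mono_ae (L0.integrable_dist _ _)
      ((L0.integrable_dist _ _).add (L0.integrable_dist _ _)) ?_
    filter_upwards [p.1.coeFn_tsub p.2, q.1.coeFn_tsub q.2] with ω h1 h2
    rw [h1, h2]
    exact UnitFun.dist_tsub_le _ _ _ _
  have h1 : dist p.1 q.1 ≤ dist p q := le_max_left _ _
  have h2 : dist p.2 q.2 ≤ dist p q := le_max_right _ _
  rw [NNReal.coe_ofNat]
  linarith

theorem Aux.continuous_compl : Continuous (Aux.compl : Aux Ω → Aux Ω) := by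
  have h : (Aux.compl : Aux Ω → Aux Ω) = fun R => Aux.tsub (L0.const Ω 1) R := by
    funext R
    refine L0.ext ?_
    filter_upwards [R.coeFn_compl, Aux.coeFn_tsub (L0.const Ω 1) R,
      L0.coeFn_const (Ω := Ω) (1 : I)] with ω h1 h2 h3
    rw [h1, h2, h3]
    refine Subtype.ext ?_
    have := (R ω).2.2
    rw [unitInterval.coe_symm_eq, UnitFun.coe_tsub, Set.Icc.coe_one, max_eq_left (by linarith)]
  rw [h]
  exact Aux.continuous_tsub.comp (continuous_const.prodMk continuous_id)

/-- `R.tsub R` is the zero variable, and the expectation is the `L¹` distance to it. -/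
theorem Aux.expect_eq_dist (R : Aux Ω) : R.expect = dist R (R.tsub R) := by
  rw [Aux.expect, L0.dist_def]
  refine integral_congr_ae ?_
  filter_upwards [R.coeFn_tsub R] with ω h1
  rw [h1, Subtype.dist_eq, UnitFun.coe_tsub, sub_self, max_self, Real.dist_eq, sub_zero,
    abs_of_nonneg (R ω).2.1]

/-- The expectation can be defined from the distance and the truncated difference. -/
theorem IsAuxHom.of_dist {τ : Aux Ω → Aux Ω} (hd : ∀ R S, Dist.dist (τ R) (τ S) = Dist.dist R S)
    (hc : ∀ R : Aux Ω, τ R.compl = (τ R).compl) (hh : ∀ R : Aux Ω, τ R.half = (τ R).half)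
    (ht : ∀ R S : Aux Ω, τ (R.tsub S) = (τ R).tsub (τ S)) : IsAuxHom τ :=
  ⟨hd, fun R => by rw [Aux.expect_eq_dist, ← ht, hd, ← Aux.expect_eq_dist], hc, hh, ht⟩

/-- The analogue of `exists_L0_aut` for fibres `[0,1]^Ω`. The operations need only be checked on
constants from a dense sequence; preservation of expectation on each fibre then follows from
`IsAuxHom.of_dist`, and the fibre maps come from transformations of `Ω`. -/
theorem exists_L0_MPAut {Ω₀ : Type*} [MeasureSpace Ω₀] [MeasurableSpace.CountablyGenerated Ω]
    (j : Ω ≃ᵐ I) (ρ : Equiv.Perm (L0 Ω₀ (Aux Ω)))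
    (hdist : ∀ r s : L0 Ω₀ (Aux Ω), ∀ᵐ ω, dist (ρ r ω) (ρ s ω) = dist (r ω) (s ω))
    (hcompl : ∀ R : Aux Ω, ∀ᵐ ω, ρ (L0.const Ω₀ R.compl) ω = (ρ (L0.const Ω₀ R) ω).compl)
    (hhalf : ∀ R : Aux Ω, ∀ᵐ ω, ρ (L0.const Ω₀ R.half) ω = (ρ (L0.const Ω₀ R) ω).half)
    (htsub : ∀ R S : Aux Ω, ∀ᵐ ω, ρ (L0.const Ω₀ (R.tsub S)) ω =
      (ρ (L0.const Ω₀ R) ω).tsub (ρ (L0.const Ω₀ S) ω)) :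
    ∃ h : L0 Ω₀ (MPAut Ω), ∀ r : L0 Ω₀ (Aux Ω), ρ r = h • r := by
  have : Nonempty (Aux Ω) := ⟨L0.const Ω 0⟩
  obtain ⟨g, hg, hgr⟩ := exists_pointwise_isometry ρ hdist
  refine exists_L0_smul_eq MPAut.dist_smul ⟨rfl⟩ (fun _ _ => MPAut.eq_of_smul_eq j) ρ hgr ?_
  let d := TopologicalSpace.denseSeq (Aux Ω)
  have hd : DenseRange d := TopologicalSpace.denseRange_denseSeq (Aux Ω)
  have hρ : ∀ R : Aux Ω, ∀ᵐ ω, ρ (L0.const Ω₀ R) ω = g ω R := fun R => by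
    filter_upwards [hgr (L0.const Ω₀ R), L0.coeFn_const (Ω := Ω₀) R] with ω h1 h2
    rw [h1, h2]
  have h1 : ∀ᵐ ω, ∀ n, g ω (d n).compl = (g ω (d n)).compl := ae_all_iff.2 fun n => by
    filter_upwards [hcompl (d n), hρ (d n), hρ (d n).compl] with ω h1 h2 h3
    rw [← h3, h1, h2]
  have h2 : ∀ᵐ ω, ∀ n, g ω (d n).half = (g ω (d n)).half := ae_all_iff.2 fun n => by
    filter_upwards [hhalf (d n), hρ (d n), hρ (d n).half] with ω h1 h2 h3
    rw [← h3, h1, h2]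
  have h3 : ∀ᵐ ω, ∀ n m, g ω ((d n).tsub (d m)) = (g ω (d n)).tsub (g ω (d m)) :=
    ae_all_iff.2 fun n => ae_all_iff.2 fun m => by
      filter_upwards [htsub (d n) (d m), hρ (d n), hρ (d m), hρ ((d n).tsub (d m))]
        with ω h1 h2 h3 h4
      rw [← h4, h1, h2, h3]
  filter_upwards [hg, h1, h2, h3] with ω hg h1 h2 h3
  have hc := hg.1.continuous
  let τ : Equiv.Perm (Aux Ω) := Equiv.ofBijective (g ω) ⟨hg.1.injective, hg.2⟩
  have hτ : IsAuxHom τ := by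
    refine IsAuxHom.of_dist hg.1.dist_eq (congrFun ?_) (congrFun ?_) fun R S => ?_
    · exact hd.equalizer (hc.comp Aux.continuous_compl) (Aux.continuous_compl.comp hc) (funext h1)
    · exact hd.equalizer (hc.comp Aux.continuous_half) (Aux.continuous_half.comp hc) (funext h2)
    · have := (hd.prodMap hd).equalizer (g := fun p : Aux Ω × Aux Ω => g ω (p.1.tsub p.2))
        (h := fun p => (g ω p.1).tsub (g ω p.2)) (hc.comp Aux.continuous_tsub)
        (Aux.continuous_tsub.comp ((hc.comp continuous_fst).prodMk (hc.comp continuous_snd)))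
        (funext fun p => h3 p.1 p.2)
      exact congrFun this (R, S)
  exact hτ.exists_MPAut j

end AuxLocal

/-- A permutation that fixes the range of an injection setwise induces a permutation of its
domain. -/
theorem exists_perm_of_image_range {A B : Type*} {p : A → B} (hp : Function.Injective p)
    (τ : Equiv.Perm B) (h : τ '' Set.range p = Set.range p) :
    ∃ τ' : Equiv.Perm A, ∀ a, p (τ' a) = τ (p a) := by
  have h1 : ∀ a, ∃ b, p b = τ (p a) := fun a => by
    have : τ (p a) ∈ τ '' Set.range p := ⟨_, ⟨a, rfl⟩, rfl⟩
    rwa [h] at this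
  have h2 : ∀ a, ∃ b, p b = τ.symm (p a) := fun a => by
    have : p a ∈ τ '' Set.range p := by rw [h]; exact ⟨a, rfl⟩
    obtain ⟨_, ⟨b, rfl⟩, hb⟩ := this
    exact ⟨b, by rw [← hb, τ.symm_apply_apply]⟩
  choose f hf using h1
  choose g hg using h2
  refine ⟨⟨f, g, fun a => hp ?_, fun a => hp ?_⟩, hf⟩
  · rw [hg, hf, τ.symm_apply_apply]
  · rw [hf, hg, τ.apply_symm_apply]

theorem Aux.continuous_uncurry_tsub {Ω : Type*} [MeasureSpace Ω]
    [IsFiniteMeasure (volume : Measure Ω)] :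
    Continuous (Function.uncurry (Aux.tsub : Aux Ω → Aux Ω → Aux Ω)) :=
  Aux.continuous_tsub

/-! ## The action of the wreath product -/

section Wreath

variable {Ω : Type*} [MeasureSpace Ω] {G : Type*} [Group G] [TopologicalSpace G]
  [IsTopologicalGroup G]

theorem L0.smul_map {X Y : Type*} [TopologicalSpace X] [TopologicalSpace Y] [MulAction G X]
    [MulAction G Y] [ContinuousSMul G X] [ContinuousSMul G Y] (f : X → Y) (hf : Continuous f)
    (hG : ∀ (g : G) (x : X), g • f x = f (g • x)) (g : L0 Ω G) (r : L0 Ω X) :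
    g • map f hf r = map f hf (g • r) := by
  refine ext ?_
  filter_upwards [coeFn_smul g (map f hf r), coeFn_map f hf r, coeFn_map f hf (g • r),
    coeFn_smul g r] with ω h1 h2 h3 h4
  rw [h1, h2, h3, h4, hG]

theorem L0.smul_map₂ {X Y Z : Type*} [TopologicalSpace X] [TopologicalSpace Y] [TopologicalSpace Z]
    [MulAction G X] [MulAction G Y] [MulAction G Z] [ContinuousSMul G X] [ContinuousSMul G Y]
    [ContinuousSMul G Z] (f : X → Y → Z) (hf : Continuous (Function.uncurry f))
    (hG : ∀ (g : G) (x : X) (y : Y), g • f x y = f (g • x) (g • y)) (g : L0 Ω G) (r : L0 Ω X)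
    (s : L0 Ω Y) : g • map₂ f hf r s = map₂ f hf (g • r) (g • s) := by
  refine ext ?_
  filter_upwards [coeFn_smul g (map₂ f hf r s), coeFn_map₂ f hf r s,
    coeFn_map₂ f hf (g • r) (g • s), coeFn_smul g r, coeFn_smul g s] with ω h1 h2 h3 h4 h5
  rw [h1, h2, h3, h4, h5, hG]

/-- Constants from a dense sequence already separate the values `g ω` almost surely, since each `g
ω` acts continuously and `G` acts faithfully. -/
theorem L0.eq_of_smul_eq {X : Type*} [MetricSpace X] [SecondCountableTopology X] [Nonempty X]
    [MulAction G X] [ContinuousSMul G X] (hd : ∀ (g : G) (x y : X), dist (g • x) (g • y) = dist x y)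
    (hf : ∀ g h : G, (∀ x : X, g • x = h • x) → g = h) {g h : L0 Ω G}
    (H : ∀ r : L0 Ω X, g • r = h • r) : g = h := by
  let d := TopologicalSpace.denseSeq X
  have hdr : DenseRange d := TopologicalSpace.denseRange_denseSeq X
  have h1 : ∀ᵐ ω, ∀ n, g ω • d n = h ω • d n := ae_all_iff.2 fun n => by
    filter_upwards [coeFn_eq (H (const Ω (d n))), coeFn_smul g (const Ω (d n)),
      coeFn_smul h (const Ω (d n)), coeFn_const (Ω := Ω) (d n)] with ω h1 h2 h3 h4
    rw [h2, h3, h4] at h1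
    exact h1
  refine ext ?_
  filter_upwards [h1] with ω h1
  exact hf _ _ (congrFun (hdr.equalizer (Isometry.of_dist_eq (hd (g ω))).continuous
    (Isometry.of_dist_eq (hd (h ω))).continuous (funext h1)))

variable (Ω G) in
/-- The action of `G ≀ Ω` on `X^Ω`. -/
def wreathHom (X : Type*) [TopologicalSpace X] [MulAction G X] [ContinuousSMul G X]
    [IsFiniteMeasure (volume : Measure Ω)] : MWreath G Ω →* Equiv.Perm (L0 Ω X) :=
  SemidirectProduct.lift (MulAction.toPermHom (L0 Ω G) (L0 Ω X))
    (MulAction.toPermHom (MPAut Ω) (L0 Ω X)) (fun e => by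
      ext g r
      show (e • g) • r = e • g • e⁻¹ • r
      rw [MPAut.smul_smul_L0, smul_inv_smul])

end Wreath

/-! ## The homomorphism `ι` -/

section Iota

instance {Ω : Type*} [MeasureSpace Ω] : Nonempty (Aux Ω) := ⟨L0.const Ω 0⟩

theorem not_countable_unitInterval : ¬ Countable I := fun h =>
  absurd ((Cardinal.Real.Icc_countable_iff (x := 0) (y := 1)).1 h) (by norm_num)

/-- A Borel isomorphism of the unit square with the unit interval. -/
def squareEquiv : (I × I) ≃ᵐ I :=
  PolishSpace.measurableEquivOfNotCountable
    (fun _ => not_countable_unitInterval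
      (Function.Injective.countable (f := fun x : I => (x, x)) fun _ _ h => congrArg Prod.fst h))
    not_countable_unitInterval

/-- The identification of `[0,1]^{I × I}` with `([0,1]^I)^I`. -/
abbrev curryI : Aux (I × I) ≃ L0 I (Aux I) := L0.curryEquiv I I

theorem curryI_compl (R : Aux (I × I)) :
    curryI R.compl = L0.map Aux.compl Aux.continuous_compl (curryI R) := by
  refine L0.ext ?_
  filter_upwards [L0.coeFn_curryEquiv R, L0.coeFn_curryEquiv R.compl,
    L0.coeFn_map Aux.compl Aux.continuous_compl (curryI R), L0.curry_congr R.coeFn_compl]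
    with ω₀ h1 h2 h3 h4
  rw [h2, h3, h1]
  refine L0.ext ?_
  filter_upwards [h4, Aux.coeFn_compl (L0.curry R ω₀), L0.coeFn_curry R ω₀] with ω₁ h5 h6 h7
  rw [h5, h6, h7]

theorem curryI_half (R : Aux (I × I)) :
    curryI R.half = L0.map Aux.half Aux.continuous_half (curryI R) := by
  refine L0.ext ?_
  filter_upwards [L0.coeFn_curryEquiv R, L0.coeFn_curryEquiv R.half,
    L0.coeFn_map Aux.half Aux.continuous_half (curryI R), L0.curry_congr R.coeFn_half]
    with ω₀ h1 h2 h3 h4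
  rw [h2, h3, h1]
  refine L0.ext ?_
  filter_upwards [h4, Aux.coeFn_half (L0.curry R ω₀), L0.coeFn_curry R ω₀] with ω₁ h5 h6 h7
  rw [h5, h6, h7]

theorem curryI_tsub (R S : Aux (I × I)) :
    curryI (R.tsub S) = L0.map₂ Aux.tsub Aux.continuous_uncurry_tsub (curryI R) (curryI S) := by
  refine L0.ext ?_
  filter_upwards [L0.coeFn_curryEquiv R, L0.coeFn_curryEquiv S, L0.coeFn_curryEquiv (R.tsub S),
    L0.coeFn_map₂ Aux.tsub Aux.continuous_uncurry_tsub (curryI R) (curryI S),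
    L0.curry_congr (R.coeFn_tsub S)] with ω₀ h1 h1' h2 h3 h4
  rw [h2, h3, h1, h1']
  refine L0.ext ?_
  filter_upwards [h4, Aux.coeFn_tsub (L0.curry R ω₀) (L0.curry S ω₀), L0.coeFn_curry R ω₀,
    L0.coeFn_curry S ω₀] with ω₁ h5 h6 h7 h8
  rw [h5, h6, h7, h8]

/-- The action of the wreath product on the auxiliary sort. -/
def wreathAux : MWreath (MPAut I) I →* Equiv.Perm (Aux (I × I)) :=
  (curryI.symm.permCongrHom : _ →* _).comp (wreathHom I (MPAut I) (Aux I))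

theorem curryI_wreathAux (x : MWreath (MPAut I) I) (R : Aux (I × I)) :
    curryI (wreathAux x R) = x.left • x.right • curryI R :=
  curryI.apply_symm_apply _

/-- After currying, distance and arithmetic are computed section by section, so they commute both
with permuting the sections and with acting on each of them. -/
theorem isAuxHom_wreathAux (x : MWreath (MPAut I) I) : IsAuxHom (wreathAux x) := by
  refine IsAuxHom.of_dist (fun R S => ?_) (fun R => curryI.injective ?_)
    (fun R => curryI.injective ?_) (fun R S => curryI.injective ?_)
  · rw [← L0.dist_curryEquiv, curryI_wreathAux, curryI_wreathAux, L0.dist_smul MPAut.dist_smul,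
      MPAut.dist_smul, L0.dist_curryEquiv]
  · rw [curryI_wreathAux, curryI_compl, curryI_compl, curryI_wreathAux, MPAut.smul_map,
      L0.smul_map _ _ fun t R => t.isAuxHom.compl R]
  · rw [curryI_wreathAux, curryI_half, curryI_half, curryI_wreathAux, MPAut.smul_map,
      L0.smul_map _ _ fun t R => t.isAuxHom.half R]
  · rw [curryI_wreathAux, curryI_tsub, curryI_tsub, curryI_wreathAux, curryI_wreathAux,
      MPAut.smul_map₂, L0.smul_map₂ _ _ fun t R S => t.isAuxHom.tsub R S]

/-- The homomorphism from the wreath product to the transformations of the unit square. -/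
def iota : MWreath (MPAut I) I →* MPAut (I × I) :=
  -- The transformation is merely chosen, but `Aut(I × I)` acts faithfully on the auxiliary sort, so
  -- the choice is unique and therefore multiplicative.
  MonoidHom.mk' (fun x => ((isAuxHom_wreathAux x).exists_MPAut squareEquiv).choose) (fun x y => by
    refine MPAut.eq_of_smul_eq squareEquiv fun R => ?_
    rw [((isAuxHom_wreathAux (x * y)).exists_MPAut squareEquiv).choose_spec, mul_smul,
      ((isAuxHom_wreathAux y).exists_MPAut squareEquiv).choose_spec,
      ((isAuxHom_wreathAux x).exists_MPAut squareEquiv).choose_spec, map_mul]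
    rfl)

theorem iota_smul (x : MWreath (MPAut I) I) (R : Aux (I × I)) : iota x • R = wreathAux x R :=
  ((isAuxHom_wreathAux x).exists_MPAut squareEquiv).choose_spec R

theorem curryI_iota_smul (x : MWreath (MPAut I) I) (R : Aux (I × I)) :
    curryI (iota x • R) = x.left • x.right • curryI R := by
  rw [iota_smul, curryI_wreathAux]

theorem curry_iota_smul (h : L0 I (MPAut I)) (e : mpGroup I) (R : Aux (I × I)) :
    ∀ᵐ ω₀, (iota ⟨h, MPAut.mk e⟩ • R).curry ω₀ = h ω₀ • R.curry (e.1.symm ω₀) := by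
  filter_upwards [L0.coeFn_curryEquiv (iota ⟨h, MPAut.mk e⟩ • R),
    L0.coeFn_eq (curryI_iota_smul ⟨h, MPAut.mk e⟩ R), L0.coeFn_smul h (MPAut.mk e • curryI R),
    L0.coeFn_shift e (curryI R), e.2.2.quasiMeasurePreserving.ae (L0.coeFn_curryEquiv R)]
    with ω h1 h2 h3 h4 h5
  rw [← h1, h2]
  refine h3.trans ?_
  rw [MPAut.mk_smul, h4, h5]

/-! ### The action of `ι` on random variables pulled back from `Ω₀` -/

theorem continuous_const_aux : Continuous (L0.const I : I → Aux I) := by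
  refine (LipschitzWith.of_dist_le_mul (K := 1) fun x y => ?_).continuous
  rw [NNReal.coe_one, one_mul]
  refine (L0.dist_le_of_forall (C := dist x y) _ _ ?_).trans (by simp)
  filter_upwards [L0.coeFn_const (Ω := I) x, L0.coeFn_const (Ω := I) y] with ω h1 h2
  rw [h1, h2]

theorem curryI_pullFst (R : Aux I) :
    curryI (L0.pullFst R) = L0.map (L0.const I) continuous_const_aux R := by
  refine L0.ext ?_
  filter_upwards [L0.coeFn_curryEquiv (L0.pullFst R : Aux (I × I)),
    L0.coeFn_map (L0.const I) continuous_const_aux R,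
    L0.curry_congr (L0.coeFn_pullFst (Ω₁ := I) R)] with ω₀ h1 h2 h3
  rw [h1, h2]
  refine L0.ext ?_
  filter_upwards [h3, L0.coeFn_const (Ω := I) (R ω₀)] with ω₁ h4 h5
  rw [h4, h5]

theorem L0.smul_map_const (h : L0 I (MPAut I)) (R : Aux I) :
    h • L0.map (L0.const I) continuous_const_aux R = L0.map (L0.const I) continuous_const_aux R := by
  refine L0.ext ?_
  filter_upwards [L0.coeFn_smul h (L0.map (L0.const I) continuous_const_aux R),
    L0.coeFn_map (L0.const I) continuous_const_aux R] with ω h1 h2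
  rw [h1, h2, MPAut.smul_const]

/-- A pulled-back variable has constant sections, and these are fixed by the fibre transformations.
-/
theorem iota_smul_pullFst_aux (x : MWreath (MPAut I) I) (R : Aux I) :
    iota x • (L0.pullFst R : Aux (I × I)) = L0.pullFst (x.right • R) := by
  refine curryI.injective ?_
  rw [curryI_iota_smul, curryI_pullFst, curryI_pullFst, MPAut.smul_map, L0.smul_map_const]

/-- Testing the `[0,1]`-valued case on the coordinate of `Ω₀` shows that `ι(x)⁻¹` acts on first
coordinates as `e⁻¹`; this settles arbitrary values. -/
theorem iota_smul_pullFst {X : Type*} [TopologicalSpace X] (x : MWreath (MPAut I) I) (r : L0 I X) :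
    iota x • (L0.pullFst r : L0 (I × I) X) = L0.pullFst (x.right • r) := by
  obtain ⟨E, hE⟩ := MPAut.mk_surjective (iota x)
  obtain ⟨e, he⟩ := MPAut.mk_surjective x.right
  let J : Aux I := L0.mk id stronglyMeasurable_id.aestronglyMeasurable
  have hJ : ∀ᵐ ω, J ω = ω := L0.coeFn_mk _ _
  have fst_ae : ∀ {p : I → Prop}, (∀ᵐ ω, p ω) → ∀ᵐ ω : I × I, p ω.1 := fun h =>
    (measurePreserving_fst (μ := (volume : Measure I))
      (ν := (volume : Measure I))).quasiMeasurePreserving.ae h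
  have key : ∀ᵐ ω : I × I, (E.1.symm ω).1 = e.1.symm ω.1 := by
    have h1 := iota_smul_pullFst_aux x J
    rw [← hE, ← he, MPAut.mk_smul, MPAut.mk_smul] at h1
    have hp : ∀ᵐ ω : I × I, (L0.pullFst J : Aux (I × I)) ω = ω.1 := by
      filter_upwards [L0.coeFn_pullFst (Ω₁ := I) J, fst_ae hJ] with ω h2 h3
      rw [h2, h3]
    filter_upwards [L0.coeFn_eq h1, L0.coeFn_shift E (L0.pullFst J : Aux (I × I)),
      E.2.2.quasiMeasurePreserving.ae hp, L0.coeFn_pullFst (Ω₁ := I) (L0.shift e J),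
      fst_ae (L0.coeFn_shift e J), fst_ae (e.2.2.quasiMeasurePreserving.ae hJ)]
      with ω h1 h2 h3 h4 h5 h6
    rw [← h3, ← h2, h1, h4, h5, h6]
  rw [← hE, ← he, MPAut.mk_smul, MPAut.mk_smul]
  refine L0.ext ?_
  filter_upwards [L0.coeFn_shift E (L0.pullFst r : L0 (I × I) X),
    E.2.2.quasiMeasurePreserving.ae (L0.coeFn_pullFst (Ω₁ := I) r),
    L0.coeFn_pullFst (Ω₁ := I) (L0.shift e r), fst_ae (L0.coeFn_shift e r), key]
    with ω h1 h2 h3 h4 h5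
  rw [h1, h2, h3, h4, h5]

/-! ### The range of `ι` -/

theorem L0.pullFst_map {X Y : Type*} [TopologicalSpace X] [TopologicalSpace Y] (f : X → Y)
    (hf : Continuous f) (r : L0 I X) :
    (L0.pullFst (L0.map f hf r) : L0 (I × I) Y) = L0.map f hf (L0.pullFst r) := by
  refine L0.ext ?_
  filter_upwards [L0.coeFn_pullFst (Ω₁ := I) (L0.map f hf r), L0.coeFn_pullFst (Ω₁ := I) r,
    L0.coeFn_map f hf (L0.pullFst r : L0 (I × I) X),
    (measurePreserving_fst (μ := (volume : Measure I))
      (ν := (volume : Measure I))).quasiMeasurePreserving.ae (L0.coeFn_map f hf r)] with ω h1 h2 h3 h4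
  rw [h1, h3, h4, h2]

theorem L0.pullFst_map₂ {X Y Z : Type*} [TopologicalSpace X] [TopologicalSpace Y]
    [TopologicalSpace Z] (f : X → Y → Z) (hf : Continuous (Function.uncurry f)) (r : L0 I X)
    (s : L0 I Y) : (L0.pullFst (L0.map₂ f hf r s) : L0 (I × I) Z) =
      L0.map₂ f hf (L0.pullFst r) (L0.pullFst s) := by
  refine L0.ext ?_
  filter_upwards [L0.coeFn_pullFst (Ω₁ := I) (L0.map₂ f hf r s), L0.coeFn_pullFst (Ω₁ := I) r,
    L0.coeFn_pullFst (Ω₁ := I) s,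
    L0.coeFn_map₂ f hf (L0.pullFst r : L0 (I × I) X) (L0.pullFst s),
    (measurePreserving_fst (μ := (volume : Measure I))
      (ν := (volume : Measure I))).quasiMeasurePreserving.ae (L0.coeFn_map₂ f hf r s)]
    with ω h1 h2 h2' h3 h4
  rw [h1, h3, h4, h2, h2']

/-- The pullback is an isometric embedding that commutes with the arithmetic, so the permutation of
`[0,1]^{Ω₀}` induced by `t` is again an automorphism and comes from the base. -/
theorem exists_base_of_image_range (t : MPAut (I × I))
    (h : (fun R : Aux (I × I) => t • R) '' Set.range (L0.pullFst : Aux I → Aux (I × I)) =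
      Set.range (L0.pullFst : Aux I → Aux (I × I))) :
    ∃ e : MPAut I, ∀ R : Aux I, t • (L0.pullFst R : Aux (I × I)) = L0.pullFst (e • R) := by
  obtain ⟨τ, hτ⟩ := exists_perm_of_image_range
    (L0.pullFst_injective (Ω₀ := I) (Ω₁ := I) (X := I)) (MulAction.toPerm t) h
  have hτ' : ∀ R, (L0.pullFst (τ R) : Aux (I × I)) = t • L0.pullFst R := hτ
  have hi := L0.pullFst_injective (Ω₀ := I) (Ω₁ := I) (X := I)
  have hA : IsAuxHom τ := by
    refine IsAuxHom.of_dist (fun R S => ?_) (fun R => hi ?_) (fun R => hi ?_) (fun R S => hi ?_)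
    · rw [← L0.dist_pullFst (Ω₁ := I), hτ', hτ', MPAut.dist_smul, L0.dist_pullFst]
    · exact (hτ' _).trans ((congrArg (t • ·) (L0.pullFst_map _ _ R)).trans
        ((t.isAuxHom.compl _).trans ((congrArg Aux.compl (hτ' R).symm).trans
        (L0.pullFst_map _ _ (τ R)).symm)))
    · exact (hτ' _).trans ((congrArg (t • ·) (L0.pullFst_map _ _ R)).trans
        ((t.isAuxHom.half _).trans ((congrArg Aux.half (hτ' R).symm).trans
        (L0.pullFst_map _ _ (τ R)).symm)))
    · exact (hτ' _).trans ((congrArg (t • ·) (L0.pullFst_map₂ _ _ R S)).trans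
        ((t.isAuxHom.tsub _ _).trans ((congrArg₂ Aux.tsub (hτ' R).symm (hτ' S).symm).trans
        (L0.pullFst_map₂ _ _ (τ R) (τ S)).symm)))
  obtain ⟨e, he⟩ := hA.exists_MPAut (MeasurableEquiv.refl I)
  exact ⟨e, fun R => by rw [he, hτ']⟩

theorem continuous_uncurry_inf : Continuous (Function.uncurry (fun x y : I => x ⊓ y)) :=
  continuous_inf

/-- The indicator of the set `B × I`. -/
def Aux.cylinder (B : Set I) (hB : MeasurableSet B) : Aux I :=
  L0.mk (UnitFun.ind B) (UnitFun.measurable_ind hB).stronglyMeasurable.aestronglyMeasurable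

/-- Cutting both variables down to `B × I` erases the sections outside `B`. This expresses a
localized distance by operations that `t` respects. -/
theorem dist_inf_cylinder (R S : Aux (I × I)) (B : Set I) (hB : MeasurableSet B) :
    dist (L0.map₂ _ continuous_uncurry_inf R (L0.pullFst (Aux.cylinder B hB)))
      (L0.map₂ _ continuous_uncurry_inf S (L0.pullFst (Aux.cylinder B hB))) =
      ∫ ω in B, dist (curryI R ω) (curryI S ω) := by
  rw [L0.dist_eq_integral_curry, ← integral_indicator hB]
  refine integral_congr_ae ?_
  have hb : ∀ᵐ ω : I × I, (L0.pullFst (Aux.cylinder B hB) : Aux (I × I)) ω = UnitFun.ind B ω.1 := by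
    filter_upwards [L0.coeFn_pullFst (Ω₁ := I) (Aux.cylinder B hB),
      (measurePreserving_fst (μ := (volume : Measure I))
        (ν := (volume : Measure I))).quasiMeasurePreserving.ae (L0.coeFn_mk (UnitFun.ind B)
        (UnitFun.measurable_ind hB).stronglyMeasurable.aestronglyMeasurable)] with ω h1 h2
    exact h1.trans h2
  have hR : ∀ R : Aux (I × I), ∀ᵐ ω : I × I,
      L0.map₂ _ continuous_uncurry_inf R (L0.pullFst (Aux.cylinder B hB)) ω =
        R ω ⊓ UnitFun.ind B ω.1 := fun R => by
    filter_upwards [hb, L0.coeFn_map₂ _ continuous_uncurry_inf R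
      (L0.pullFst (Aux.cylinder B hB))] with ω h1 h2
    rw [h2, h1]
  filter_upwards [L0.curry_congr (hR R), L0.curry_congr (hR S), L0.coeFn_curryEquiv R,
    L0.coeFn_curryEquiv S] with ω₀ h1 h2 h3 h4
  by_cases hω : ω₀ ∈ B
  · rw [Set.indicator_of_mem hω, h3, h4]
    congr 1
    · refine L0.ext ?_
      filter_upwards [h1, L0.coeFn_curry R ω₀] with ω₁ h5 h6
      rw [h5, h6, UnitFun.ind_of_mem hω, inf_eq_left]
      exact unitInterval.le_one'
    · refine L0.ext ?_
      filter_upwards [h2, L0.coeFn_curry S ω₀] with ω₁ h5 h6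
      rw [h5, h6, UnitFun.ind_of_mem hω, inf_eq_left]
      exact unitInterval.le_one'
  · rw [Set.indicator_of_notMem hω, dist_eq_zero]
    refine L0.ext ?_
    filter_upwards [h1, h2] with ω₁ h5 h6
    rw [h5, h6, UnitFun.ind_of_notMem hω, inf_eq_right.2 unitInterval.nonneg',
      inf_eq_right.2 unitInterval.nonneg']

/-- Since `t` fixes every cylinder, it preserves the distance localized to any `B`; two integrable
functions with equal integrals over all measurable sets agree almost everywhere. -/
theorem dist_curryI_smul (t : MPAut (I × I))
    (ht : ∀ R : Aux I, t • (L0.pullFst R : Aux (I × I)) = L0.pullFst R) (R S : Aux (I × I)) :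
    ∀ᵐ ω, dist (curryI (t • R) ω) (curryI (t • S) ω) = dist (curryI R ω) (curryI S ω) := by
  refine Integrable.ae_eq_of_forall_setIntegral_eq _ _ (L0.integrable_dist _ _)
    (L0.integrable_dist _ _) fun B hB _ => ?_
  rw [← dist_inf_cylinder _ _ B hB, ← dist_inf_cylinder _ _ B hB,
    ← MPAut.dist_smul t (L0.map₂ _ _ R _), MPAut.smul_map₂, MPAut.smul_map₂, ht]

/-- The permutation of `([0,1]^I)^I` obtained by currying `t` preserves distances and arithmetic
pointwise, so `exists_L0_MPAut` supplies the fibre transformations. -/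
theorem exists_fiber (t : MPAut (I × I))
    (ht : ∀ R : Aux I, t • (L0.pullFst R : Aux (I × I)) = L0.pullFst R) :
    ∃ h : L0 I (MPAut I), iota ⟨h, 1⟩ = t := by
  let ρ : Equiv.Perm (L0 I (Aux I)) := curryI.permCongr (MulAction.toPerm t)
  have hρ : ∀ r, ρ r = curryI (t • curryI.symm r) := fun r => rfl
  have hmap : ∀ (f : Aux I → Aux I) (hf : Continuous f) (F : Aux (I × I) → Aux (I × I)),
      (∀ R, curryI (F R) = L0.map f hf (curryI R)) → (∀ R, t • F R = F (t • R)) →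
      ∀ R : Aux I, ∀ᵐ ω, ρ (L0.const I (f R)) ω = f (ρ (L0.const I R) ω) := by
    intro f hf F hF htF R
    have h1 : ρ (L0.const I (f R)) = L0.map f hf (ρ (L0.const I R)) := by
      rw [hρ, hρ, ← hF, ← htF]
      congr 2
      rw [Equiv.symm_apply_eq, hF, Equiv.apply_symm_apply, L0.map_const]
    rw [h1]
    exact L0.coeFn_map f hf _
  have hdist : ∀ r s : L0 I (Aux I), ∀ᵐ ω, dist (ρ r ω) (ρ s ω) = dist (r ω) (s ω) := fun r s => by
    have := dist_curryI_smul t ht (curryI.symm r) (curryI.symm s)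
    simpa only [hρ, Equiv.apply_symm_apply] using this
  have htsub : ∀ R S : Aux I, ∀ᵐ ω, ρ (L0.const I (R.tsub S)) ω =
      (ρ (L0.const I R) ω).tsub (ρ (L0.const I S) ω) := fun R S => by
    have h1 : ρ (L0.const I (R.tsub S)) = L0.map₂ Aux.tsub Aux.continuous_uncurry_tsub
        (ρ (L0.const I R)) (ρ (L0.const I S)) := by
      rw [hρ, hρ, hρ, ← curryI_tsub, ← t.isAuxHom.tsub]
      congr 2
      rw [Equiv.symm_apply_eq, curryI_tsub, Equiv.apply_symm_apply, Equiv.apply_symm_apply]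
      refine L0.ext ?_
      filter_upwards [L0.coeFn_const (Ω := I) (R.tsub S), L0.coeFn_const (Ω := I) R,
        L0.coeFn_const (Ω := I) S, L0.coeFn_map₂ Aux.tsub Aux.continuous_uncurry_tsub
          (L0.const I R) (L0.const I S)] with ω h1 h2 h3 h4
      rw [h1, h4, h2, h3]
    rw [h1]
    exact L0.coeFn_map₂ _ _ _ _
  obtain ⟨h, hh⟩ := exists_L0_MPAut (MeasurableEquiv.refl I) ρ hdist
    (hmap _ Aux.continuous_compl _ curryI_compl t.isAuxHom.compl)
    (hmap _ Aux.continuous_half _ curryI_half t.isAuxHom.half) htsub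
  refine ⟨h, MPAut.eq_of_smul_eq squareEquiv fun R => curryI.injective ?_⟩
  rw [curryI_iota_smul]
  show h • (1 : MPAut I) • curryI R = _
  rw [one_smul, ← hh, hρ, Equiv.symm_apply_apply]

/-- The range of `ι` consists of the transformations that fix the factor setwise. -/
theorem exists_iota_eq (t : MPAut (I × I))
    (h : (fun R : Aux (I × I) => t • R) '' Set.range (L0.pullFst : Aux I → Aux (I × I)) =
      Set.range (L0.pullFst : Aux I → Aux (I × I))) : ∃ x, iota x = t := by
  obtain ⟨e, he⟩ := exists_base_of_image_range t h
  obtain ⟨k, hk⟩ := exists_fiber (t * (iota ⟨1, e⟩)⁻¹) fun R => by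
    rw [mul_smul, ← map_inv, iota_smul_pullFst_aux, he, smul_smul]
    have : e * (⟨1, e⟩ : MWreath (MPAut I) I)⁻¹.right = 1 := mul_inv_cancel e
    rw [this, one_smul]
  exact ⟨⟨k, 1⟩ * ⟨1, e⟩, by rw [map_mul, hk, inv_mul_cancel_right]⟩

theorem iota_injective : Function.Injective iota := by
  rw [injective_iff_map_eq_one]
  intro x hx
  have h1 : x.right = 1 := by
    refine MPAut.eq_of_smul_eq (MeasurableEquiv.refl I) fun R => ?_
    refine L0.pullFst_injective (Ω₀ := I) (Ω₁ := I) ?_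
    rw [← iota_smul_pullFst_aux, hx, one_smul, one_smul]
  have h2 : x.left = 1 := by
    refine L0.eq_of_smul_eq (X := Aux I) MPAut.dist_smul
      (fun _ _ => MPAut.eq_of_smul_eq (MeasurableEquiv.refl I)) fun r => ?_
    have := curryI_iota_smul x (curryI.symm r)
    rw [hx, h1, one_smul, one_smul, Equiv.apply_symm_apply] at this
    rw [one_smul, ← this]
  exact SemidirectProduct.ext h2 h1

end Iota

/-! ## Automorphisms preserve formulas -/

section Formulas

variable {L : Language.{u}} {M : Structure.{u, w} L}

theorem Structure.aut_funMap (g : M.Aut) {n : ℕ} (f : L.Functions n) (a : Fin n → M) :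
    g • M.funMap f a = M.funMap f fun i => g • a i := g.2.2.1 n f a

theorem Structure.aut_relMap (g : M.Aut) {n : ℕ} (R : L.Relations n) (a : Fin n → M) :
    (M.relMap R fun i => g • a i) = M.relMap R a := g.2.2.2 n R a

theorem Term.eval_smul (g : M.Aut) {n : ℕ} (t : Term L n) (a : Fin n → M) :
    t.eval M (fun i => g • a i) = g • t.eval M a := by
  induction t with
  | var i => rfl
  | app f ts ih =>
    simp only [Term.eval, ih]
    exact (M.aut_funMap g f _).symm

theorem Formula.eval_smul (g : M.Aut) {n : ℕ} (φ : Formula L n) (a : Fin n → M) :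
    φ.eval M (fun i => g • a i) = φ.eval M a := by
  have hsnoc : ∀ {n : ℕ} (a : Fin n → M) (b : M),
      (Fin.snoc (α := fun _ => M) (fun i => g • a i) (g • b) : Fin (n + 1) → M) =
        fun i => g • (Fin.snoc (α := fun _ => M) a b : Fin (n + 1) → M) i := by
    intro n a b
    funext i
    refine Fin.lastCases ?_ (fun j => ?_) i <;> simp
  induction φ with
  | dist t s =>
    refine Subtype.ext ?_
    simp only [Formula.eval, Term.eval_smul]
    exact M.aut_dist g _ _
  | rel R ts =>
    simp only [Formula.eval, Term.eval_smul]
    exact M.aut_relMap g R _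
  | conn c φs ih => simp only [Formula.eval, ih]
  | sup φ ih =>
    simp only [Formula.eval]
    -- The quantified variable may be replaced by its image under the surjection `g`.
    refine ((MulAction.surjective g).iSup_comp _).symm.trans ?_
    simp only [hsnoc, ih]
  | inf φ ih =>
    simp only [Formula.eval]
    refine ((MulAction.surjective g).iInf_comp _).symm.trans ?_
    simp only [hsnoc, ih]

variable {Ω : Type*} [MeasureSpace Ω]

theorem Formula.coeFn_rv {n : ℕ} (φ : Formula L n) (r : Fin n → L0 Ω M) :
    ∀ᵐ ω, φ.rv M r ω = φ.eval M fun i => r i ω :=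
  L0.coeFn_mk _ _

theorem Formula.rv_smul (g : L0 Ω M.Aut) {n : ℕ} (φ : Formula L n) (r : Fin n → L0 Ω M) :
    φ.rv M (fun i => g • r i) = φ.rv M r := by
  refine L0.ext ?_
  filter_upwards [φ.coeFn_rv r, φ.coeFn_rv fun i => g • r i,
    ae_all_iff.2 fun i => L0.coeFn_smul g (r i)] with ω h1 h2 h3
  rw [h1, h2]
  simp only [h3]
  exact φ.eval_smul (g ω) _

theorem Formula.rv_shift (t : MPAut Ω) {n : ℕ} (φ : Formula L n) (r : Fin n → L0 Ω M) :
    φ.rv M (fun i => t • r i) = t • φ.rv M r := by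
  obtain ⟨e, rfl⟩ := MPAut.mk_surjective t
  rw [MPAut.mk_smul]
  refine L0.ext ?_
  filter_upwards [φ.coeFn_rv fun i => MPAut.mk e • r i, L0.coeFn_shift e (φ.rv M r),
    e.2.2.quasiMeasurePreserving.ae (φ.coeFn_rv r),
    ae_all_iff.2 fun i => L0.coeFn_shift e (r i)] with ω h1 h2 h3 h4
  rw [h1, h2, h3]
  refine congrArg _ (funext fun i => ?_)
  rw [MPAut.mk_smul, h4]

variable [IsFiniteMeasure (volume : Measure Ω)]

instance : ContinuousSMul (L0 Ω M.Aut) (L0 Ω M) :=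
  have h : IsInducing fun (g : L0 Ω M.Aut) (r : L0 Ω M) => g • r :=
    L0.isInducing_smul M.aut_dist ⟨rfl⟩
  continuousSMul_of_pointwise (L0.dist_smul M.aut_dist) h

/-- The automorphism `r ↦ g (t r)`, `R ↦ t R` of the randomization. -/
def RandAut.of (g : L0 Ω M.Aut) (t : MPAut Ω) : RandAut M Ω :=
  ⟨(MulAction.toPerm g * MulAction.toPerm t, MulAction.toPerm t),
    fun r s => (L0.dist_smul M.aut_dist g _ _).trans (MPAut.dist_smul t r s), MPAut.dist_smul t,
    fun n φ r => by
      show φ.rv M (fun i => g • t • r i) = t • φ.rv M r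
      exact (Formula.rv_smul g φ fun i => t • r i).trans (Formula.rv_shift t φ r),
    t.isAuxHom.expect, t.isAuxHom.compl, t.isAuxHom.half, t.isAuxHom.tsub⟩

theorem RandAut.onMain_of (g : L0 Ω M.Aut) (t : MPAut Ω) (r : L0 Ω M) :
    (RandAut.of g t).onMain r = g • t • r := rfl

theorem RandAut.onAux_of (g : L0 Ω M.Aut) (t : MPAut Ω) (R : Aux Ω) :
    (RandAut.of g t).onAux R = t • R := rfl

theorem RandAut.ext {ρ σ' : RandAut M Ω} (h1 : ∀ r, ρ.onMain r = σ'.onMain r)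
    (h2 : ∀ R, ρ.onAux R = σ'.onAux R) : ρ = σ' :=
  Subtype.ext (Prod.ext (Equiv.ext h1) (Equiv.ext h2))

theorem RandAut.isAuxHom (ρ : RandAut M Ω) : IsAuxHom ρ.onAux :=
  ⟨ρ.2.2.1, ρ.2.2.2.2.1, ρ.2.2.2.2.2.1, ρ.2.2.2.2.2.2.1, ρ.2.2.2.2.2.2.2⟩

theorem RandAut.rv_onMain (ρ : RandAut M Ω) {n : ℕ} (φ : Formula L n) (r : Fin n → L0 Ω M) :
    φ.rv M (fun i => ρ.onMain (r i)) = ρ.onAux (φ.rv M r) := ρ.2.2.2.1 n φ r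

theorem RandAut.continuous_onMain (r : L0 Ω M) : Continuous fun ρ : RandAut M Ω => ρ.onMain r :=
  (continuous_apply r).comp
    (continuous_fst.comp (continuous_induced_dom (f := fun ρ : RandAut M Ω => (ρ.onMain, ρ.onAux))))

theorem RandAut.continuous_onAux (R : Aux Ω) : Continuous fun ρ : RandAut M Ω => ρ.onAux R :=
  (continuous_apply R).comp
    (continuous_snd.comp (continuous_induced_dom (f := fun ρ : RandAut M Ω => (ρ.onMain, ρ.onAux))))

/-- Every automorphism of the randomization is of the form `r ↦ g (t r)`, `R ↦ t R`. -/
theorem RandAut.exists_of_onAux (hL : L.IsCountable) [TopologicalSpace.SeparableSpace M]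
    (ρ : RandAut M Ω) (t : MPAut Ω) (ht : ∀ R, ρ.onAux R = t • R) :
    ∃ g : L0 Ω M.Aut, ρ = RandAut.of g t := by
  -- Undoing `t` first leaves a permutation of the main sort that fixes all truth values `⟦φ⟧`.
  let τ : Equiv.Perm (L0 Ω M) := (MulAction.toPerm t⁻¹).trans ρ.1.1
  have hτ : ∀ r, τ r = ρ.onMain (t⁻¹ • r) := fun _ => rfl
  have hrv : ∀ {n : ℕ} (φ : Formula L n) (r : Fin n → L0 Ω M),
      ∀ᵐ ω, φ.eval M (fun i => τ (r i) ω) = φ.eval M fun i => r i ω := by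
    intro n φ r
    have h : φ.rv M (fun i => τ (r i)) = φ.rv M r := by
      simp only [hτ]
      rw [ρ.rv_onMain, Formula.rv_shift, ht, smul_inv_smul]
    filter_upwards [L0.coeFn_eq h, φ.coeFn_rv fun i => τ (r i), φ.coeFn_rv r] with ω h1 h2 h3
    rw [← h2, h1, h3]
  suffices h : ∃ g : L0 Ω M.Aut, ∀ r, τ r = g • r by
    obtain ⟨g, hg⟩ := h
    refine ⟨g, RandAut.ext (fun r => ?_) ht⟩
    rw [onMain_of, ← hg, hτ, inv_smul_smul]
  refine exists_L0_aut hL τ (fun r s => ?_) (fun n f r s => ?_) fun n R r => ?_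
  · filter_upwards [hrv (Formula.dist (Term.var 0) (Term.var 1) : Formula L 2) ![r, s]] with ω h
    exact congrArg Subtype.val h
  -- The formula is `d(f(x_0, …, x_{n-1}), x_n)`, evaluated with `s` as the last variable.
  · filter_upwards [hrv (Formula.dist (Term.app f fun i => Term.var (Fin.castSucc i))
      (Term.var (Fin.last n)) : Formula L (n + 1)) (Fin.snoc (α := fun _ => L0 Ω M) r s)] with ω h
    have h := congrArg Subtype.val h
    simpa [Formula.eval, Term.eval] using h
  · exact hrv (Formula.rel R fun i => Term.var i) r

end Formulas

/-! ## The pair -/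

section PairGroup

variable {L : Language.{u}} {M : Structure.{u, w} L} (N : M.Substructure)

/-- Identities between `N`-valued variables are found over `Ω²`, where `g` lives, but do not depend
on the second coordinate; this brings them down to `Ω₀`. -/
theorem ae_of_ae_fst {p : I → Prop} (h : ∀ᵐ ω : I × I, p ω.1) : ∀ᵐ ω, p ω := by
  filter_upwards [ae_prod h] with ω h1
  exact Filter.eventually_const.1 h1

theorem fst_ae {p : I → Prop} (h : ∀ᵐ ω, p ω) : ∀ᵐ ω : I × I, p ω.1 :=
  (measurePreserving_fst (μ := (volume : Measure I))
    (ν := (volume : Measure I))).quasiMeasurePreserving.ae h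

theorem coeFn_randIncl (r : L0 I N.toStructure) :
    ∀ᵐ ω, randIncl N I I r ω = N.incl (r ω.1) := by
  filter_upwards [L0.coeFn_pullFst (Ω₁ := I) (L0.map N.incl N.continuous_incl r),
    fst_ae (L0.coeFn_map N.incl N.continuous_incl r)] with ω h1 h2
  exact h1.trans h2

theorem Structure.Substructure.incl_injective : Function.Injective N.incl :=
  Subtype.val_injective (p := fun x : M => x ∈ N.carrier)

theorem Structure.Substructure.incl_mem (x : N.toStructure) : N.incl x ∈ N.carrier :=
  (x : N.carrier).2

theorem Structure.Substructure.dist_incl (x y : N.toStructure) :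
    dist (N.incl x) (N.incl y) = dist x y := rfl

theorem randIncl_injective : Function.Injective (randIncl N I I) := fun r s h => by
  refine L0.ext (ae_of_ae_fst ?_)
  filter_upwards [L0.coeFn_eq h, coeFn_randIncl N r, coeFn_randIncl N s] with ω h1 h2 h3
  rw [h2, h3] at h1
  exact N.incl_injective h1

theorem iota_smul_randIncl (x : MWreath (MPAut I) I) (r : L0 I N.toStructure) :
    iota x • randIncl N I I r = randIncl N I I (x.right • r) := by
  rw [randIncl, randIncl, iota_smul_pullFst, MPAut.smul_map]

theorem Structure.Substructure.separableSpace [TopologicalSpace.SeparableSpace M] :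
    TopologicalSpace.SeparableSpace N.toStructure := by
  have : SecondCountableTopology M := UniformSpace.secondCountable_of_separable M
  exact inferInstanceAs (TopologicalSpace.SeparableSpace N.carrier)

/-- The elements of `G^{Ω²}` that fix `N^Ω` setwise belong to `G_P^*`. -/
theorem mem_GPStar_of_image (hL : L.IsCountable) [TopologicalSpace.SeparableSpace M]
    (g : L0 (I × I) M.Aut)
    (h : (fun r : L0 (I × I) M => g • r) '' Set.range (randIncl N I I) =
      Set.range (randIncl N I I)) : g ∈ GPStar N I I := by
  have := N.separableSpace
  obtain ⟨τ, hτ⟩ := exists_perm_of_image_range (randIncl_injective N) (MulAction.toPerm g) h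
  have key : ∀ r : L0 I N.toStructure, ∀ᵐ ω, N.incl (τ r ω.1) = g ω • N.incl (r ω.1) := by
    intro r
    filter_upwards [L0.coeFn_eq (hτ r), coeFn_randIncl N r, coeFn_randIncl N (τ r),
      L0.coeFn_smul g (randIncl N I I r)] with ω h1 h2 h3 h4
    rw [← h3, h1, ← h2]
    exact h4
  suffices h : ∃ k : L0 I N.toStructure.Aut, ∀ r, τ r = k • r by
    obtain ⟨k, hk⟩ := h
    exact ⟨k, fun r => by rw [← hk, hτ]; rfl⟩
  refine exists_L0_aut hL τ (fun r s => ?_) (fun n f r s => ?_) fun n R r => ?_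
  · refine ae_of_ae_fst ?_
    filter_upwards [key r, key s] with ω h1 h2
    rw [← N.dist_incl, h1, h2, M.aut_dist, N.dist_incl]
  · refine ae_of_ae_fst ?_
    filter_upwards [ae_all_iff.2 fun i => key (r i), key s] with ω h1 h2
    have e : ∀ a : Fin n → N.toStructure,
        N.incl (N.toStructure.funMap f a) = M.funMap f fun i => N.incl (a i) := fun _ => rfl
    rw [← N.dist_incl, ← N.dist_incl, e, e, h2]
    simp only [h1]
    rw [← M.aut_funMap, M.aut_dist]
  · refine ae_of_ae_fst ?_
    filter_upwards [ae_all_iff.2 fun i => key (r i)] with ω h1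
    have e : ∀ a : Fin n → N.toStructure,
        N.toStructure.relMap R a = M.relMap R fun i => N.incl (a i) := fun _ => rfl
    rw [e, e]
    simp only [h1]
    exact M.aut_relMap _ _ _

theorem of_mem_pairAut {g : L0 (I × I) M.Aut} (hg : g ∈ GPStar N I I) (x : MWreath (MPAut I) I) :
    RandAut.of g (iota x) ∈ pairAut N I I := by
  obtain ⟨k, hk⟩ := hg
  have h1 : ∀ r, (RandAut.of g (iota x)).onMain (randIncl N I I r) =
      randIncl N I I (k • x.right • r) := fun r => by
    rw [RandAut.onMain_of, iota_smul_randIncl, hk]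
  have h2 : ∀ R : Aux I, (RandAut.of g (iota x)).onAux (L0.pullFst R) =
      L0.pullFst (x.right • R) := fun R => by
    rw [RandAut.onAux_of, iota_smul_pullFst]
  constructor
  · rw [← Set.range_comp]
    refine Set.Subset.antisymm ?_ ?_
    · rintro _ ⟨r, rfl⟩
      exact ⟨_, (h1 r).symm⟩
    · rintro _ ⟨r, rfl⟩
      refine ⟨x.right⁻¹ • k⁻¹ • r, (h1 _).trans ?_⟩
      rw [smul_inv_smul, smul_inv_smul]
  · rw [← Set.range_comp]
    refine Set.Subset.antisymm ?_ ?_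
    · rintro _ ⟨r, rfl⟩
      exact ⟨_, (h2 r).symm⟩
    · rintro _ ⟨r, rfl⟩
      refine ⟨x.right⁻¹ • r, (h2 _).trans ?_⟩
      rw [smul_inv_smul]

/-- The automorphism given by `ι(x)` alone lies in the group of the pair. Multiplying by its inverse
leaves `g`, which therefore fixes `N^Ω` setwise. -/
theorem mem_GPStar_of_of_mem_pairAut (hL : L.IsCountable) [TopologicalSpace.SeparableSpace M]
    {g : L0 (I × I) M.Aut} {x : MWreath (MPAut I) I}
    (h : RandAut.of g (iota x) ∈ pairAut N I I) : g ∈ GPStar N I I := by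
  have h1 : RandAut.of g (iota x) * RandAut.of 1 (iota x⁻¹) = RandAut.of g 1 := by
    refine RandAut.ext (fun r => ?_) fun R => ?_
    · show g • iota x • (1 : L0 (I × I) M.Aut) • iota x⁻¹ • r = g • (1 : MPAut (I × I)) • r
      rw [one_smul, one_smul, map_inv, smul_inv_smul]
    · show iota x • iota x⁻¹ • R = (1 : MPAut (I × I)) • R
      rw [one_smul, map_inv, smul_inv_smul]
  have h2 := mul_mem h (of_mem_pairAut N (one_mem (GPStar N I I)) x⁻¹)
  rw [h1] at h2
  refine mem_GPStar_of_image N hL g ?_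
  have h3 : (RandAut.of g 1).onMain = fun r : L0 (I × I) M => g • r := by
    funext r
    rw [RandAut.onMain_of, one_smul]
  rw [← h3]
  exact h2.1

theorem exists_of_mem_pairAut (hL : L.IsCountable) [TopologicalSpace.SeparableSpace M]
    {ρ : RandAut M (I × I)} (hρ : ρ ∈ pairAut N I I) :
    ∃ (x : MWreath (MPAut I) I) (g : GPStar N I I), ρ = RandAut.of g (iota x) := by
  obtain ⟨t, ht⟩ := IsAuxHom.exists_MPAut (τ := ρ.1.2) ρ.isAuxHom squareEquiv
  have ht' : ρ.onAux = fun R => t • R := funext fun R => (ht R).symm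
  obtain ⟨x, rfl⟩ := exists_iota_eq t (by rw [← ht']; exact hρ.2)
  obtain ⟨g, rfl⟩ := ρ.exists_of_onAux hL (iota x) fun R => (ht R).symm
  exact ⟨x, ⟨g, mem_GPStar_of_of_mem_pairAut N hL hρ⟩, rfl⟩

/-- Almost surely, an element of `G_P^*` acts on `N` as an automorphism of `N`. -/
theorem ae_smul_incl [TopologicalSpace.SeparableSpace M] {g : L0 (I × I) M.Aut}
    {k : L0 I N.toStructure.Aut}
    (hk : ∀ r : L0 I N.toStructure, g • randIncl N I I r = randIncl N I I (k • r)) :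
    ∀ᵐ ω, ∀ x : N.toStructure, g ω • N.incl x = N.incl (k ω.1 • x) := by
  have := N.separableSpace
  let d := TopologicalSpace.denseSeq N.toStructure
  have hd : DenseRange d := TopologicalSpace.denseRange_denseSeq _
  have h1 : ∀ᵐ ω, ∀ n, g ω • N.incl (d n) = N.incl (k ω.1 • d n) := ae_all_iff.2 fun n => by
    filter_upwards [L0.coeFn_eq (hk (L0.const I (d n))),
      L0.coeFn_smul g (randIncl N I I (L0.const I (d n))), coeFn_randIncl N (L0.const I (d n)),
      coeFn_randIncl N (k • L0.const I (d n)), fst_ae (L0.coeFn_smul k (L0.const I (d n))),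
      fst_ae (L0.coeFn_const (Ω := I) (d n))] with ω h1 h2 h3 h4 h5 h6
    rw [h2, h3, h4, h5, h6] at h1
    exact h1
  filter_upwards [h1] with ω h1 x
  have hc1 : Continuous fun x => g ω • N.incl x :=
    (Isometry.of_dist_eq (M.aut_dist (g ω))).continuous.comp N.continuous_incl
  have hc2 : Continuous fun x => N.incl (k ω.1 • x) :=
    N.continuous_incl.comp (Isometry.of_dist_eq (N.toStructure.aut_dist (k ω.1))).continuous
  exact congrFun (hd.equalizer hc1 hc2 (funext h1)) x

/-- Almost surely `g ω` restricts to the automorphism `k ω.1` of `N`. For the converse inclusion, a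
point that is sent into `N` is compared with its `(k ω.1)⁻¹` preimage inside `N`. -/
theorem ae_smul_mem_iff [TopologicalSpace.SeparableSpace M] {g : L0 (I × I) M.Aut}
    (hg : g ∈ GPStar N I I) : ∀ᵐ ω, ∀ x : M, g ω • x ∈ N.carrier ↔ x ∈ N.carrier := by
  obtain ⟨k, hk⟩ := hg
  filter_upwards [ae_smul_incl N hk] with ω h x
  constructor
  · intro hx
    let y : N.toStructure := (⟨_, hx⟩ : N.carrier)
    have h1 := h ((k ω.1)⁻¹ • y)
    rw [smul_inv_smul] at h1
    have h2 : N.incl ((k ω.1)⁻¹ • y) = x := MulAction.injective (g ω) h1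
    rw [← h2]
    exact N.incl_mem _
  · intro hx
    let y : N.toStructure := (⟨x, hx⟩ : N.carrier)
    have h1 : g ω • x = N.incl (k ω.1 • y) := h y
    rw [h1]
    exact N.incl_mem _

theorem mem_GPStar_iff (hL : L.IsCountable) [TopologicalSpace.SeparableSpace M]
    (g : L0 (I × I) M.Aut) : g ∈ GPStar N I I ↔
      (∀ᵐ ω, ∀ x : M, g ω • x ∈ N.carrier ↔ x ∈ N.carrier) ∧
      ∃ ρ ∈ pairAut N I I, (∀ r, ρ.onMain r = g • r) ∧ (∀ R, ρ.onAux R = R) := by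
  constructor
  · refine fun hg => ⟨ae_smul_mem_iff N hg, RandAut.of g (iota 1), of_mem_pairAut N hg 1,
      fun r => ?_, fun R => ?_⟩
    · rw [RandAut.onMain_of, map_one, one_smul]
    · rw [RandAut.onAux_of, map_one, one_smul]
  · rintro ⟨-, ρ, hρ, h1, -⟩
    refine mem_GPStar_of_image N hL g ?_
    rw [← funext h1]
    exact hρ.1

end PairGroup

/-! ## The isomorphism of topological groups -/

section Isomorphism

theorem isInducing_smul_fiber :
    IsInducing fun (h : L0 I (MPAut I)) (r : L0 I (Aux I)) => h • r :=
  L0.isInducing_smul MPAut.dist_smul ⟨rfl⟩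

instance : ContinuousSMul (L0 I (MPAut I)) (L0 I (Aux I)) :=
  continuousSMul_of_pointwise (L0.dist_smul MPAut.dist_smul) isInducing_smul_fiber

theorem continuous_left {N H : Type*} [Group N] [Group H] [TopologicalSpace N] [TopologicalSpace H]
    (θ : H →* MulAut N) : Continuous fun x : N ⋊[θ] H => x.left :=
  continuous_fst.comp (continuous_induced_dom (f := fun x : N ⋊[θ] H => (x.left, x.right)))

theorem continuous_right {N H : Type*} [Group N] [Group H] [TopologicalSpace N] [TopologicalSpace H]
    (θ : H →* MulAut N) : Continuous fun x : N ⋊[θ] H => x.right :=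
  continuous_snd.comp (continuous_induced_dom (f := fun x : N ⋊[θ] H => (x.left, x.right)))

theorem continuous_iota : Continuous iota := by
  rw [continuous_induced_rng, continuous_pi_iff]
  intro R
  rw [(L0.isometry_curryEquiv (Ω₀ := I) (Ω₁ := I)).isUniformInducing.isInducing.continuous_iff]
  have h : (L0.curryEquiv I I) ∘ (fun x : MWreath (MPAut I) I => iota x • R) =
      fun x => x.left • x.right • curryI R := funext fun x => curryI_iota_smul x R
  exact h ▸ (continuous_left _).smul ((continuous_right _).smul continuous_const)

variable {L : Language.{u}} {M : Structure.{u, w} L} (N : M.Substructure)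

theorem iota_smul_mem_GPStar (x : MWreath (MPAut I) I) {g : L0 (I × I) M.Aut}
    (hg : g ∈ GPStar N I I) : iota x • g ∈ GPStar N I I := by
  obtain ⟨k, hk⟩ := hg
  refine ⟨x.right • k, fun r => ?_⟩
  have h1 : randIncl N I I r = iota x • randIncl N I I (x.right⁻¹ • r) := by
    rw [iota_smul_randIncl, smul_inv_smul]
  rw [h1, ← MPAut.smul_smul_L0, hk, iota_smul_randIncl, MPAut.smul_smul_L0, smul_inv_smul]

/-- The action of the wreath product on `G_P^*`. -/
def wreathAct : MWreath (MPAut I) I →* MulAut (GPStar N I I) where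
  toFun x :=
    { toFun := fun g => ⟨iota x • (g : L0 (I × I) M.Aut), iota_smul_mem_GPStar N x g.2⟩
      invFun := fun g => ⟨iota x⁻¹ • (g : L0 (I × I) M.Aut), iota_smul_mem_GPStar N x⁻¹ g.2⟩
      left_inv := fun g => Subtype.ext (by
        show iota x⁻¹ • iota x • (g : L0 (I × I) M.Aut) = g
        rw [map_inv, inv_smul_smul])
      right_inv := fun g => Subtype.ext (by
        show iota x • iota x⁻¹ • (g : L0 (I × I) M.Aut) = g
        rw [map_inv, smul_inv_smul])
      map_mul' := fun g h => Subtype.ext (smul_mul' (iota x) (g : L0 (I × I) M.Aut) h) }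
  map_one' := MulEquiv.ext fun g => Subtype.ext (by
    show iota 1 • (g : L0 (I × I) M.Aut) = g
    rw [map_one, one_smul])
  map_mul' x y := MulEquiv.ext fun g => Subtype.ext (by
    show iota (x * y) • (g : L0 (I × I) M.Aut) = iota x • iota y • (g : L0 (I × I) M.Aut)
    rw [map_mul, mul_smul])

theorem coe_wreathAct (x : MWreath (MPAut I) I) (g : GPStar N I I) :
    (wreathAct N x g : L0 (I × I) M.Aut) = iota x • (g : L0 (I × I) M.Aut) := rfl

theorem isInducing_smul_GPStar :
    IsInducing fun (g : GPStar N I I) (r : L0 (I × I) M) => (g : L0 (I × I) M.Aut) • r :=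
  (L0.isInducing_smul M.aut_dist ⟨rfl⟩).comp IsInducing.subtypeVal

/-- `(ι(x) · g) r = ι(x) (g (ι(x)⁻¹ r))` is a composition of jointly continuous actions by
isometries. -/
theorem continuous_wreathAct :
    Continuous fun p : MWreath (MPAut I) I × GPStar N I I => wreathAct N p.1 p.2 := by
  rw [(isInducing_smul_GPStar N).continuous_iff, continuous_pi_iff]
  intro r
  have h : (fun p : MWreath (MPAut I) I × GPStar N I I =>
      (wreathAct N p.1 p.2 : L0 (I × I) M.Aut) • r) =
      fun p => iota p.1 • (p.2 : L0 (I × I) M.Aut) • (iota p.1)⁻¹ • r := by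
    funext p
    rw [coe_wreathAct, MPAut.smul_smul_L0, smul_inv_smul]
  have h1 : Continuous fun p : MWreath (MPAut I) I × GPStar N I I => iota p.1 :=
    continuous_iota.comp continuous_fst
  have h2 : Continuous fun p : MWreath (MPAut I) I × GPStar N I I =>
      (p.2 : L0 (I × I) M.Aut) := continuous_subtype_val.comp continuous_snd
  have h3 := h1.smul (h2.smul (h1.inv.smul (continuous_const (y := r))))
  exact h ▸ h3

/-- The homomorphism from the semidirect product to the automorphism group of the pair. -/
def pairHom : GPStar N I I ⋊[wreathAct N] MWreath (MPAut I) I →* pairAut N I I :=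
  MonoidHom.mk' (fun x => ⟨RandAut.of x.left (iota x.right), of_mem_pairAut N x.left.2 x.right⟩)
    (fun x y => Subtype.ext (RandAut.ext (fun r => by
        show ((x.left : L0 (I × I) M.Aut) * (iota x.right • (y.left : L0 (I × I) M.Aut))) •
          iota (x.right * y.right) • r =
          (x.left : L0 (I × I) M.Aut) • iota x.right • (y.left : L0 (I × I) M.Aut) •
            iota y.right • r
        rw [mul_smul, map_mul, mul_smul, MPAut.smul_smul_L0 (iota x.right)])
      (fun R => by
        show iota (x.right * y.right) • R = iota x.right • iota y.right • R
        rw [map_mul, mul_smul])))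

theorem onMain_pairHom (x : GPStar N I I ⋊[wreathAct N] MWreath (MPAut I) I) (r : L0 (I × I) M) :
    (pairHom N x : RandAut M (I × I)).onMain r =
      (x.left : L0 (I × I) M.Aut) • iota x.right • r := rfl

theorem onAux_pairHom (x : GPStar N I I ⋊[wreathAct N] MWreath (MPAut I) I) (R : Aux (I × I)) :
    (pairHom N x : RandAut M (I × I)).onAux R = iota x.right • R := rfl

/-- Injectivity: the auxiliary sort determines `ι(x)`, hence `x`, and then the main sort determines
`g`. Surjectivity is the decomposition `exists_of_mem_pairAut`. -/
theorem pairHom_bijective (hL : L.IsCountable) [TopologicalSpace.SeparableSpace M] :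
    Function.Bijective (pairHom N) := by
  have : SecondCountableTopology M := UniformSpace.secondCountable_of_separable M
  constructor
  · rw [injective_iff_map_eq_one]
    intro x hx
    have hr : x.right = 1 := iota_injective (MPAut.eq_of_smul_eq squareEquiv fun R => by
      rw [← onAux_pairHom, hx, map_one, one_smul]; rfl)
    have hl : (x.left : L0 (I × I) M.Aut) = 1 := by
      refine L0.eq_of_smul_eq M.aut_dist (fun _ _ => Structure.aut_ext) fun r => ?_
      have h := onMain_pairHom N x r
      rw [hx, hr, map_one, one_smul] at h
      rw [← h, one_smul]; rfl
    exact SemidirectProduct.ext (Subtype.ext hl) hr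
  · rintro ⟨ρ, hρ⟩
    obtain ⟨x, g, rfl⟩ := exists_of_mem_pairAut N hL hρ
    exact ⟨⟨g, x⟩, rfl⟩

theorem continuous_pairHom : Continuous (pairHom N) := by
  have h1 : Continuous fun x : GPStar N I I ⋊[wreathAct N] MWreath (MPAut I) I => iota x.right :=
    continuous_iota.comp (continuous_right _)
  have h2 : Continuous fun x : GPStar N I I ⋊[wreathAct N] MWreath (MPAut I) I =>
      (x.left : L0 (I × I) M.Aut) := continuous_subtype_val.comp (continuous_left _)
  refine Continuous.subtype_mk ?_ _
  refine continuous_induced_rng.2 (Continuous.prodMk (continuous_pi fun r => ?_)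
    (continuous_pi fun R => ?_))
  · exact h2.smul (h1.smul continuous_const)
  · exact h1.smul continuous_const

/-- The isomorphism of groups between the semidirect product and the automorphism group. -/
def pairMulEquiv (hL : L.IsCountable) [TopologicalSpace.SeparableSpace M] :
    GPStar N I I ⋊[wreathAct N] MWreath (MPAut I) I ≃* pairAut N I I :=
  MulEquiv.ofBijective (pairHom N) (pairHom_bijective N hL)

theorem continuous_pairMulEquiv_symm (hL : L.IsCountable) [TopologicalSpace.SeparableSpace M] :
    Continuous (pairMulEquiv N hL).symm := by
  set Ψ := (pairMulEquiv N hL).symm with hΨ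
  have hinv : ∀ ρ, pairHom N (Ψ ρ) = ρ := (pairMulEquiv N hL).apply_symm_apply
  have hmain : ∀ (ρ : pairAut N I I) (r : L0 (I × I) M), ρ.1.onMain r =
      ((Ψ ρ).left : L0 (I × I) M.Aut) • iota (Ψ ρ).right • r := fun ρ r => by
    rw [← onMain_pairHom, hinv]
  have haux : ∀ (ρ : pairAut N I I) (R : Aux (I × I)), ρ.1.onAux R = iota (Ψ ρ).right • R :=
    fun ρ R => by rw [← onAux_pairHom, hinv]
  have cmain : Continuous fun p : pairAut N I I × L0 (I × I) M => p.1.1.onMain p.2 :=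
    continuous_uncurry_of_isometry (F := fun (ρ : pairAut N I I) r => ρ.1.onMain r)
      (fun ρ => ρ.1.2.1) fun r => (RandAut.continuous_onMain r).comp continuous_subtype_val
  have caux : Continuous fun p : pairAut N I I × Aux (I × I) => p.1.1.onAux p.2 :=
    continuous_uncurry_of_isometry (F := fun (ρ : pairAut N I I) R => ρ.1.onAux R)
      (fun ρ => ρ.1.isAuxHom.dist) fun r => (RandAut.continuous_onAux r).comp continuous_subtype_val
  -- The component `e` is visible on variables pulled back from `Ω₀`, which embed isometrically into
  -- the auxiliary sort.
  have cbase : Continuous fun ρ => (Ψ ρ).right.right := by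
    rw [continuous_induced_rng, continuous_pi_iff]
    intro R
    have hi : Isometry (L0.pullFst : Aux I → Aux (I × I)) := Isometry.of_dist_eq L0.dist_pullFst
    rw [hi.isUniformInducing.isInducing.continuous_iff]
    have h : (L0.pullFst : Aux I → Aux (I × I)) ∘ (fun ρ => (Ψ ρ).right.right • R) =
        fun ρ => ρ.1.onAux (L0.pullFst R) := funext fun ρ => by
      rw [haux, iota_smul_pullFst]; rfl
    exact h ▸ caux.comp (continuous_id.prodMk continuous_const)
  -- Once `e` is known to vary continuously, `h s` is obtained by applying `ρ` to the variable whose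
  -- curried form is `e⁻¹ s`.
  have cfiber : Continuous fun ρ => (Ψ ρ).right.left := by
    rw [isInducing_smul_fiber.continuous_iff, continuous_pi_iff]
    intro s
    have h : (fun ρ => (Ψ ρ).right.left • s) =
        fun ρ => curryI (ρ.1.onAux (curryI.symm ((Ψ ρ).right.right⁻¹ • s))) := funext fun ρ => by
      rw [haux, curryI_iota_smul, Equiv.apply_symm_apply, smul_inv_smul]
    have hc := (L0.isometry_curryEquiv (Ω₀ := I) (Ω₁ := I)).continuous.comp
      (caux.comp (continuous_id.prodMk
        ((L0.isometry_curryEquiv_symm (Ω₀ := I) (Ω₁ := I)).continuous.comp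
          (cbase.inv.smul (continuous_const (y := s))))))
    exact h ▸ hc
  have cright : Continuous fun ρ => (Ψ ρ).right := continuous_induced_rng.2 (cfiber.prodMk cbase)
  have ciota := continuous_iota.comp cright
  -- What remains is `g`, recovered as `g r = ρ (ι(x)⁻¹ r)`, where `ι(x)` is already continuous in
  -- `ρ`.
  refine continuous_induced_rng.2 (Continuous.prodMk ?_ cright)
  rw [(isInducing_smul_GPStar N).continuous_iff, continuous_pi_iff]
  intro r
  have h : (fun ρ => ((Ψ ρ).left : L0 (I × I) M.Aut) • r) =
      fun ρ => ρ.1.onMain ((iota (Ψ ρ).right)⁻¹ • r) := funext fun ρ => by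
    rw [hmain, smul_inv_smul]
  exact h ▸ cmain.comp (continuous_id.prodMk (ciota.inv.smul (continuous_const (y := r))))

/-- The isomorphism of topological groups. -/
def pairContinuousMulEquiv (hL : L.IsCountable) [TopologicalSpace.SeparableSpace M] :
    GPStar N I I ⋊[wreathAct N] MWreath (MPAut I) I ≃ₜ* pairAut N I I :=
  { pairMulEquiv N hL with
    continuous_toFun := continuous_pairHom N
    continuous_invFun := continuous_pairMulEquiv_symm N hL }

end Isomorphism

end

end MetricLogic

/-- `I` is the unit interval with the Lebesgue measure, `Ω₀ = Ω₁ = I` and `Ω² = I × I`. The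
homomorphism `ι` is the action of `Aut(Ω₁) ≀ Ω₀` on `Ω²`: for `h ∈ Aut(Ω₁)^{Ω₀}` and `e ∈ Aut(Ω₀)`,
the pair `(h, e)` acts on `[0,1]^{Ω²} ≃ ([0,1]^{Ω₁})^{Ω₀}` by `R(ω₀, ·) ↦ h(ω₀) R(e⁻¹(ω₀), ·)`. -/
theorem mainTheorem12 {L : MetricLogic.Language.{u}} (hL : L.IsCountable)
    (M : MetricLogic.Structure.{u, w} L) [TopologicalSpace.SeparableSpace M]
    (hcat : M.IsSeparablyCategorical) (hstab : M.IsStable)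
    (N : M.Substructure) (hN : N.IsElementary) :
    -- `G_P^* = (G_P)^{Ω²} ∩ G_P^R`
    (∀ g : L0 (I × I) M.Aut, g ∈ GPStar N I I ↔
      (∀ᵐ ω, ∀ x : M, g ω • x ∈ N.carrier ↔ x ∈ N.carrier) ∧
      ∃ ρ ∈ pairAut N I I, (∀ r, ρ.onMain r = g • r) ∧ (∀ R, ρ.onAux R = R)) ∧
    -- `G_P^R = G_P^* ⋊ (Aut(Ω₁) ≀ Ω₀)` as topological groups
    ∃ (ι : MWreath (MPAut I) I →* MPAut (I × I))
      (θ : MWreath (MPAut I) I →* MulAut (GPStar N I I))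
      (Φ : GPStar N I I ⋊[θ] MWreath (MPAut I) I ≃ₜ* pairAut N I I),
      (∀ (h : L0 I (MPAut I)) (e : mpGroup I) (R : Aux (I × I)), ∀ᵐ ω₀,
        (ι ⟨h, MPAut.mk e⟩ • R).curry ω₀ = h ω₀ • R.curry (e.1.symm ω₀)) ∧
      (∀ (x : MWreath (MPAut I) I) (g : GPStar N I I),
        (θ x g : L0 (I × I) M.Aut) = ι x • (g : L0 (I × I) M.Aut)) ∧
      Continuous (fun p : MWreath (MPAut I) I × GPStar N I I => θ p.1 p.2) ∧
      (∀ (g : GPStar N I I) (x : MWreath (MPAut I) I),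
        (∀ r : L0 (I × I) M,
          (Φ ⟨g, x⟩ : RandAut M (I × I)).onMain r = (g : L0 (I × I) M.Aut) • ι x • r) ∧
        (∀ R : Aux (I × I), (Φ ⟨g, x⟩ : RandAut M (I × I)).onAux R = ι x • R)) := by
  refine ⟨mem_GPStar_iff N hL, iota, wreathAct N, pairContinuousMulEquiv N hL, curry_iota_smul,
    fun _ _ => rfl, continuous_wreathAct N, fun _ _ => ⟨fun _ => rfl, fun _ => rfl⟩⟩
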